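/- **Setting.** A toy top has moments of inertia $C>0$ about its symmetry axis and $A>0$ about perpendicular axes through the centre of mass; $s>0$ is the distance from tip to centre of mass, $\mu>0$ is $s$ times the mass, and gravity is $1$. Identify $\mathbb R^3$ with $\mathrm{su}(2)$, with $\langle x,y\rangle=-2\,\mathrm{Tr}(xy)$ and $k_0=\tfrac12\mathrm{diag}(i,-i)$ the upward vertical. For $\Phi=\begin{pmatrix}\alpha&\beta\\\gamma&\delta\end{pmatrix}\in \mathrm{SU}(2)$ put $r=\Phi k_0\Phi^{-1}$ and $u=\langle r,k_0\rangle$. The Lagrangian is $\mathcal L(\Phi,\omega)=\mathcal T-V$ with $$\mathcal T=\tfrac A2\langle\omega,\omega\rangle+\tfrac{C-A}2\langle\omega,r\rangle^2+\tfrac{\mu s}2\langle[r,k_0],\omega\rangle^2,\qquad V=\mu\langle r,k_0\rangle ,$$ and $m=\partial\mathcal L/\partial\omega$. A motion $t\mapsto\Phi(t)\in \mathrm{SU}(2)$, $t\in\mathbb R$, with angular velocity $\omega(t)\in\mathrm{su}(2)$, satisfies $\Phi'=\omega\Phi$ and $m'=[\omega,m]+D\mathcal L$, where $\langle D\mathcal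 L,\eta\rangle=\frac{d}{d\varepsilon}\mathcal L(e^{\varepsilon\eta}\Phi,\omega)|_{\varepsilon=0}$ for $\eta\in\mathrm{su}(2)$. First integrals are $h=\mathcal T+V$, $\lambda=\langle m,k_0\rangle$, $n=\langle m,r\rangle$. The dynamical constants $-1\le e_1\le e_2\le1\le e_3$ are the roots of the polynomial in $v$ $$\tfrac1\mu(1-v^2)\Big(h-\tfrac{n^2}{2C}-\mu v\Big)-\tfrac1{2A\mu}(\lambda-nv)^2=(v-e_1)(v-e_2)(v-e_3).$$ Put $e_4=\sqrt{1+A/(\mu s)}>1$. **Aperiodic case.** Let $\Phi$ be a motion with $e_2=e_3=1$ and $-1<e_1<1$, and let $u=e_1$ at $t=0$. Assume that at $t=0$ the number $\alpha$ is real and positive and $\beta$ is imaginary with positive imaginary part (so $\delta=\alpha$, $\gamma=\beta$ there). Let $R(u)=4(u-e_1)(u^2-e_4^2)$ and consider the elliptic curve $w^2=R(u)$. Let $$\omega_1=-i\int_{e_1}^{e_4}\frac{du}{\sqrt{-R(u)}},\qquad \omega_2=\int_{-e_4}^{e_1}\frac{du}{\sqrt{R(u)}},\qquad \omega_3=\omega_1+\omega_2,$$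 and let $\wp,\zeta,\sigma$ be the Weierstrass functions of the lattice $\Lambda=2\omega_1\mathbb Z+2\omega_2\mathbb Z$. The uniformizing variable $x=\int du/w$, with $u=\wp(x-\omega_3)+\frac{e_1}3$ and $w=\wp'(x-\omega_3)$, is given along the motion by $$x(t)=\int_0^t\frac{u-1}{i\sqrt{2s}\,(u^2-e_4^2)}\,dt .$$ Put $w_{-1}=\sqrt{s/2}\,(1-e_4^2)(\lambda+n)/A$ (a value of $w$ over $u=-1$) and let $w_{+1}$ be either value of $w$ over $u=1$. Let $a$ and $b$ be any points of the $x$-plane corresponding to $(u,w)=(-1,w_{-1})$ and $(u,w)=(1,w_{+1})$. Define $$p=\frac12\,\frac{w_{-1}}{w_{+1}},\qquad k=\sqrt{\frac{1+e_1}2}\,\frac{\sigma(\omega_3)}{\sigma(a)},$$ $$l=\frac{w_{-1}}4-\frac{w_{-1}}{1-e_4^2}+\zeta(a-\omega_3)-p\big(\zeta(a+b)-\zeta(a-b)\big).$$ **Proposition.** For all $t$, $u=\wp(x(t)-\omega_3)+\frac{e_1}3$. With $x=x(t)$, the motion is $$\Phi(t)=\begin{pmatrix}\alpha(x)&\beta(x)\\\gamma(x)&\delta(x)\end{pmatrix}\begin{pmatrix}e^{i\tau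 t/2}&0\\0&e^{-i\tau t/2}\end{pmatrix},\qquad \tau=\Big(\frac1C-\frac1A\Big)n$$ (so the last factor is the identity for a spherical top, $A=C$), where $$\alpha(x)=k\,e^{lx-i\pi p}\,\frac{\sigma(x-a)}{\sigma(x-\omega_3)}\Big(\frac{\sigma(x+b)}{\sigma(x-b)}\Big)^p,\qquad \beta(x)=\gamma(x)=i\sqrt{\frac{1-u}2},$$ $$\delta(x)=k\,e^{-lx+i\pi p}\,\frac{\sigma(x+a)}{\sigma(x+\omega_3)}\Big(\frac{\sigma(x-b)}{\sigma(x+b)}\Big)^p .$$ The branches of $(\sigma(x+b)/\sigma(x-b))^p$ and $(\sigma(x-b)/\sigma(x+b))^p$ are those with values $e^{i\pi p}$ and $e^{-i\pi p}$ at $x=0$, and the square root is positive along the motion. More precisely, such single-valued holomorphic branches exist on some open connected set $U$ in the $x$-plane that contains the path $x(t)$ and is disjoint from $\omega_3+\Lambda$. On every such $U$ with such branches (the square root being fixed by its value $\sqrt{(1-e_1)/2}>0$ at $x=0$), the formulas hold along the motion. There $\alpha,\beta,\gamma,\delta$ are holomorphic functions on $U$, and they are the only holomorphic functions on $U$ that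 represent the motion in this way. -/

import Mathlib

open Complex Matrix

/-! ### Weierstrass zeta and sigma functions -/

namespace PeriodPair

/-- The Weierstrass zeta function
`ζ(z) = 1/z + ∑_{λ ≠ 0} (1/(z - λ) + 1/λ + z/λ²)` of the lattice of `L`.
The summand at `λ = 0` is `1/z`, because `1/0 = 0`. -/
noncomputable def weierstrassZeta (L : PeriodPair) (z : ℂ) : ℂ :=
  ∑' l : L.lattice, (1 / (z - l) + 1 / (l : ℂ) + z / (l : ℂ) ^ 2)

/-- The Weierstrass sigma function
`σ(z) = z ∏_{λ ≠ 0} (1 - z/λ) exp(z/λ + z²/(2λ²))` of the lattice of `L`.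
The factor at `λ = 0` is `1`, because `z/0 = 0`. -/
noncomputable def weierstrassSigma (L : PeriodPair) (z : ℂ) : ℂ :=
  z * ∏' l : L.lattice, (1 - z / (l : ℂ)) * exp (z / (l : ℂ) + z ^ 2 / (2 * (l : ℂ) ^ 2))

end PeriodPair

/-! ### Mechanics of the toy top -/

/-- The parameters of a toy top: the moments of inertia `A` (about any axis through the centre of
mass perpendicular to the symmetry axis) and `C` (about the symmetry axis), the distance `s` from
the tip to the centre of mass, and the product `μ` of `s` and the mass.
The gravitational acceleration is one. -/
structure ToyTop where
  A : ℝ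
  C : ℝ
  s : ℝ
  μ : ℝ
  A_pos : 0 < A
  C_pos : 0 < C
  s_pos : 0 < s
  μ_pos : 0 < μ

namespace ToyTop

/-- Complex `2 × 2` matrices. -/
abbrev Mat : Type := Matrix (Fin 2) (Fin 2) ℂ

/-- The Lie algebra `su(2)`: skew hermitian matrices of trace zero. -/
def su2 : Set Mat := {x | xᴴ = -x ∧ x.trace = 0}

/-- The scalar product `⟨x, y⟩ = -2 Tr(x y)` on `su(2)` (where the trace is real). -/
noncomputable def ip (x y : Mat) : ℝ := (-2 * (x * y).trace).re

/-- The vertical unit vector, as an element of `su(2)`. -/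
noncomputable def vert : Mat := !![I / 2, 0; 0, -(I / 2)]

/-- The unit vector `r = Φ k Φ⁻¹` in the direction of the top's axis, in the fixed frame. -/
noncomputable def axis (Φ : Mat) : Mat := Φ * vert * Φ⁻¹

/-- `u = ⟨r, k⟩`, the cosine of the angle between the top's axis and the vertical. -/
noncomputable def height (Φ : Mat) : ℝ := ip (axis Φ) vert

variable (T : ToyTop)

/-- Kinetic energy at the position `Φ` with angular velocity `ω` (in the fixed frame). -/
noncomputable def kinetic (Φ ω : Mat) : ℝ :=
  1 / 2 * T.A * ip ω ω + 1 / 2 * (T.C - T.A) * ip ω (axis Φ) ^ 2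
    + 1 / 2 * (T.μ * T.s) * ip ⁅axis Φ, vert⁆ ω ^ 2

/-- Potential energy. -/
noncomputable def potential (Φ : Mat) : ℝ := T.μ * ip (axis Φ) vert

/-- The Lagrangian `L = T - V`. -/
noncomputable def lagrangian (Φ ω : Mat) : ℝ := T.kinetic Φ ω - T.potential Φ

/-- The momentum `m = ∂L/∂ω`. -/
noncomputable def momentum (Φ ω : Mat) : Mat :=
  T.A • ω + ((T.C - T.A) * ip ω (axis Φ)) • axis Φ
    + (T.μ * T.s * ip ⁅axis Φ, vert⁆ ω) • ⁅axis Φ, vert⁆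

/-- `⟨DL(Φ, ω), η⟩ = d/dε L(exp(ε η) Φ, ω)` at `ε = 0`. -/
noncomputable def lagrangianDeriv (Φ ω η : Mat) : ℝ :=
  deriv (fun ε : ℝ => T.lagrangian (NormedSpace.exp (ε • η) * Φ) ω) 0

/-- `Φ : ℝ → SU(2)` is a motion of the top with angular velocity `ω : ℝ → su(2)`: the equations of
motion `Φ' = ω Φ` and `m' = [ω, m] + DL(Φ, ω)` hold, the second one being tested against all
`η ∈ su(2)`. -/
structure IsMotion (Φ ω : ℝ → Mat) : Prop where
  mem_SU2 : ∀ t, Φ t ∈ Matrix.specialUnitaryGroup (Fin 2) ℂ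
  mem_su2 : ∀ t, ω t ∈ su2
  deriv_config : ∀ t, HasDerivAt Φ (ω t * Φ t) t
  deriv_momentum : ∀ t, ∀ η ∈ su2,
    HasDerivAt (fun τ => ip (T.momentum (Φ τ) (ω τ)) η)
      (ip ⁅ω t, T.momentum (Φ t) (ω t)⁆ η + T.lagrangianDeriv (Φ t) (ω t) η) t

/-- The total energy `h = T + V`. -/
noncomputable def energy (Φ ω : Mat) : ℝ := T.kinetic Φ ω + T.potential Φ

/-- The first integral `⟨m, k⟩`. -/
noncomputable def vertMomentum (Φ ω : Mat) : ℝ := ip (T.momentum Φ ω) vert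

/-- The first integral `n = ⟨m, r⟩`. -/
noncomputable def axisMomentum (Φ ω : Mat) : ℝ := ip (T.momentum Φ ω) (axis Φ)

/-- `e₁ ≤ e₂ ≤ e₃` are the dynamical constants of the state `(Φ, ω)`: the roots of the cubic
polynomial on the right hand side of the reduced equation of motion
`(s/2) (A/(μ s) + 1 - u²) u'² = (1/μ) (1 - u²) (h - n²/(2C) - μ u) - (1/(2Aμ)) (⟨m,k⟩ - n u)²`. -/
def HasDynamicalConstants (Φ ω : Mat) (e₁ e₂ e₃ : ℝ) : Prop :=
  -1 ≤ e₁ ∧ e₁ ≤ e₂ ∧ e₂ ≤ 1 ∧ 1 ≤ e₃ ∧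
  ∀ v : ℝ,
    1 / T.μ * (1 - v ^ 2) *
        (T.energy Φ ω - T.axisMomentum Φ ω ^ 2 / (2 * T.C) - T.μ * v)
      - 1 / (2 * T.A * T.μ) * (T.vertMomentum Φ ω - T.axisMomentum Φ ω * v) ^ 2
      = (v - e₁) * (v - e₂) * (v - e₃)

/-- `e₄ = √(1 + A/(μ s))`. -/
noncomputable def e₄ : ℝ := √(1 + T.A / (T.μ * T.s))

/-- `τ = (1/C - 1/A) n`, the speed of the additional rotation about the top's axis by which
the motion differs from that of a spherical top (`τ = 0` if `A = C`). -/
noncomputable def spin (Φ ω : Mat) : ℝ := (1 / T.C - 1 / T.A) * T.axisMomentum Φ ω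

lemma one_lt_e₄ : 1 < T.e₄ := by
  have h : 0 < T.A / (T.μ * T.s) := div_pos T.A_pos (mul_pos T.μ_pos T.s_pos)
  rw [e₄, Real.lt_sqrt (by norm_num)]
  linarith

/-! ### The elliptic curve of the aperiodic case and its uniformization -/

/-- The polynomial `R(u) = 4 (u - e₁) (u² - e₄²)`; the elliptic curve is `w² = R(u)`. -/
noncomputable def aperPoly (e₁ u : ℝ) : ℝ := 4 * (u - e₁) * (u ^ 2 - T.e₄ ^ 2)

/-- Half of the period of `du/w` along the cycle around `e₁` and `e₄`
(on the negative imaginary axis). -/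
noncomputable def halfPeriod₁ (e₁ : ℝ) : ℂ :=
  -I * ((∫ u in e₁..T.e₄, 1 / √(-T.aperPoly e₁ u) : ℝ) : ℂ)

/-- Half of the period of `du/w` along the cycle around `-e₄` and `e₁` (positive). -/
noncomputable def halfPeriod₂ (e₁ : ℝ) : ℂ :=
  ((∫ u in (-T.e₄)..e₁, 1 / √(T.aperPoly e₁ u) : ℝ) : ℂ)

/-- The half period `ω₃ = ω₁ + ω₂`. -/
noncomputable def halfPeriod₃ (e₁ : ℝ) : ℂ := T.halfPeriod₁ e₁ + T.halfPeriod₂ e₁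

lemma integral_one_div_sqrt_pos {a b c : ℝ} (hab : a < b) (hc : 0 < c) {f g : ℝ → ℝ}
    (hg : Continuous g) (hgc : ∀ x ∈ Set.Ioo a b, c ≤ g x)
    (hf : ∀ x, f x = (x - a) * (b - x) * g x) :
    0 < ∫ x in a..b, 1 / √(f x) := by
  have hpos : ∀ x ∈ Set.Ioo a b, 0 < f x := fun x hx => by
    rw [hf]
    exact mul_pos (mul_pos (sub_pos.2 hx.1) (sub_pos.2 hx.2)) (hc.trans_le (hgc x hx))
  refine intervalIntegral.intervalIntegral_pos_of_pos_on ?_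
    (fun x hx => one_div_pos.2 (Real.sqrt_pos.2 (hpos x hx))) hab
  have h1 : IntervalIntegrable (fun x : ℝ => (x - a) ^ (-(1 / 2) : ℝ)) MeasureTheory.volume a b := by
    have := (intervalIntegral.intervalIntegrable_rpow' (a := 0) (b := b - a)
      (r := -(1 / 2)) (by norm_num)).comp_sub_right a
    simpa using this
  have h2 : IntervalIntegrable (fun x : ℝ => (b - x) ^ (-(1 / 2) : ℝ)) MeasureTheory.volume a b := by
    have := (intervalIntegral.intervalIntegrable_rpow' (a := b - a) (b := 0)
      (r := -(1 / 2)) (by norm_num)).comp_sub_left b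
    simpa using this
  have h3 := ((h1.add h2).const_mul (1 / √((b - a) * c)))
  rw [intervalIntegrable_iff_integrableOn_Ioo_of_le hab.le] at h3 ⊢
  have hfc : Continuous f := by
    rw [funext hf]; fun_prop
  refine MeasureTheory.Integrable.mono' h3
    (measurable_const.div hfc.measurable.sqrt).aestronglyMeasurable ?_
  refine (MeasureTheory.ae_restrict_iff' measurableSet_Ioo).2 (Filter.Eventually.of_forall ?_)
  intro x hx
  have hxa : 0 < x - a := sub_pos.2 hx.1
  have hxb : 0 < b - x := sub_pos.2 hx.2
  have hba : 0 < b - a := sub_pos.2 hab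
  have hsa := Real.sqrt_pos.2 hxa
  have hsb := Real.sqrt_pos.2 hxb
  have hfx := hpos x hx
  have e1 : (x - a) ^ (-(1 / 2) : ℝ) = 1 / √(x - a) := by
    rw [Real.rpow_neg hxa.le, ← Real.sqrt_eq_rpow, one_div]
  have e2 : (b - x) ^ (-(1 / 2) : ℝ) = 1 / √(b - x) := by
    rw [Real.rpow_neg hxb.le, ← Real.sqrt_eq_rpow, one_div]
  have hle : √((x - a) * (b - x)) * √c ≤ √(f x) := by
    rw [← Real.sqrt_mul (by positivity), hf]
    exact Real.sqrt_le_sqrt (mul_le_mul_of_nonneg_left (hgc x hx) (by positivity))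
  have hle2 : √(b - a) ≤ √(x - a) + √(b - x) := by
    rw [Real.sqrt_le_left (by positivity)]
    nlinarith [Real.sq_sqrt hxa.le, Real.sq_sqrt hxb.le, mul_pos hsa hsb]
  rw [Real.norm_of_nonneg (by positivity)]
  simp only [e1, e2]
  have hsc := Real.sqrt_pos.2 hc
  have hsba := Real.sqrt_pos.2 hba
  rw [Real.sqrt_mul hxa.le] at hle
  calc 1 / √(f x) ≤ 1 / (√(x - a) * √(b - x) * √c) :=
        one_div_le_one_div_of_le (by positivity) hle
    _ = 1 / (√(b - a) * √c) * (√(b - a) / (√(x - a) * √(b - x))) := by field_simp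
    _ ≤ 1 / (√(b - a) * √c) * ((√(x - a) + √(b - x)) / (√(x - a) * √(b - x))) := by gcongr
    _ = 1 / √((b - a) * c) * (1 / √(x - a) + 1 / √(b - x)) := by
        rw [Real.sqrt_mul hba.le]; field_simp; ring

lemma linearIndependent_periods {e₁ : ℝ} (h : -1 < e₁) (h' : e₁ < 1) :
    LinearIndependent ℝ ![2 * T.halfPeriod₁ e₁, 2 * T.halfPeriod₂ e₁] := by
  have h4 := T.one_lt_e₄
  have p1 : 0 < ∫ u in e₁..T.e₄, 1 / √(-T.aperPoly e₁ u) :=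
    integral_one_div_sqrt_pos (c := 4 * (e₁ + T.e₄)) (g := fun u => 4 * (u + T.e₄)) (by linarith)
      (by linarith) (by fun_prop) (fun x hx => by linarith [hx.1])
      (fun x => by simp only [aperPoly]; ring)
  have p2 : 0 < ∫ u in (-T.e₄)..e₁, 1 / √(T.aperPoly e₁ u) :=
    integral_one_div_sqrt_pos (c := 4 * (T.e₄ - e₁)) (g := fun u => 4 * (T.e₄ - u)) (by linarith)
      (by linarith) (by fun_prop) (fun x hx => by linarith [hx.2])
      (fun x => by simp only [aperPoly]; ring)
  rw [LinearIndependent.pair_iff]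
  intro x y hxy
  have hre := congrArg Complex.re hxy
  have him := congrArg Complex.im hxy
  simp [halfPeriod₁, halfPeriod₂] at hre him
  constructor
  · rcases him with h | h
    · exact h
    · exact absurd h (by simpa using p1.ne')
  · rcases hre with h | h
    · exact h
    · exact absurd h (by simpa using p2.ne')

/-- The period lattice of the elliptic curve, with basis `2ω₁`, `2ω₂`. -/
noncomputable def periodPair {e₁ : ℝ} (h : -1 < e₁) (h' : e₁ < 1) : PeriodPair where
  ω₁ := 2 * T.halfPeriod₁ e₁
  ω₂ := 2 * T.halfPeriod₂ e₁
  indep := T.linearIndependent_periods h h'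

/-- The value at time `t` of the uniformizing variable `x = ∫ du/w` along the motion `Φ`, starting
with `x = 0` at `t = 0`. Since `dt = i √(2s) (u² - e₄²)/(u - 1) du/w`, this is
`x = ∫ (u - 1)/(i √(2s) (u² - e₄²)) dt`. -/
noncomputable def uniformizer (Φ : ℝ → Mat) (t : ℝ) : ℂ :=
  ∫ τ in (0 : ℝ)..t,
    ((height (Φ τ) : ℂ) - 1) / (I * (√(2 * T.s) : ℂ) * ((height (Φ τ) : ℂ) ^ 2 - (T.e₄ : ℂ) ^ 2))

end ToyTop

/-- `P` is a holomorphic branch on `U` of the multiply valued function `f ^ p`: there is a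
holomorphic branch `ℓ` of `log f` on `U` with `P = exp (p ℓ)`. -/
def IsPowerBranch (U : Set ℂ) (f : ℂ → ℂ) (p : ℂ) (P : ℂ → ℂ) : Prop :=
  ∃ ℓ : ℂ → ℂ, DifferentiableOn ℂ ℓ U ∧ ∀ x ∈ U, exp (ℓ x) = f x ∧ P x = exp (p * ℓ x)

/-- `P`, `Q` and `S` are the branches on the domain `U` of the `x`-plane of
`(σ(x+b)/σ(x-b))^p`, `(σ(x-b)/σ(x+b))^p` and `√((1-u)/2)`, where `u(x) = ℘(x - ω₃) + e₁/3`,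
fixed by the values `exp(iπp)`, `exp(-iπp)` and `√((1-e₁)/2) > 0` at `x = 0`. -/
structure AreAperiodicBranches (L : PeriodPair) (ω₃ : ℂ) (e₁ : ℝ) (b p : ℂ) (U : Set ℂ)
    (P Q S : ℂ → ℂ) : Prop where
  branch_P : IsPowerBranch U (fun x => L.weierstrassSigma (x + b) / L.weierstrassSigma (x - b)) p P
  branch_Q : IsPowerBranch U (fun x => L.weierstrassSigma (x - b) / L.weierstrassSigma (x + b)) p Q
  holo_S : DifferentiableOn ℂ S U
  sq_S : ∀ x ∈ U, S x ^ 2 = (1 - (L.weierstrassP (x - ω₃) + e₁ / 3)) / 2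
  P_zero : P 0 = exp (I * Real.pi * p)
  Q_zero : Q 0 = exp (-(I * Real.pi * p))
  S_zero : S 0 = (√((1 - e₁) / 2) : ℂ)

/-- `U` is a domain in the `x`-plane that contains the path `x : ℝ → ℂ` and no point over
`u = ∞`. -/
structure IsPathDomain (L : PeriodPair) (ω₃ : ℂ) (x : ℝ → ℂ) (U : Set ℂ) : Prop where
  isOpen : IsOpen U
  isConnected : IsConnected U
  path_mem : ∀ t, x t ∈ U
  no_pole : ∀ z ∈ U, z - ω₃ ∉ L.lattice

/-- The matrix of the explicit Cayley-Klein parameters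
`α = k e^{lx-iπp} σ(x-a)/σ(x-ω₃) P(x)`, `β = γ = i S(x)`,
`δ = k e^{-lx+iπp} σ(x+a)/σ(x+ω₃) Q(x)`. -/
noncomputable def aperiodicSolution (L : PeriodPair) (ω₃ a p k l : ℂ) (P Q S : ℂ → ℂ) (x : ℂ) :
    Matrix (Fin 2) (Fin 2) ℂ :=
  !![k * exp (l * x - I * Real.pi * p)
        * (L.weierstrassSigma (x - a) / L.weierstrassSigma (x - ω₃)) * P x,
      I * S x;
    I * S x,
      k * exp (-(l * x) + I * Real.pi * p)
        * (L.weierstrassSigma (x + a) / L.weierstrassSigma (x + ω₃)) * Q x]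

/-! In the aperiodic case the cubic has a double root at 1. Its values at v = 1 and v = -1 force λ =
n and n² = 2Aμ(1 + e₁), and energy conservation becomes (s/2)(e₄² - u²)u'² = (u - e₁)(1 - u)². The
substitution dx = (u - 1)dt / (i√(2s)(u² - e₄²)) absorbs the factor (1 - u)², so that w = du/dx
satisfies w² = R(u). A Gronwall estimate keeps u below 1 for all finite times
(`IsMotion.aperiodicMotion`).

To conclude u = ℘(x - ω₃) + e₁/3 two points are needed. First, the motion starts at the branch point
e₁, where a constant u also solves the first order equation. The comparison therefore uses the
second order equation, which comes from the momentum conjugate to the inclination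
(`AperiodicMotion.height_eq_of_hasDerivAt`). Secondly, the lattice is given by integrals, and its ℘
has to be matched with the curve. On a rectangular lattice ℘ is real on lines through half periods
and inverts elliptic integrals there. So the half periods are complete integrals of the root
differences, and by monotonicity the two integrals determine these differences
(`IsRectangular.half_period_values_eq`).

By Φ' = ωΦ, the logarithmic derivatives of α and δ are, up to the constants ±iτ/2, the rate dx/dt
times rational functions of u and w. The addition formulas for ζ identify these functions with
logarithmic derivatives of the sigma expressions (`logDeriv_sigma_quotients`, `logDeriv_identity`).
The formulas follow by logarithmic differentiation from σ(z+w)σ(z-w) = -σ(z)²σ(w)²(℘(z) - ℘(w)),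
which is an application of Liouville's theorem (`weierstrassSigma_add_mul_sub`). The entries β and γ
are multiples of √(1 - u), up to the same rotation. Each matrix entry of the two sides then solves
one scalar linear equation with one initial value.

The path x(t) stays on the imaginary axis between two opposite points over u = 1. The disc about 0
with these points on its boundary carries all branches (`exists_pathDomain_branches`). Uniqueness on
a path domain is the identity theorem, since x'(0) ≠ 0. -/

namespace PeriodPair
open Filter Topology
variable (L : PeriodPair)

/-! ### Convergence and derivatives of the zeta series and the sigma product -/

lemma weierstrassZeta_bound {r : ℝ} {z : ℂ} (hz : ‖z‖ < r) {l : ℂ}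
    (h : 2 * r ≤ ‖l‖) : ‖1 / (z - l) + 1 / l + z / l ^ 2‖ ≤ 2 * r ^ 2 * ‖l‖ ^ (-3 : ℝ) := by
  have hr : 0 < r := (norm_nonneg z).trans_lt hz
  have hl : 0 < ‖l‖ := by linarith
  have hl0 : l ≠ 0 := norm_pos_iff.1 hl
  have hzl : ‖l‖ / 2 ≤ ‖z - l‖ := by
    rw [norm_sub_rev]; exact .trans (by linarith) (norm_sub_norm_le l z)
  have hzl0 : z - l ≠ 0 := norm_pos_iff.1 (by linarith)
  -- The two correction terms leave decay of order |l|⁻³, which is summable over a lattice of rank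
  -- two.
  have e : 1 / (z - l) + 1 / l + z / l ^ 2 = z ^ 2 / (l ^ 2 * (z - l)) := by
    field_simp; ring
  rw [e, norm_div, norm_mul, norm_pow, norm_pow]
  calc ‖z‖ ^ 2 / (‖l‖ ^ 2 * ‖z - l‖) ≤ r ^ 2 / (‖l‖ ^ 2 * (‖l‖ / 2)) := by gcongr
    _ = 2 * r ^ 2 / ‖l‖ ^ 3 := by field_simp
    _ = _ := by rw [div_eq_mul_inv]; norm_cast

lemma hasSumLocallyUniformly_weierstrassZeta :
    HasSumLocallyUniformly
      (fun (l : L.lattice) (z : ℂ) ↦ 1 / (z - l) + 1 / (l : ℂ) + z / (l : ℂ) ^ 2)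
      L.weierstrassZeta := by
  refine L.hasSumLocallyUniformly_aux (u := fun r l ↦ 2 * r ^ 2 * ‖l‖ ^ (-3 : ℝ)) _
    (fun _ _ ↦ (ZLattice.summable_norm_rpow _ _ (by simp; norm_num)).mul_left _) fun r hr ↦
    Filter.eventually_atTop.mpr ⟨2 * r, ?_⟩
  rintro _ h s hs l rfl
  exact weierstrassZeta_bound hs h

lemma hasSum_weierstrassZeta (z : ℂ) :
    HasSum (fun l : L.lattice ↦ 1 / (z - l) + 1 / (l : ℂ) + z / (l : ℂ) ^ 2)
      (L.weierstrassZeta z) :=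
  L.hasSumLocallyUniformly_weierstrassZeta.tendstoLocallyUniformlyOn.tendsto_at (Set.mem_univ z)

lemma sub_ne_zero_of_notMem {z : ℂ} (hz : z ∉ L.lattice) (l : L.lattice) : z - l ≠ 0 :=
  fun h ↦ hz (sub_eq_zero.1 h ▸ l.2)

lemma differentiableOn_weierstrassZeta : DifferentiableOn ℂ L.weierstrassZeta L.latticeᶜ := by
  refine L.hasSumLocallyUniformly_weierstrassZeta.tendstoLocallyUniformlyOn.differentiableOn
    (.of_forall fun s ↦ .fun_sum fun i _ ↦ ?_) L.isClosed_lattice.isOpen_compl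
  exact ((DifferentiableOn.div (by fun_prop) (by fun_prop)
    fun x hx ↦ L.sub_ne_zero_of_notMem hx i).add (by fun_prop)).add (by fun_prop)

/-- Locally uniform convergence allows termwise differentiation, and the differentiated terms are
those of the series for -℘. -/
lemma hasDerivAt_weierstrassZeta {z : ℂ} (hz : z ∉ L.lattice) :
    HasDerivAt L.weierstrassZeta (-℘[L] z) z := by
  have hd := (L.differentiableOn_weierstrassZeta z hz).differentiableAt
    (L.isClosed_lattice.isOpen_compl.mem_nhds hz)
  suffices deriv L.weierstrassZeta z = -℘[L] z from this ▸ hd.hasDerivAt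
  have hs (i : L.lattice) {x : ℂ} (hx : x ∉ L.lattice) :
      HasDerivAt (fun z : ℂ ↦ 1 / (z - i) + 1 / (i : ℂ) + z / (i : ℂ) ^ 2)
        (-(1 / (x - i) ^ 2 - 1 / (i : ℂ) ^ 2)) x := by
    have h0 := L.sub_ne_zero_of_notMem hx i
    have h1 : HasDerivAt (fun z : ℂ ↦ 1 / (z - i)) (-1 / (x - i) ^ 2) x := by
      simpa using ((hasDerivAt_id x).sub_const (i : ℂ)).fun_inv h0
    refine ((h1.add_const _).add ((hasDerivAt_id x).div_const ((i : ℂ) ^ 2))).congr_deriv ?_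
    ring
  have h1 := (L.hasSumLocallyUniformly_weierstrassZeta.tendstoLocallyUniformlyOn.deriv
    (U := L.latticeᶜ) (.of_forall fun s ↦ .fun_sum fun i _ x hx ↦
      (hs i hx).differentiableAt.differentiableWithinAt)
      L.isClosed_lattice.isOpen_compl).tendsto_at hz
  refine tendsto_nhds_unique h1 (((L.hasSum_weierstrassP z).neg).congr fun s ↦ ?_)
  exact (HasDerivAt.fun_sum fun i _ ↦ hs i hz).deriv.symm

/-- The factor of the product for `σ` that belongs to the lattice point `l`. -/
noncomputable def sigmaFactor (l z : ℂ) : ℂ := (1 - z / l) * exp (z / l + z ^ 2 / (2 * l ^ 2))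

/-- The exponent cancels the Taylor polynomial of log(1 - w) up to order two, so the logarithm of
the product is of third order. -/
lemma norm_one_sub_mul_exp_sub_one_le {w : ℂ} (hw : ‖w‖ ≤ 1 / 2) :
    ‖(1 - w) * exp (w + w ^ 2 / 2) - 1‖ ≤ 2 * ‖w‖ ^ 3 := by
  have h1 : ‖-w‖ < 1 := by rw [norm_neg]; linarith
  have h2 := norm_log_sub_logTaylor_le 2 h1
  have h3 : logTaylor 3 (-w) = -(w + w ^ 2 / 2) := by
    simp [logTaylor, Finset.sum_range_succ]; ring
  simp only [Nat.reduceAdd, norm_neg] at h2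
  rw [h3, sub_neg_eq_add, ← sub_eq_add_neg] at h2
  have hne : 1 - w ≠ 0 := by
    intro h
    rw [← sub_eq_zero.1 h] at hw
    norm_num at hw
  have h4 : (1 - w) * exp (w + w ^ 2 / 2) = exp (log (1 - w) + (w + w ^ 2 / 2)) := by
    rw [exp_add (log _), exp_log hne]
  have h5 : (1 - ‖w‖)⁻¹ ≤ 2 := by
    rw [inv_le_comm₀ (by linarith) (by norm_num)]; linarith
  have h6 : ‖w‖ ^ 3 * (1 - ‖w‖)⁻¹ / (2 + 1) ≤ ‖w‖ ^ 3 := by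
    have := mul_le_mul_of_nonneg_left h5 (by positivity : 0 ≤ ‖w‖ ^ 3)
    have : 0 ≤ ‖w‖ ^ 3 := by positivity
    linarith
  have h8 : ‖w‖ ^ 3 ≤ 1 := pow_le_one₀ (norm_nonneg _) (by linarith)
  have h9 := h2.trans (by exact_mod_cast h6)
  rw [h4]
  exact (norm_exp_sub_one_le (h9.trans h8)).trans (by linarith)

lemma norm_sigmaFactor_sub_one_le {r : ℝ} {z : ℂ} (hz : ‖z‖ < r) {l : ℂ} (h : 2 * r ≤ ‖l‖) :
    ‖sigmaFactor l z - 1‖ ≤ 2 * r ^ 3 * ‖l‖ ^ (-3 : ℝ) := by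
  have hr : 0 < r := (norm_nonneg z).trans_lt hz
  have hl : 0 < ‖l‖ := by linarith
  have h1 : ‖z / l‖ ≤ 1 / 2 := by
    rw [norm_div, div_le_iff₀ hl]; linarith
  have e : sigmaFactor l z = (1 - z / l) * exp (z / l + (z / l) ^ 2 / 2) := by
    rw [sigmaFactor, div_pow, div_div, mul_comm (2 : ℂ)]
  rw [e]
  refine (norm_one_sub_mul_exp_sub_one_le h1).trans ?_
  rw [norm_div, div_pow, mul_assoc, Real.rpow_neg hl.le, ← div_eq_mul_inv]
  norm_cast
  gcongr

lemma differentiable_sigmaFactor (l : ℂ) : Differentiable ℂ (sigmaFactor l) := by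
  unfold sigmaFactor
  simp only [div_eq_mul_inv]
  fun_prop

lemma sigmaFactor_ne_zero {z : ℂ} {l : ℂ} (hz : z ≠ l) : sigmaFactor l z ≠ 0 := by
  refine mul_ne_zero (fun h ↦ ?_) (exp_ne_zero _)
  rcases eq_or_ne l 0 with rfl | h0
  · simp at h
  · rw [sub_eq_zero, eq_div_iff h0, one_mul] at h
    exact hz h.symm

lemma eventually_norm_sigmaFactor_sub_one_le (r : ℝ) :
    ∀ᶠ l : L.lattice in cofinite, ∀ z ∈ Metric.ball (0 : ℂ) r,
      ‖sigmaFactor l z - 1‖ ≤ 2 * r ^ 3 * ‖l‖ ^ (-3 : ℝ) := by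
  refine (isCompact_iff_finite.mp (isCompact_closedBall (0 : L.lattice) (2 * r))).subset ?_
  intro l hl
  simp only [Metric.mem_closedBall, dist_zero_right]
  by_contra hl'
  refine hl fun z hz ↦ norm_sigmaFactor_sub_one_le (by simpa using hz) ?_
  simpa using (not_le.1 hl').le

lemma summable_two_mul_pow_mul_norm_rpow (r : ℝ) :
    Summable fun l : L.lattice ↦ 2 * r ^ 3 * ‖l‖ ^ (-3 : ℝ) :=
  (ZLattice.summable_norm_rpow _ _ (by simp; norm_num)).mul_left _

lemma multipliableLocallyUniformlyOn_sigmaFactor (r : ℝ) :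
    MultipliableLocallyUniformlyOn (fun (l : L.lattice) z ↦ sigmaFactor l z)
      (Metric.ball (0 : ℂ) r) := by
  simpa using (L.summable_two_mul_pow_mul_norm_rpow r).multipliableLocallyUniformlyOn_one_add
    (f := fun (l : L.lattice) z ↦ sigmaFactor l z - 1) Metric.isOpen_ball
    (L.eventually_norm_sigmaFactor_sub_one_le r)
    fun l ↦ ((differentiable_sigmaFactor l).continuous.sub continuous_const).continuousOn

lemma weierstrassSigma_eq (z : ℂ) :
    L.weierstrassSigma z = z * ∏' l : L.lattice, sigmaFactor l z := rfl

lemma differentiable_tprod_sigmaFactor :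
    Differentiable ℂ fun z ↦ ∏' l : L.lattice, sigmaFactor l z := by
  intro z
  have hz : z ∈ Metric.ball (0 : ℂ) (‖z‖ + 1) := by simp
  exact ((L.multipliableLocallyUniformlyOn_sigmaFactor
    (‖z‖ + 1)).hasProdLocallyUniformlyOn.differentiableOn
    (.of_forall fun s ↦ (Differentiable.fun_finsetProd
      (f := fun l : L.lattice ↦ sigmaFactor l) fun l _ ↦ differentiable_sigmaFactor (l : ℂ)).differentiableOn)
    Metric.isOpen_ball z hz).differentiableAt (Metric.isOpen_ball.mem_nhds hz)

lemma differentiable_weierstrassSigma : Differentiable ℂ L.weierstrassSigma :=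
  differentiable_id.mul L.differentiable_tprod_sigmaFactor

lemma tprod_sigmaFactor_ne_zero {z : ℂ} (hz : ∀ l : L.lattice, z = l → l = 0) :
    ∏' l : L.lattice, sigmaFactor l z ≠ 0 := by
  have h0 (l : L.lattice) : sigmaFactor l z ≠ 0 := by
    by_cases h : z = l
    · rw [hz l h]; simp [sigmaFactor]
    · exact sigmaFactor_ne_zero h
  have := tprod_one_add_ne_zero_of_summable (f := fun l : L.lattice ↦ sigmaFactor l z - 1)
    (by simpa using h0)
    ((L.summable_two_mul_pow_mul_norm_rpow (‖z‖ + 1)).of_norm_bounded_eventually (by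
      filter_upwards [L.eventually_norm_sigmaFactor_sub_one_le (‖z‖ + 1)] with l hl
      simpa using hl z (by simp)))
  simpa using this

lemma weierstrassSigma_ne_zero {z : ℂ} (hz : z ∉ L.lattice) : L.weierstrassSigma z ≠ 0 :=
  mul_ne_zero (fun h ↦ hz (h ▸ zero_mem _))
    (L.tprod_sigmaFactor_ne_zero fun l h ↦ absurd (h ▸ l.2) hz)

lemma weierstrassSigma_zero : L.weierstrassSigma 0 = 0 := by simp [weierstrassSigma]

lemma weierstrassSigma_neg (z : ℂ) : L.weierstrassSigma (-z) = -L.weierstrassSigma z := by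
  rw [weierstrassSigma_eq, weierstrassSigma_eq, ← (Equiv.neg L.lattice).tprod_eq, neg_mul]
  congr! 4 with l
  simp [sigmaFactor]

lemma weierstrassZeta_neg (z : ℂ) : L.weierstrassZeta (-z) = -L.weierstrassZeta z := by
  rw [weierstrassZeta, weierstrassZeta, ← (Equiv.neg L.lattice).tsum_eq, ← tsum_neg]
  congr! 2 with l
  simp only [Equiv.neg_apply, NegMemClass.coe_neg, neg_sq]
  rw [show -z - -(l : ℂ) = -(z - l) by ring, div_neg, div_neg, neg_div]
  ring

lemma logDeriv_sigmaFactor (l : ℂ) {z : ℂ} (hz : z ≠ l) (h0 : l ≠ 0) :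
    logDeriv (sigmaFactor l) z = 1 / (z - l) + 1 / l + z / l ^ 2 := by
  have h1 : z - l ≠ 0 := sub_ne_zero.2 hz
  have h2 : HasDerivAt (sigmaFactor l) ((-(1 / l)) * exp (z / l + z ^ 2 / (2 * l ^ 2)) +
      (1 - z / l) * (exp (z / l + z ^ 2 / (2 * l ^ 2)) * (1 / l + 2 * z / (2 * l ^ 2)))) z := by
    refine HasDerivAt.mul (((hasDerivAt_id z).div_const l).const_sub 1) (HasDerivAt.cexp ?_)
    refine ((hasDerivAt_id z).div_const l).add ?_
    simpa using (hasDerivAt_pow 2 z).div_const (2 * l ^ 2)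
  rw [logDeriv_apply, h2.deriv, sigmaFactor]
  have h3 := exp_ne_zero (z / l + z ^ 2 / (2 * l ^ 2))
  have h4 : 1 - z / l ≠ 0 := by
    intro h; rw [sub_eq_zero, eq_div_iff h0, one_mul] at h; exact hz h.symm
  have h5 : 1 - z / l = -(z - l) / l := by field_simp; ring
  rw [div_eq_iff (mul_ne_zero h4 h3), h5]
  field_simp
  ring

lemma hasDerivAt_weierstrassSigma {z : ℂ} (hz : z ∉ L.lattice) :
    HasDerivAt L.weierstrassSigma (L.weierstrassSigma z * L.weierstrassZeta z) z := by
  have hz0 : z ≠ 0 := fun h ↦ hz (h ▸ zero_mem _)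
  have hne (l : L.lattice) : z ≠ l := fun h ↦ hz (h ▸ l.2)
  have hp := L.tprod_sigmaFactor_ne_zero (z := z) fun l h ↦ absurd (h ▸ l.2) hz
  -- At l = 0 the factor is constantly 1, while the zeta series has the term 1/z there. The
  -- prefactor z of σ restores this term.
  have hld (l : L.lattice) : logDeriv (fun z ↦ sigmaFactor l z) z =
      (1 / (z - l) + 1 / (l : ℂ) + z / (l : ℂ) ^ 2) - if l = 0 then 1 / z else 0 := by
    split_ifs with h
    · subst h
      have : (fun z ↦ sigmaFactor ((0 : L.lattice) : ℂ) z) = fun _ ↦ 1 := by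
        ext; simp [sigmaFactor]
      rw [this]; simp
    · rw [sub_zero]
      exact logDeriv_sigmaFactor _ (hne l) (by simpa using h)
  have hsum : HasSum (fun l : L.lattice ↦ logDeriv (fun z ↦ sigmaFactor l z) z)
      (L.weierstrassZeta z - 1 / z) := by
    simp only [hld]
    exact (L.hasSum_weierstrassZeta z).sub (hasSum_ite_eq 0 (1 / z))
  have hlog := logDeriv_tprod_eq_tsum (s := Metric.ball (0 : ℂ) (‖z‖ + 1)) Metric.isOpen_ball
    (x := z) (by simp) (f := fun (l : L.lattice) z ↦ sigmaFactor l z)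
    (fun l ↦ sigmaFactor_ne_zero (hne l))
    (fun l ↦ (differentiable_sigmaFactor l).differentiableOn) hsum.summable
    (L.multipliableLocallyUniformlyOn_sigmaFactor _) hp
  rw [hsum.tsum_eq, logDeriv_apply, div_eq_iff hp] at hlog
  refine ((hasDerivAt_id z).mul (L.differentiable_tprod_sigmaFactor z).hasDerivAt).congr_deriv ?_
  rw [hlog, weierstrassSigma_eq, id]
  field_simp
  ring

end PeriodPair

/-! ### Quasi-periodicity of zeta and sigma, and the addition formulas -/

namespace PeriodPair
open Filter Topology
variable (L : PeriodPair)

lemma countable_lattice : (L.lattice : Set ℂ).Countable :=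
  Set.countable_coe_iff.1 (inferInstanceAs (Countable L.lattice))

lemma isPreconnected_compl_lattice : IsPreconnected (L.lattice : Set ℂ)ᶜ :=
  (L.countable_lattice.isConnected_compl_of_one_lt_rank
    (by rw [Complex.rank_real_complex]; norm_num)).isPreconnected

lemma dense_compl_lattice : Dense (L.lattice : Set ℂ)ᶜ := L.countable_lattice.dense_compl ℝ

lemma add_mem_lattice_iff {z l : ℂ} (hl : l ∈ L.lattice) : z + l ∈ L.lattice ↔ z ∈ L.lattice :=
  L.lattice.add_mem_iff_left hl

lemma exists_eq_of_hasDerivAt_zero {f : ℂ → ℂ} (hf : ∀ z ∉ L.lattice, HasDerivAt f 0 z) :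
    ∃ c, ∀ z ∉ L.lattice, f z = c := by
  refine L.isClosed_lattice.isOpen_compl.exists_is_const_of_deriv_eq_zero
    L.isPreconnected_compl_lattice
    (fun z hz ↦ (hf z hz).differentiableAt.differentiableWithinAt) fun z hz ↦ (hf z hz).deriv

lemma exists_weierstrassZeta_add {l : ℂ} (hl : l ∈ L.lattice) :
    ∃ η, ∀ z ∉ L.lattice, L.weierstrassZeta (z + l) = L.weierstrassZeta z + η := by
  obtain ⟨η, hη⟩ := L.exists_eq_of_hasDerivAt_zero
    (f := fun z ↦ L.weierstrassZeta (z + l) - L.weierstrassZeta z) fun z hz ↦ by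
      have hz' : z + l ∉ L.lattice := (L.add_mem_lattice_iff hl).not.2 hz
      refine (((L.hasDerivAt_weierstrassZeta hz').comp_add_const z l).sub
        (L.hasDerivAt_weierstrassZeta hz)).congr_deriv ?_
      have := L.weierstrassP_add_coe z ⟨l, hl⟩
      simp_all
  exact ⟨η, fun z hz ↦ by rw [← hη z hz]; ring⟩

/-- The logarithmic derivatives of σ(z + l) and σ(z) differ by the constant η, so their quotient is
a multiple of exp(ηz) off the lattice. Density of the complement extends the relation to all z. -/
lemma exists_weierstrassSigma_add {l : ℂ} (hl : l ∈ L.lattice) :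
    ∃ c η : ℂ, c ≠ 0 ∧ ∀ z, L.weierstrassSigma (z + l) = c * exp (η * z) * L.weierstrassSigma z := by
  obtain ⟨η, hη⟩ := L.exists_weierstrassZeta_add hl
  have hmem {z : ℂ} (hz : z ∉ L.lattice) : z + l ∉ L.lattice := (L.add_mem_lattice_iff hl).not.2 hz
  obtain ⟨c, hc⟩ := L.exists_eq_of_hasDerivAt_zero
    (f := fun z ↦ L.weierstrassSigma (z + l) / (exp (η * z) * L.weierstrassSigma z))
    fun z hz ↦ by
      have h0 := mul_ne_zero (exp_ne_zero (η * z)) (L.weierstrassSigma_ne_zero hz)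
      refine (((L.hasDerivAt_weierstrassSigma (hmem hz)).comp_add_const z l).div
        ((((hasDerivAt_id z).const_mul η).cexp).mul (L.hasDerivAt_weierstrassSigma hz))
        h0).congr_deriv ?_
      rw [div_eq_zero_iff, hη z hz]
      left
      simp only [id, Pi.mul_apply]
      ring
  have key : ∀ z ∉ L.lattice,
      L.weierstrassSigma (z + l) = c * exp (η * z) * L.weierstrassSigma z := fun z hz ↦ by
    have h0 := mul_ne_zero (exp_ne_zero (η * z)) (L.weierstrassSigma_ne_zero hz)
    rw [mul_assoc, ← hc z hz, div_mul_cancel₀ _ h0]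
  refine ⟨c, η, fun h0 ↦ ?_, fun z ↦ ?_⟩
  · refine L.weierstrassSigma_ne_zero (hmem L.ω₁_div_two_notMem_lattice) ?_
    rw [key _ L.ω₁_div_two_notMem_lattice, h0]; ring
  · have hd := L.differentiable_weierstrassSigma.continuous
    exact congrFun (Continuous.ext_on (f := fun z ↦ L.weierstrassSigma (z + l))
      (g := fun z ↦ c * exp (η * z) * L.weierstrassSigma z) L.dense_compl_lattice
      (by fun_prop) (by fun_prop) fun z hz ↦ key z hz) z

lemma weierstrassSigma_eq_zero_iff {z : ℂ} : L.weierstrassSigma z = 0 ↔ z ∈ L.lattice := by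
  refine ⟨fun h ↦ by_contra fun hz ↦ L.weierstrassSigma_ne_zero hz h, fun hz ↦ ?_⟩
  obtain ⟨c, η, -, h⟩ := L.exists_weierstrassSigma_add hz
  simpa [weierstrassSigma_zero] using h 0

lemma analyticAt_weierstrassPExcept_zero : AnalyticAt ℂ ℘[L - (0 : ℂ)] 0 :=
  L.analyticAt_weierstrassPExcept 0

/-- `σ(z+w) σ(z-w) / σ(z)² + σ(w)² (℘(z) - ℘(w))` is `G(z) / z²` near `z = 0`, where `G` is
this function. -/
noncomputable def sigmaRelationNumerator (w z : ℂ) : ℂ :=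
  L.weierstrassSigma (z + w) * L.weierstrassSigma (z - w) /
      (∏' l : L.lattice, sigmaFactor l z) ^ 2
    + L.weierstrassSigma w ^ 2 * (z ^ 2 * (℘[L - (0 : ℂ)] z - ℘[L] w) + 1)

lemma tprod_sigmaFactor_zero : ∏' l : L.lattice, sigmaFactor l 0 = 1 := by
  simp [sigmaFactor]

lemma tprod_sigmaFactor_neg (z : ℂ) :
    ∏' l : L.lattice, sigmaFactor l (-z) = ∏' l : L.lattice, sigmaFactor l z := by
  rw [← (Equiv.neg L.lattice).tprod_eq]
  congr! 2 with l
  simp [sigmaFactor]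

/-- The function is even and vanishes at 0, because σ is odd, so its order of vanishing is at least
two. This removes the possible pole at the lattice points in the Liouville argument. -/
lemma exists_sigmaRelationNumerator_eq (w : ℂ) :
    ∃ g : ℂ → ℂ, AnalyticAt ℂ g 0 ∧
      ∀ᶠ z in 𝓝 0, L.sigmaRelationNumerator w z = z ^ 2 * g z := by
  have hσ := L.differentiable_weierstrassSigma
  have ha : AnalyticAt ℂ (L.sigmaRelationNumerator w) 0 := by
    have h1 : AnalyticAt ℂ L.weierstrassSigma (0 + w) := hσ.analyticAt _
    have h2 : AnalyticAt ℂ L.weierstrassSigma (0 - w) := hσ.analyticAt _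
    have h3 : AnalyticAt ℂ (fun z ↦ ∏' l : L.lattice, sigmaFactor l z) 0 :=
      L.differentiable_tprod_sigmaFactor.analyticAt _
    have h4 := L.analyticAt_weierstrassPExcept_zero
    have h5 : AnalyticAt ℂ (fun z ↦ L.weierstrassSigma (z + w)) 0 :=
      h1.comp (f := fun z ↦ z + w) (by fun_prop)
    have h6 : AnalyticAt ℂ (fun z ↦ L.weierstrassSigma (z - w)) 0 :=
      h2.comp (f := fun z ↦ z - w) (by fun_prop)
    refine ((h5.mul h6).div (h3.pow 2) ?_).add (by fun_prop)
    simp [tprod_sigmaFactor_zero]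
  have heven (z : ℂ) : L.sigmaRelationNumerator w (-z) = L.sigmaRelationNumerator w z := by
    have e1 : L.weierstrassSigma (-z + w) = -L.weierstrassSigma (z - w) := by
      rw [← L.weierstrassSigma_neg]; ring_nf
    have e2 : L.weierstrassSigma (-z - w) = -L.weierstrassSigma (z + w) := by
      rw [← L.weierstrassSigma_neg]; ring_nf
    have e3 : ℘[L - (0 : ℂ)] (-z) = ℘[L - (0 : ℂ)] z := by
      simpa using L.weierstrassPExcept_neg 0 z
    rw [sigmaRelationNumerator, sigmaRelationNumerator, e1, e2, e3, tprod_sigmaFactor_neg]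
    ring
  have h0 : (2 : ℕ) ≤ analyticOrderAt (L.sigmaRelationNumerator w) 0 := by
    refine (natCast_le_analyticOrderAt_iff_iteratedDeriv_eq_zero ha).2 fun i hi ↦ ?_
    interval_cases i
    · rw [iteratedDeriv_zero, sigmaRelationNumerator, tprod_sigmaFactor_zero, zero_add, zero_sub,
        weierstrassSigma_neg]
      ring
    · rw [iteratedDeriv_one]
      have h1 := deriv_comp_neg (L.sigmaRelationNumerator w) 0
      simp only [heven, neg_zero] at h1
      exact CharZero.eq_neg_self_iff.1 h1
  obtain ⟨g, hg, h⟩ := (natCast_le_analyticOrderAt ha).1 h0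
  exact ⟨g, hg, by simpa using h⟩

/-- The sum f below is periodic, since the exponential factors of σ cancel, and its singularities
are removable. Hence it is a bounded entire function, thus constant, and its value at z = w is 0. -/
theorem weierstrassSigma_add_mul_sub {z w : ℂ} (hz : z ∉ L.lattice) (hw : w ∉ L.lattice) :
    L.weierstrassSigma (z + w) * L.weierstrassSigma (z - w) =
      -(L.weierstrassSigma z ^ 2 * L.weierstrassSigma w ^ 2 * (℘[L] z - ℘[L] w)) := by
  classical
  obtain ⟨g, hg, hgz⟩ := L.exists_sigmaRelationNumerator_eq w
  let f (z : ℂ) : ℂ := L.weierstrassSigma (z + w) * L.weierstrassSigma (z - w) /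
      L.weierstrassSigma z ^ 2 + L.weierstrassSigma w ^ 2 * (℘[L] z - ℘[L] w)
  let F (z : ℂ) : ℂ := if z ∈ L.lattice then g 0 else f z
  have hσ := L.differentiable_weierstrassSigma
  have hper (z l : ℂ) (hl : l ∈ L.lattice) : F (z + l) = F z := by
    by_cases hz : z ∈ L.lattice
    · simp [F, hz, (L.add_mem_lattice_iff hl).2 hz]
    · simp only [F, hz, (L.add_mem_lattice_iff hl).not.2 hz, if_false, f]
      obtain ⟨c, η, hc, h⟩ := L.exists_weierstrassSigma_add hl
      have e := exp_ne_zero (η * z)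
      rw [L.weierstrassP_add_coe z ⟨l, hl⟩, h z, show z + l + w = z + w + l by ring, h,
        show z + l - w = z - w + l by ring, h]
      have e2 : exp (η * (z + w)) * exp (η * (z - w)) = exp (η * z) ^ 2 := by
        rw [← exp_add, sq, ← exp_add]; ring_nf
      congr 1
      rw [show c * exp (η * (z + w)) * L.weierstrassSigma (z + w) *
          (c * exp (η * (z - w)) * L.weierstrassSigma (z - w)) =
          c ^ 2 * (exp (η * (z + w)) * exp (η * (z - w))) *
          (L.weierstrassSigma (z + w) * L.weierstrassSigma (z - w)) by ring, e2, mul_pow, mul_pow]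
      exact mul_div_mul_left _ _ (mul_ne_zero (pow_ne_zero _ hc) (pow_ne_zero _ e))
  have hF0 : DifferentiableAt ℂ F 0 := by
    refine (hg.congr ?_).differentiableAt
    filter_upwards [L.compl_lattice_sdiff_singleton_mem_nhds 0, hgz] with z hz hgz
    by_cases hz0 : z = 0
    · simp [F, hz0]
    have hzl : z ∉ L.lattice := by simp_all
    have hp := L.tprod_sigmaFactor_ne_zero (z := z) fun l h ↦ absurd (h ▸ l.2) hzl
    have hP : ℘[L - (0 : ℂ)] z = ℘[L] z - 1 / z ^ 2 := by
      have := L.weierstrassPExcept_def 0 z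
      simpa [sub_eq_add_neg] using this
    simp only [F, hzl, if_false, f]
    rw [sigmaRelationNumerator, hP] at hgz
    rw [L.weierstrassSigma_eq z]
    field_simp at hgz ⊢
    linear_combination -hgz
  have hF : Differentiable ℂ F := fun z ↦ by
    by_cases hz : z ∈ L.lattice
    · have : F = fun x ↦ F (x - z) := by
        ext x
        simpa [sub_eq_add_neg] using (hper x (-z) (neg_mem hz)).symm
      rw [this]
      have h1 : DifferentiableAt ℂ F (z - z) := by rwa [sub_self]
      exact h1.comp (f := fun x ↦ x - z) z (by fun_prop)
    · have h1 := (L.analyticOnNhd_weierstrassP z hz).differentiableAt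
      have h2 : DifferentiableAt ℂ f z := by
        refine DifferentiableAt.add (DifferentiableAt.div (by fun_prop) (by fun_prop)
          (pow_ne_zero _ (L.weierstrassSigma_ne_zero hz))) (by fun_prop)
      refine h2.congr_of_eventuallyEq ?_
      filter_upwards [L.isClosed_lattice.isOpen_compl.mem_nhds hz] with x hx
      exact if_neg hx
  have hconst : F z = F w := hF.apply_eq_apply_of_bounded
    (IsZLattice.isCompact_range_of_periodic L.lattice _ hF.continuous
      fun z l hl ↦ hper z l hl).isBounded z w
  simp only [F, hz, hw, if_false, f, sub_self, weierstrassSigma_zero, mul_zero, zero_div,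
    add_zero] at hconst
  have := L.weierstrassSigma_ne_zero hz
  field_simp at hconst
  linear_combination hconst

/-- The zeros of σ are the lattice points, so the sigma relation shows where the difference of
℘-values vanishes. -/
lemma weierstrassP_eq_iff {z w : ℂ} (hz : z ∉ L.lattice) (hw : w ∉ L.lattice) :
    ℘[L] z = ℘[L] w ↔ z + w ∈ L.lattice ∨ z - w ∈ L.lattice := by
  rw [← L.weierstrassSigma_eq_zero_iff, ← L.weierstrassSigma_eq_zero_iff, ← mul_eq_zero,
    L.weierstrassSigma_add_mul_sub hz hw, neg_eq_zero, mul_eq_zero, sub_eq_zero]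
  have h1 := L.weierstrassSigma_ne_zero hz
  have h2 := L.weierstrassSigma_ne_zero hw
  simp [h1, h2]

lemma hasDerivAt_weierstrassP {z : ℂ} (hz : z ∉ L.lattice) : HasDerivAt ℘[L] (℘'[L] z) z := by
  rw [← L.deriv_weierstrassP]
  exact (L.analyticOnNhd_weierstrassP z hz).differentiableAt.hasDerivAt

/-- This is the logarithmic derivative in z of the sigma relation. The two formulas that follow
combine it with its version for exchanged arguments. -/
theorem weierstrassZeta_add_add_sub {z w : ℂ} (hz : z ∉ L.lattice) (hw : w ∉ L.lattice)
    (h : ℘[L] z ≠ ℘[L] w) :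
    L.weierstrassZeta (z + w) + L.weierstrassZeta (z - w) - 2 * L.weierstrassZeta z =
      ℘'[L] z / (℘[L] z - ℘[L] w) := by
  obtain ⟨hp, hm⟩ := not_or.1 ((L.weierstrassP_eq_iff hz hw).not.1 h)
  have h1 := ((L.hasDerivAt_weierstrassSigma hp).comp_add_const z w).mul
    ((L.hasDerivAt_weierstrassSigma hm).comp_sub_const z w)
  have h2 := ((((L.hasDerivAt_weierstrassSigma hz).pow 2).mul_const
    (L.weierstrassSigma w ^ 2)).mul ((L.hasDerivAt_weierstrassP hz).sub_const (℘[L] w))).neg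
  have h3 := h1.congr_of_eventuallyEq (f₁ := -((fun x ↦
      (L.weierstrassSigma ^ 2) x * L.weierstrassSigma w ^ 2) * fun x ↦ ℘[L] x - ℘[L] w)) (by
    filter_upwards [L.isClosed_lattice.isOpen_compl.mem_nhds hz] with x hx
    have := L.weierstrassSigma_add_mul_sub hx hw
    simpa using this.symm)
  have h4 := h2.unique h3
  have e := L.weierstrassSigma_add_mul_sub hz hw
  have hz0 := L.weierstrassSigma_ne_zero hz
  have hw0 := L.weierstrassSigma_ne_zero hw
  have hd := sub_ne_zero.2 h
  simp only [Pi.pow_apply, Nat.cast_ofNat, Nat.add_one_sub_one, pow_one] at h4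
  rw [eq_div_iff hd]
  have h5 : L.weierstrassSigma z ^ 2 * L.weierstrassSigma w ^ 2 ≠ 0 := by positivity
  refine mul_left_cancel₀ h5 ?_
  linear_combination h4 +
    (L.weierstrassZeta (z + w) + L.weierstrassZeta (z - w)) * e

theorem weierstrassZeta_add {z w : ℂ} (hz : z ∉ L.lattice) (hw : w ∉ L.lattice)
    (h : ℘[L] z ≠ ℘[L] w) :
    L.weierstrassZeta (z - w) - L.weierstrassZeta z + L.weierstrassZeta w =
      (℘'[L] z + ℘'[L] w) / (2 * (℘[L] z - ℘[L] w)) := by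
  have h1 := L.weierstrassZeta_add_add_sub hz hw h
  have h2 := L.weierstrassZeta_add_add_sub hw hz h.symm
  rw [show w - z = -(z - w) by ring, weierstrassZeta_neg, add_comm w z] at h2
  have hd := sub_ne_zero.2 h
  have hd' := sub_ne_zero.2 h.symm
  rw [eq_div_iff hd] at h1
  rw [eq_div_iff hd'] at h2
  rw [eq_div_iff (by simpa using hd)]
  linear_combination h1 + h2

theorem weierstrassZeta_sub_sub_add {z w : ℂ} (hz : z ∉ L.lattice) (hw : w ∉ L.lattice)
    (h : ℘[L] z ≠ ℘[L] w) :
    L.weierstrassZeta (z - w) - L.weierstrassZeta (z + w) + 2 * L.weierstrassZeta w =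
      ℘'[L] w / (℘[L] z - ℘[L] w) := by
  have h2 := L.weierstrassZeta_add_add_sub hw hz h.symm
  rw [show w - z = -(z - w) by ring, weierstrassZeta_neg, add_comm w z] at h2
  rw [← neg_sub (℘[L] w), div_neg, ← h2]
  ring

end PeriodPair

section

open Filter Topology MeasureTheory Set

/-! ### Inversion of elliptic integrals and the dependence of the periods on the roots -/

/-- The integral `∫₀¹ dt / √(t (1 - t) (b + a t))`. -/
noncomputable def ellipticPeriod (a b : ℝ) : ℝ := ∫ t in (0 : ℝ)..1, 1 / √(t * (1 - t) * (b + a * t))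

lemma ellipticPeriod_pos {a b : ℝ} (ha : 0 < a) (hb : 0 < b) : 0 < ellipticPeriod a b :=
  ToyTop.integral_one_div_sqrt_pos (g := fun t ↦ b + a * t) zero_lt_one hb (by fun_prop)
    (fun t ht ↦ by nlinarith [ht.1]) (fun t ↦ by ring)

lemma ellipticPeriod_intervalIntegrable {a b : ℝ} (ha : 0 < a) (hb : 0 < b) :
    IntervalIntegrable (fun t ↦ 1 / √(t * (1 - t) * (b + a * t))) volume 0 1 :=
  by_contra fun h ↦ (ellipticPeriod_pos ha hb).ne' (intervalIntegral.integral_undef h)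

/-- The affine function b + a t is determined by its end values b and a + b. If both increase weakly
and one of them strictly, the integrand decreases strictly on the open interval, and so does the
integral. -/
lemma eq_of_ellipticPeriod_eq_of_le {a b a' b' : ℝ} (ha : 0 < a) (hb : 0 < b) (ha' : 0 < a')
    (hb' : 0 < b') (h1 : b ≤ b') (h2 : a + b ≤ a' + b')
    (h : ellipticPeriod a b = ellipticPeriod a' b') : a = a' ∧ b = b' := by
  by_contra hne
  have hlt {t : ℝ} (ht : t ∈ Ioo (0 : ℝ) 1) : b + a * t < b' + a' * t := by
    rcases h1.lt_or_eq with h1 | rfl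
    · nlinarith [ht.1, ht.2, mul_pos (sub_pos.2 h1) (sub_pos.2 ht.2),
        mul_nonneg (sub_nonneg.2 h2) ht.1.le]
    · have : a < a' := lt_of_le_of_ne (by linarith) fun h ↦ hne ⟨h, rfl⟩
      nlinarith [ht.1]
  have hi := ellipticPeriod_intervalIntegrable ha hb
  have hi' := ellipticPeriod_intervalIntegrable ha' hb'
  have hpos := intervalIntegral.intervalIntegral_pos_of_pos_on (hi.sub hi') (fun t ht ↦ by
    have h01 := mul_pos ht.1 (sub_pos.2 ht.2)
    have h3 : 0 < b + a * t := by nlinarith [ht.1]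
    rw [sub_pos]
    refine one_div_lt_one_div_of_lt (Real.sqrt_pos.2 (mul_pos h01 h3)) ?_
    exact Real.sqrt_lt_sqrt (mul_pos h01 h3).le (mul_lt_mul_of_pos_left (hlt ht) h01)) zero_lt_one
  rw [intervalIntegral.integral_sub hi hi'] at hpos
  exact absurd h (sub_pos.1 hpos).ne'

/-- The two integrals involve the end values b, a + b and a, a + b. When a + b ≤ a' + b', either b ≤
b' and the first integral can be compared, or b' ≤ b forces a ≤ a' and the second one can. The other
case is symmetric. -/
lemma eq_of_ellipticPeriod_eq {a b a' b' : ℝ} (ha : 0 < a) (hb : 0 < b) (ha' : 0 < a')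
    (hb' : 0 < b') (h : ellipticPeriod a b = ellipticPeriod a' b')
    (h' : ellipticPeriod b a = ellipticPeriod b' a') : a = a' ∧ b = b' := by
  rcases le_total (a + b) (a' + b') with hs | hs
  · rcases le_total b b' with hl | hl
    · exact eq_of_ellipticPeriod_eq_of_le ha hb ha' hb' hl hs h
    · exact (eq_of_ellipticPeriod_eq_of_le hb ha hb' ha' (by linarith) (by linarith) h').symm
  · rcases le_total b' b with hl | hl
    · have := eq_of_ellipticPeriod_eq_of_le ha' hb' ha hb hl hs h.symm
      exact ⟨this.1.symm, this.2.symm⟩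
    · have := eq_of_ellipticPeriod_eq_of_le hb' ha' hb ha (by linarith) (by linarith) h'.symm
      exact ⟨this.2.symm, this.1.symm⟩

lemma integral_one_div_sqrt_neg_cubic {x y z : ℝ} (hyz : y < z) :
    ∫ u in y..z, 1 / √(-(4 * (u - x) * (u - y) * (u - z))) =
      1 / 2 * ellipticPeriod (z - y) (y - x) := by
  have hzy : 0 < z - y := sub_pos.2 hyz
  have h := intervalIntegral.smul_integral_comp_mul_add
    (f := fun u ↦ 1 / √(-(4 * (u - x) * (u - y) * (u - z)))) (a := 0) (b := 1) (z - y) y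
  rw [show (z - y) * 0 + y = y by ring, show (z - y) * 1 + y = z by ring] at h
  rw [← h, ellipticPeriod, smul_eq_mul, ← intervalIntegral.integral_const_mul,
    ← intervalIntegral.integral_const_mul]
  congr 1 with t
  rw [show -(4 * ((z - y) * t + y - x) * ((z - y) * t + y - y) * ((z - y) * t + y - z)) =
    (2 * (z - y)) ^ 2 * (t * (1 - t) * (y - x + (z - y) * t)) by ring,
    Real.sqrt_mul (by positivity), Real.sqrt_sq (by positivity)]
  field_simp

lemma integral_one_div_sqrt_cubic {x y z : ℝ} (hxy : x < y) :
    ∫ u in x..y, 1 / √(4 * (u - x) * (u - y) * (u - z)) =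
      1 / 2 * ellipticPeriod (y - x) (z - y) := by
  have h := integral_one_div_sqrt_neg_cubic (x := -z) (y := -y) (z := -x) (by linarith)
  rw [show -x - -y = y - x by ring, show -y - -z = z - y by ring] at h
  rw [← h, ← intervalIntegral.integral_comp_neg]
  congr 1 with u
  ring_nf

lemma exists_mem_Ioo_eq_of_mem_Ioo {f : ℝ → ℝ} {η v : ℝ} (hη : 0 < η)
    (hf : ContinuousOn f (Icc 0 η)) (hv : (f 0 < v ∧ v < f η) ∨ (f η < v ∧ v < f 0)) :
    ∃ y ∈ Ioo 0 η, f y = v := by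
  have h := intermediate_value_uIcc (a := 0) (b := η) (f := f) (by rwa [uIcc_of_le hη.le])
  obtain ⟨y, hy, rfl⟩ := h (show v ∈ uIcc (f 0) (f η) by
    rcases hv with hv | hv
    · exact mem_uIcc.2 (Or.inl ⟨hv.1.le, hv.2.le⟩)
    · exact mem_uIcc.2 (Or.inr ⟨hv.1.le, hv.2.le⟩))
  rw [uIcc_of_le hη.le] at hy
  refine ⟨y, ⟨lt_of_le_of_ne hy.1 ?_, lt_of_le_of_ne hy.2 ?_⟩, rfl⟩ <;>
  · rintro rfl
    rcases hv with hv | hv <;> linarith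

/-- A solution of `f'² = c(f)` without critical points on `(0, η)` that increases from `x` to `y`
inverts the integral `∫ du / √c(u)`. -/
lemma integral_one_div_sqrt_eq_of_hasDerivAt {f f' c : ℝ → ℝ} {η : ℝ} (hη : 0 < η)
    (hf : ∀ y, HasDerivAt f (f' y) y) (hc : ∀ y, f' y ^ 2 = c (f y))
    (hne : ∀ y ∈ Ioo 0 η, f' y ≠ 0) (h0 : f 0 < f η) :
    ∫ u in (f 0)..(f η), 1 / √(c u) = η := by
  have hcont : Continuous f := continuous_iff_continuousAt.2 fun y ↦ (hf y).continuousAt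
  -- By Rolle's theorem, since f' has no zeros inside.
  have hinj : InjOn f (Icc 0 η) := by
    intro x hx y hy hxy
    by_contra hxy'
    wlog hlt : x < y generalizing x y
    · exact this hy hx hxy.symm (Ne.symm hxy') (lt_of_le_of_ne (not_lt.1 hlt) (Ne.symm hxy'))
    obtain ⟨z, hz, hz0⟩ := exists_hasDerivAt_eq_zero hlt hcont.continuousOn hxy fun z _ ↦ hf z
    exact hne z ⟨hx.1.trans_lt hz.1, hz.2.trans_le hy.2⟩ hz0
  have hmono := hcont.continuousOn.strictMonoOn_of_injOn_Icc hη.le h0.le hinj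
  have himg : f '' Ioo 0 η = Ioo (f 0) (f η) := by
    ext v
    constructor
    · rintro ⟨y, hy, rfl⟩
      exact ⟨hmono ⟨le_rfl, hη.le⟩ ⟨hy.1.le, hy.2.le⟩ hy.1,
        hmono ⟨hy.1.le, hy.2.le⟩ ⟨hη.le, le_rfl⟩ hy.2⟩
    · intro hv
      exact exists_mem_Ioo_eq_of_mem_Ioo hη hcont.continuousOn (Or.inl hv)
  rw [intervalIntegral.integral_of_le h0.le, integral_Ioc_eq_integral_Ioo, ← himg,
    integral_image_eq_integral_abs_deriv_smul measurableSet_Ioo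
      (fun y _ ↦ (hf y).hasDerivWithinAt) (hinj.mono Ioo_subset_Icc_self)]
  rw [setIntegral_congr_fun (g := fun _ ↦ (1 : ℝ)) measurableSet_Ioo fun y hy ↦ ?_]
  · simp [hη.le]
  · simp only [smul_eq_mul]
    rw [← hc, Real.sqrt_sq_eq_abs, mul_one_div_cancel (abs_ne_zero.2 (hne y hy))]

/-- A root cannot lie in an interval on which the cubic has a strict sign. This excludes x between y
and z, and z between x and y. The sign at the midpoint of y and z excludes the reversed order. The
lemma orders the values of ℘ at the half periods, where the signs come from squares of real
derivatives. -/
lemma lt_and_lt_of_cubic_sign {x y z : ℝ} (hxy : x ≠ y) (hxz : x ≠ z) (hyz : y ≠ z)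
    (h1 : ∀ v, (y < v ∧ v < z) ∨ (z < v ∧ v < y) → 4 * (v - x) * (v - y) * (v - z) < 0)
    (h2 : ∀ v, (x < v ∧ v < y) ∨ (y < v ∧ v < x) → 0 < 4 * (v - x) * (v - y) * (v - z)) :
    x < y ∧ y < z := by
  have hx : ¬((y < x ∧ x < z) ∨ (z < x ∧ x < y)) := fun h ↦ by simpa using h1 x h
  have hz : ¬((x < z ∧ z < y) ∨ (y < z ∧ z < x)) := fun h ↦ by simpa using h2 z h
  have hmid : x < (y + z) / 2 := by
    have h := h1 ((y + z) / 2) (by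
      rcases hyz.lt_or_gt with h | h
      · exact Or.inl ⟨by linarith, by linarith⟩
      · exact Or.inr ⟨by linarith, by linarith⟩)
    have hp : 0 < (y - z) ^ 2 := by have := sub_ne_zero.2 hyz; positivity
    by_contra hcon
    nlinarith [mul_nonneg (sub_nonneg.2 (not_lt.1 hcon)) hp.le]
  rcases hxy.lt_or_gt with h | h <;> rcases hyz.lt_or_gt with h' | h' <;>
    rcases hxz.lt_or_gt with h'' | h''
  · exact ⟨h, h'⟩
  · exact absurd (Or.inr ⟨h', h''⟩) hz
  · exact absurd (Or.inl ⟨h'', h'⟩) hz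
  · exact absurd (Or.inr ⟨h'', h⟩) hx
  · exact absurd (Or.inl ⟨h, h''⟩) hx
  · linarith
  · linarith
  · linarith

lemma hasDerivAt_re_of_im_eq_zero {e : ℂ → ℂ} {e' : ℂ} {y : ℝ} (h : HasDerivAt e e' y)
    (him : ∀ y : ℝ, (e y).im = 0) : HasDerivAt (fun y : ℝ ↦ (e y).re) e'.re y ∧ e'.im = 0 := by
  refine ⟨h.real_of_complex, ?_⟩
  have h1 := (imCLM.hasFDerivAt (x := e y)).comp_hasDerivAt y h.comp_ofReal
  have h2 : (fun y : ℝ ↦ imCLM (e y)) = fun _ ↦ 0 := by ext y; simpa using him y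
  have h3 := h1.unique (by
    change HasDerivAt (fun y : ℝ ↦ imCLM (e y)) 0 y
    rw [h2]; exact hasDerivAt_const _ _)
  simpa using h3

namespace PeriodPair

/-! ### Rectangular lattices -/

section
variable {L : PeriodPair}

lemma weierstrassP_conj (hL : ∀ l ∈ L.lattice, (starRingEnd ℂ) l ∈ L.lattice) (z : ℂ) :
    ℘[L] ((starRingEnd ℂ) z) = (starRingEnd ℂ) (℘[L] z) := by
  let e : L.lattice ≃ L.lattice :=
    ⟨fun l ↦ ⟨(starRingEnd ℂ) l, hL l l.2⟩, fun l ↦ ⟨(starRingEnd ℂ) l, hL l l.2⟩,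
      fun l ↦ by simp, fun l ↦ by simp⟩
  rw [weierstrassP, weierstrassP, Complex.conj_tsum, ← e.tsum_eq]
  congr! 2 with l
  simp [e]

lemma derivWeierstrassP_eq_zero {w : ℂ} (h : 2 * w ∈ L.lattice) : ℘'[L] w = 0 := by
  have h1 := L.derivWeierstrassP_sub_coe w ⟨_, h⟩
  rw [show w - 2 * w = -w by ring, derivWeierstrassP_neg] at h1
  exact CharZero.eq_neg_self_iff.1 h1.symm

/-- The factorization of the cubic polynomial of `℘` in terms of the values at half periods. -/
lemma derivWeierstrassP_sq_eq_prod {x y z : ℂ} (hx : x ∉ L.lattice) (hy : y ∉ L.lattice)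
    (hz : z ∉ L.lattice) (hx2 : 2 * x ∈ L.lattice) (hy2 : 2 * y ∈ L.lattice)
    (hz2 : 2 * z ∈ L.lattice) (hxy : ℘[L] x ≠ ℘[L] y) (hxz : ℘[L] x ≠ ℘[L] z)
    (hyz : ℘[L] y ≠ ℘[L] z) :
    ℘[L] x + ℘[L] y + ℘[L] z = 0 ∧ ∀ t ∉ L.lattice,
      ℘'[L] t ^ 2 = 4 * (℘[L] t - ℘[L] x) * (℘[L] t - ℘[L] y) * (℘[L] t - ℘[L] z) := by
  have e1 := L.derivWeierstrassP_sq x hx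
  have e2 := L.derivWeierstrassP_sq y hy
  have e3 := L.derivWeierstrassP_sq z hz
  rw [derivWeierstrassP_eq_zero hx2] at e1
  rw [derivWeierstrassP_eq_zero hy2] at e2
  rw [derivWeierstrassP_eq_zero hz2] at e3
  have f1 : 4 * (℘[L] x ^ 2 + ℘[L] x * ℘[L] y + ℘[L] y ^ 2) = L.g₂ := by
    refine mul_left_cancel₀ (sub_ne_zero.2 hxy) ?_
    linear_combination e2 - e1
  have f2 : 4 * (℘[L] x ^ 2 + ℘[L] x * ℘[L] z + ℘[L] z ^ 2) = L.g₂ := by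
    refine mul_left_cancel₀ (sub_ne_zero.2 hxz) ?_
    linear_combination e3 - e1
  have f3 : ℘[L] x + ℘[L] y + ℘[L] z = 0 := by
    refine mul_left_cancel₀ (sub_ne_zero.2 hyz) ?_
    linear_combination (f1 - f2) / 4
  refine ⟨f3, fun t ht ↦ ?_⟩
  have hz' : ℘[L] z = -℘[L] x - ℘[L] y := by linear_combination f3
  rw [L.derivWeierstrassP_sq t ht, hz']
  linear_combination -e1 + (℘[L] t - ℘[L] x) * f1

variable {η η' : ℝ} (h1 : L.ω₁ = -(2 * I * η')) (h2 : L.ω₂ = 2 * η)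
include h1 h2

lemma mem_lattice_iff_of_rectangular {z : ℂ} :
    z ∈ L.lattice ↔ ∃ m n : ℤ, z.re = 2 * n * η ∧ z.im = 2 * m * η' := by
  rw [mem_lattice]
  constructor
  · rintro ⟨m, n, rfl⟩
    refine ⟨-m, n, ?_, ?_⟩ <;> simp [h1, h2] <;> ring
  · rintro ⟨m, n, h, h'⟩
    refine ⟨-m, n, ?_⟩
    apply Complex.ext <;> simp [h, h', h1, h2] <;> ring

lemma conj_mem_lattice_of_rectangular (l : ℂ) (hl : l ∈ L.lattice) :
    (starRingEnd ℂ) l ∈ L.lattice := by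
  rw [mem_lattice_iff_of_rectangular h1 h2] at *
  obtain ⟨m, n, h, h'⟩ := hl
  exact ⟨-m, n, by simpa using h, by simp [h']⟩
end

/-- The data of a lattice with periods `-2iη'` and `2η`. -/
structure IsRectangular (L : PeriodPair) (η η' : ℝ) : Prop where
  pos : 0 < η
  pos' : 0 < η'
  ω₁_eq : L.ω₁ = -(2 * I * η')
  ω₂_eq : L.ω₂ = 2 * η

namespace IsRectangular

variable {L : PeriodPair} {η η' : ℝ} (h : L.IsRectangular η η')
include h

lemma mem_iff {z : ℂ} : z ∈ L.lattice ↔ ∃ m n : ℤ, z.re = 2 * n * η ∧ z.im = 2 * m * η' :=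
  mem_lattice_iff_of_rectangular h.ω₁_eq h.ω₂_eq

lemma notMem_of_re {z : ℂ} {n : ℤ} {x : ℝ} (hx : x ∈ Ioo 0 2) (hz : z.re = 2 * n * η + x * η) :
    z ∉ L.lattice := by
  intro hmem
  obtain ⟨m, k, hk, -⟩ := h.mem_iff.1 hmem
  have h1 : x = 2 * (k - n) := mul_right_cancel₀ h.pos.ne' (by linarith)
  have h2 : (0 : ℝ) < ((k - n : ℤ) : ℝ) := by push_cast; linarith [hx.1]
  have h3 : ((k - n : ℤ) : ℝ) < 1 := by push_cast; linarith [hx.2]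
  norm_cast at h2 h3
  omega

lemma notMem_of_im {z : ℂ} {n : ℤ} {x : ℝ} (hx : x ∈ Ioo 0 2) (hz : z.im = 2 * n * η' + x * η') :
    z ∉ L.lattice := by
  intro hmem
  obtain ⟨k, m, -, hk⟩ := h.mem_iff.1 hmem
  have h1 : x = 2 * (k - n) := mul_right_cancel₀ h.pos'.ne' (by linarith)
  have h2 : (0 : ℝ) < ((k - n : ℤ) : ℝ) := by push_cast; linarith [hx.1]
  have h3 : ((k - n : ℤ) : ℝ) < 1 := by push_cast; linarith [hx.2]
  norm_cast at h2 h3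
  omega

lemma mem_of_eq {z : ℂ} (m n : ℤ) (hre : z.re = 2 * n * η) (him : z.im = 2 * m * η') :
    z ∈ L.lattice := h.mem_iff.2 ⟨m, n, hre, him⟩

lemma half₁_notMem : -(I * η') ∉ L.lattice :=
  h.notMem_of_im (n := -1) (x := 1) (by norm_num) (by simp; ring)

lemma half₂_notMem : (η : ℂ) ∉ L.lattice :=
  h.notMem_of_re (n := 0) (x := 1) (by norm_num) (by simp)

lemma half₃_notMem : -(I * η') + η ∉ L.lattice :=
  h.notMem_of_re (n := 0) (x := 1) (by norm_num) (by simp)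

lemma two_mul_half₁_mem : 2 * -(I * η') ∈ L.lattice :=
  h.mem_of_eq (-1) 0 (by simp) (by simp)

lemma two_mul_half₂_mem : 2 * (η : ℂ) ∈ L.lattice := h.mem_of_eq 0 1 (by simp) (by simp)

lemma two_mul_half₃_mem : 2 * (-(I * η') + η) ∈ L.lattice :=
  h.mem_of_eq (-1) 1 (by simp) (by simp)

lemma weierstrassP_half₁_ne_half₂ : ℘[L] (-(I * η')) ≠ ℘[L] η := by
  rw [Ne, L.weierstrassP_eq_iff h.half₁_notMem h.half₂_notMem, not_or]
  exact ⟨h.notMem_of_re (n := 0) (x := 1) (by norm_num) (by simp),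
    h.notMem_of_re (n := -1) (x := 1) (by norm_num) (by simp; ring)⟩

lemma weierstrassP_half₁_ne_half₃ : ℘[L] (-(I * η')) ≠ ℘[L] (-(I * η') + η) := by
  rw [Ne, L.weierstrassP_eq_iff h.half₁_notMem h.half₃_notMem, not_or]
  exact ⟨h.notMem_of_re (n := 0) (x := 1) (by norm_num) (by simp),
    h.notMem_of_re (n := -1) (x := 1) (by norm_num) (by simp; ring)⟩

lemma weierstrassP_half₃_ne_half₂ : ℘[L] (-(I * η') + η) ≠ ℘[L] η := by
  rw [Ne, L.weierstrassP_eq_iff h.half₃_notMem h.half₂_notMem, not_or]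
  exact ⟨h.notMem_of_im (n := -1) (x := 1) (by norm_num) (by simp; ring),
    h.notMem_of_im (n := -1) (x := 1) (by norm_num) (by simp; ring)⟩

lemma weierstrassP_half_sum :
    ℘[L] (-(I * η')) + ℘[L] (-(I * η') + η) + ℘[L] η = 0 ∧ ∀ t ∉ L.lattice,
      ℘'[L] t ^ 2 = 4 * (℘[L] t - ℘[L] (-(I * η'))) * (℘[L] t - ℘[L] (-(I * η') + η)) *
        (℘[L] t - ℘[L] η) :=
  derivWeierstrassP_sq_eq_prod h.half₁_notMem h.half₃_notMem h.half₂_notMem h.two_mul_half₁_mem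
    h.two_mul_half₃_mem h.two_mul_half₂_mem h.weierstrassP_half₁_ne_half₃
    h.weierstrassP_half₁_ne_half₂ h.weierstrassP_half₃_ne_half₂

/-- By the factorization of ℘'², a zero of ℘' would give z the same ℘-value as a half period w. Here
z + w and z - w differ by the period 2w, so one condition for each half period suffices. -/
lemma derivWeierstrassP_ne_zero {z : ℂ} (hz : z ∉ L.lattice) (hz1 : z + -(I * η') ∉ L.lattice)
    (hz2 : z + η ∉ L.lattice) (hz3 : z + (-(I * η') + η) ∉ L.lattice) : ℘'[L] z ≠ 0 := by
  have key {w : ℂ} (hw : w ∉ L.lattice) (hw2 : 2 * w ∈ L.lattice) (hzw : z + w ∉ L.lattice) :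
      ℘[L] z - ℘[L] w ≠ 0 := by
    rw [sub_ne_zero, Ne, L.weierstrassP_eq_iff hz hw, not_or]
    refine ⟨hzw, fun hm ↦ hzw ?_⟩
    have := add_mem hm hw2
    rwa [show z - w + 2 * w = z + w by ring] at this
  intro h0
  have h1 := h.weierstrassP_half_sum.2 z hz
  rw [h0, zero_pow two_ne_zero] at h1
  refine absurd h1.symm ?_
  exact mul_ne_zero (mul_ne_zero (mul_ne_zero (by norm_num)
    (key h.half₁_notMem h.two_mul_half₁_mem hz1)) (key h.half₃_notMem h.two_mul_half₃_mem hz3))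
    (key h.half₂_notMem h.two_mul_half₂_mem hz2)

/-- On a rectangular lattice ℘ commutes with conjugation. As ℘ is also even and periodic, its value
is fixed by conjugation whenever the conjugate of z is congruent to z or to -z. -/
lemma weierstrassP_im_eq_zero {z : ℂ}
    (hz : (starRingEnd ℂ) z - z ∈ L.lattice ∨ (starRingEnd ℂ) z + z ∈ L.lattice) :
    (℘[L] z).im = 0 := by
  have h1 := weierstrassP_conj (conj_mem_lattice_of_rectangular h.ω₁_eq h.ω₂_eq) z
  rw [← Complex.conj_eq_iff_im, ← h1]
  rcases hz with hz | hz
  · simpa using L.weierstrassP_add_coe z ⟨_, hz⟩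
  · have := L.weierstrassP_add_coe (-z) ⟨_, hz⟩
    simpa using this

/-- The vertical line through the half period `ω₃`. -/
lemma vertical_notMem (y : ℝ) : -I * (y : ℂ) - (-(I * η') + η) ∉ L.lattice :=
  h.notMem_of_re (n := -1) (x := 1) (by norm_num) (by simp; ring)

lemma vertical_im (y : ℝ) : (℘[L] (-I * (y : ℂ) - (-(I * η') + η))).im = 0 :=
  h.weierstrassP_im_eq_zero (Or.inr (h.mem_of_eq 0 (-1) (by simp; ring) (by simp)))

lemma vertical_hasDerivAt (y : ℝ) :
    HasDerivAt (fun y : ℝ ↦ (℘[L] (-I * (y : ℂ) - (-(I * η') + η))).re)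
      (℘'[L] (-I * (y : ℂ) - (-(I * η') + η)) * -I).re y ∧
    (℘'[L] (-I * (y : ℂ) - (-(I * η') + η)) * -I).im = 0 := by
  refine hasDerivAt_re_of_im_eq_zero (e := fun z ↦ ℘[L] (-I * z - (-(I * η') + η)))
    ?_ h.vertical_im
  have := (L.hasDerivAt_weierstrassP (h.vertical_notMem y)).comp (y : ℂ)
    (((hasDerivAt_id (y : ℂ)).const_mul (-I)).sub_const (-(I * η') + η))
  simpa [Function.comp_def] using this

/-- The horizontal line through the half period `ω₁`. -/
lemma horizontal_notMem (x : ℝ) : (x : ℂ) - -(I * η') ∉ L.lattice :=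
  h.notMem_of_im (n := 0) (x := 1) (by norm_num) (by simp)

lemma horizontal_im (x : ℝ) : (℘[L] ((x : ℂ) - -(I * η'))).im = 0 :=
  h.weierstrassP_im_eq_zero (Or.inl (h.mem_of_eq (-1) 0 (by simp) (by simp; ring)))

lemma horizontal_hasDerivAt (x : ℝ) :
    HasDerivAt (fun x : ℝ ↦ (℘[L] ((x : ℂ) - -(I * η'))).re) (℘'[L] ((x : ℂ) - -(I * η'))).re x ∧
    (℘'[L] ((x : ℂ) - -(I * η'))).im = 0 := by
  refine hasDerivAt_re_of_im_eq_zero (e := fun z ↦ ℘[L] (z - -(I * η'))) ?_ h.horizontal_im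
  exact (L.hasDerivAt_weierstrassP (h.horizontal_notMem x)).comp_sub_const (x : ℂ) _

/-- The values of `℘` at the half periods of a rectangular lattice. -/
theorem exists_half_period_values : ∃ E₁ E₃ E₂ : ℝ, E₁ < E₃ ∧ E₃ < E₂ ∧ E₁ + E₃ + E₂ = 0 ∧
    ℘[L] (-(I * η')) = E₁ ∧ ℘[L] (-(I * η') + η) = E₃ ∧ ℘[L] η = E₂ ∧
    η' = 1 / 2 * ellipticPeriod (E₂ - E₃) (E₃ - E₁) ∧
    η = 1 / 2 * ellipticPeriod (E₃ - E₁) (E₂ - E₃) := by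
  -- Up to sign and periods, f follows ℘ from the half period ω₃ to ω₂ as y goes from 0 to η', and g
  -- follows it from ω₁ to ω₃ on [0, η].
  obtain ⟨f, hf⟩ : ∃ f : ℝ → ℝ, ∀ y : ℝ, ℘[L] (-I * (y : ℂ) - (-(I * η') + η)) = f y :=
    ⟨fun y ↦ (℘[L] (-I * (y : ℂ) - (-(I * η') + η))).re, fun y ↦
      Complex.ext rfl (h.vertical_im y)⟩
  obtain ⟨g, hg⟩ : ∃ g : ℝ → ℝ, ∀ x : ℝ, ℘[L] ((x : ℂ) - -(I * η')) = g x :=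
    ⟨fun y ↦ _, fun y ↦ Complex.ext rfl (h.horizontal_im y)⟩
  obtain ⟨f', hf'⟩ : ∃ f' : ℝ → ℝ, ∀ y : ℝ, ℘'[L] (-I * (y : ℂ) - (-(I * η') + η)) * -I = f' y :=
    ⟨fun y ↦ _, fun y ↦ Complex.ext rfl (h.vertical_hasDerivAt y).2⟩
  obtain ⟨g', hg'⟩ : ∃ g' : ℝ → ℝ, ∀ x : ℝ, ℘'[L] ((x : ℂ) - -(I * η')) = g' x :=
    ⟨fun y ↦ _, fun y ↦ Complex.ext rfl (h.horizontal_hasDerivAt y).2⟩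
  have dF (y : ℝ) : HasDerivAt f (f' y) y := by
    simpa only [hf, hf', ofReal_re] using (h.vertical_hasDerivAt y).1
  have dG (y : ℝ) : HasDerivAt g (g' y) y := by
    simpa only [hg, hg', ofReal_re] using (h.horizontal_hasDerivAt y).1
  have v1 : ℘[L] (-(I * η')) = g 0 := by
    rw [← hg, ← L.weierstrassP_neg (-(I * η'))]; simp
  have v3 : ℘[L] (-(I * η') + η) = f 0 := by
    rw [← hf, ← L.weierstrassP_neg]; simp
  have v3' : ℘[L] (-(I * η') + η) = g η := by
    rw [← hg, ← L.weierstrassP_sub_coe _ ⟨_, h.two_mul_half₁_mem⟩]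
    congr 1; ring
  have v2 : ℘[L] η = f η' := by
    rw [← hf, ← L.weierstrassP_neg η]
    congr 1; ring
  have v3r : f 0 = g η := by exact_mod_cast v3.symm.trans v3'
  have hsum := h.weierstrassP_half_sum
  have n13 := h.weierstrassP_half₁_ne_half₃
  have n12 := h.weierstrassP_half₁_ne_half₂
  have n32 := h.weierstrassP_half₃_ne_half₂
  rw [v1, v2] at n12
  rw [v1, v3'] at n13
  rw [v3', v2] at n32
  rw [v1, v3', v2] at hsum
  norm_cast at n12 n13 n32
  -- The direction -i of the line contributes the factor (-i)² = -1.
  have cF (y : ℝ) : f' y ^ 2 = -(4 * (f y - g 0) * (f y - g η) * (f y - f η')) := by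
    have := hsum.2 _ (h.vertical_notMem y)
    rw [hf] at this
    have e : (f' y : ℂ) ^ 2 = -(4 * (f y - g 0) * (f y - g η) * (f y - f η')) := by
      rw [← this, ← hf', mul_pow, neg_sq, I_sq]; ring
    exact_mod_cast e
  have cG (y : ℝ) : g' y ^ 2 = 4 * (g y - g 0) * (g y - g η) * (g y - f η') := by
    have := hsum.2 _ (h.horizontal_notMem y)
    rw [hg, hg'] at this
    exact_mod_cast this
  have nF (y : ℝ) (hy : y ∈ Ioo 0 η') : f' y ≠ 0 := by
    have hx1 : y / η' ∈ Ioo 0 1 := ⟨div_pos hy.1 h.pos', (div_lt_one h.pos').2 hy.2⟩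
    have hy' : y = y / η' * η' := (div_mul_cancel₀ _ h.pos'.ne').symm
    intro h0
    have := hf' y
    rw [h0, ofReal_zero, mul_eq_zero] at this
    refine h.derivWeierstrassP_ne_zero (h.vertical_notMem y)
      (h.notMem_of_re (n := -1) (x := 1) (by norm_num) (by simp; ring))
      (h.notMem_of_im (n := 0) (x := 1 - y / η') ⟨by linarith [hx1.2], by linarith [hx1.1]⟩
        (by simp only [sub_mul, ← hy']; simp; ring))
      (h.notMem_of_im (n := -1) (x := 2 - y / η') ⟨by linarith [hx1.2], by linarith [hx1.1]⟩
        (by simp only [sub_mul, ← hy']; simp; ring)) (this.resolve_right (by simp))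
  have nG (y : ℝ) (hy : y ∈ Ioo 0 η) : g' y ≠ 0 := by
    have hx1 : y / η ∈ Ioo 0 1 := ⟨div_pos hy.1 h.pos, (div_lt_one h.pos).2 hy.2⟩
    have hy' : y = y / η * η := (div_mul_cancel₀ _ h.pos.ne').symm
    intro h0
    have := hg' y
    rw [h0, ofReal_zero] at this
    refine h.derivWeierstrassP_ne_zero (h.horizontal_notMem y)
      (h.notMem_of_re (n := 0) (x := y / η) ⟨hx1.1, by linarith [hx1.2]⟩
        (by simp only [← hy']; simp))
      (h.notMem_of_im (n := 0) (x := 1) (by norm_num) (by simp))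
      (h.notMem_of_re (n := 0) (x := y / η + 1) ⟨by linarith [hx1.1], by linarith [hx1.2]⟩
        (by simp only [add_mul, ← hy']; simp)) this
  have contF : Continuous f := continuous_iff_continuousAt.2 fun y ↦ (dF y).continuousAt
  have contG : Continuous g := continuous_iff_continuousAt.2 fun y ↦ (dG y).continuousAt
  -- Between two consecutive half periods every intermediate value is attained at a point with
  -- nonzero derivative. Hence the cubic has the sign of ∓ a positive square there.
  obtain ⟨lt13, lt32⟩ := lt_and_lt_of_cubic_sign n13 n12 n32
    (fun v hv ↦ by
      rw [← v3r] at hv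
      obtain ⟨y, hy, rfl⟩ := exists_mem_Ioo_eq_of_mem_Ioo h.pos' contF.continuousOn hv
      have := cF y
      have : 0 < f' y ^ 2 := by have := nF y hy; positivity
      linarith)
    (fun v hv ↦ by
      obtain ⟨y, hy, rfl⟩ := exists_mem_Ioo_eq_of_mem_Ioo h.pos contG.continuousOn hv
      rw [← cG]
      have := nG y hy
      positivity)
  refine ⟨g 0, g η, f η', lt13, lt32, by exact_mod_cast hsum.1, v1, v3', v2, ?_, ?_⟩
  · rw [← integral_one_div_sqrt_neg_cubic lt32, ← v3r]
    refine (integral_one_div_sqrt_eq_of_hasDerivAt h.pos' dF (fun y ↦ ?_) nF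
      (v3r ▸ lt32)).symm
    rw [cF, v3r]
  · rw [← integral_one_div_sqrt_cubic lt13]
    exact (integral_one_div_sqrt_eq_of_hasDerivAt h.pos dG cG nG lt13).symm

/-- The roots of the cubic polynomial are determined by the periods. -/
theorem half_period_values_eq {E₁ E₃ E₂ : ℝ} (h13 : E₁ < E₃) (h32 : E₃ < E₂)
    (hsum : E₁ + E₃ + E₂ = 0)
    (hη' : η' = ∫ u in E₃..E₂, 1 / √(-(4 * (u - E₁) * (u - E₃) * (u - E₂))))
    (hη : η = ∫ u in E₁..E₃, 1 / √(4 * (u - E₁) * (u - E₃) * (u - E₂))) :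
    ℘[L] (-(I * η')) = E₁ ∧ ℘[L] (-(I * η') + η) = E₃ ∧ ℘[L] η = E₂ := by
  obtain ⟨F₁, F₃, F₂, g13, g32, gsum, v1, v3, v2, i1, i2⟩ := h.exists_half_period_values
  rw [integral_one_div_sqrt_neg_cubic h32] at hη'
  rw [integral_one_div_sqrt_cubic h13] at hη
  -- The integrals determine the two differences of consecutive roots, and the vanishing sum then
  -- determines the roots.
  obtain ⟨e1, e2⟩ := eq_of_ellipticPeriod_eq (sub_pos.2 h32) (sub_pos.2 h13) (sub_pos.2 g32)
    (sub_pos.2 g13) (by linarith) (by linarith)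
  rw [v1, v3, v2, show F₁ = E₁ by linarith, show F₃ = E₃ by linarith, show F₂ = E₂ by linarith]
  exact ⟨rfl, rfl, rfl⟩

end IsRectangular
end PeriodPair

namespace ToyTop

/-! ### Coordinates -/

/-- The element of `su(2)` with the coordinates `a`, `b`, `c` in an orthonormal basis
whose third element is the vertical. -/
noncomputable def su2Vec (a b c : ℝ) : Mat :=
  !![I * c / 2, (I * a - b) / 2; (I * a + b) / 2, -(I * c / 2)]

lemma su2Vec_mem (a b c : ℝ) : su2Vec a b c ∈ su2 := by
  constructor
  · ext i j
    fin_cases i <;> fin_cases j <;> simp [su2Vec] <;> ring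
  · simp [su2Vec, Matrix.trace_fin_two]

lemma eq_su2Vec_of_mem {x : Mat} (hx : x ∈ su2) :
    x = su2Vec (2 * (x 0 1).im) (-(2 * (x 0 1).re)) (2 * (x 0 0).im) := by
  obtain ⟨h1, h2⟩ := hx
  have h00 := congrFun (congrFun h1 0) 0
  have h10 := congrFun (congrFun h1 1) 0
  rw [Matrix.trace_fin_two] at h2
  simp only [conjTranspose_apply, RCLike.star_def] at h00 h10
  have hre : (x 0 0).re = 0 := by
    have := congrArg Complex.re h00
    simp at this
    linarith
  have h10re := congrArg Complex.re h10
  have h10im := congrArg Complex.im h10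
  have h11re := congrArg Complex.re h2
  have h11im := congrArg Complex.im h2
  simp at h10re h10im h11re h11im
  ext i j
  fin_cases i <;> fin_cases j <;> apply Complex.ext <;> simp [su2Vec] <;> linarith

lemma ip_su2Vec (a b c a' b' c' : ℝ) :
    ip (su2Vec a b c) (su2Vec a' b' c') = a * a' + b * b' + c * c' := by
  simp [ip, su2Vec, Matrix.trace_fin_two]
  ring

lemma lie_su2Vec (a b c a' b' c' : ℝ) :
    ⁅su2Vec a b c, su2Vec a' b' c'⁆ =
      su2Vec (b * c' - c * b') (c * a' - a * c') (a * b' - b * a') := by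
  ext i j
  fin_cases i <;> fin_cases j <;>
    simp [su2Vec, Ring.lie_def] <;> ring_nf <;> simp <;> ring_nf

lemma su2Vec_add (a b c a' b' c' : ℝ) :
    su2Vec a b c + su2Vec a' b' c' = su2Vec (a + a') (b + b') (c + c') := by
  ext i j
  fin_cases i <;> fin_cases j <;> simp [su2Vec] <;> ring

lemma smul_su2Vec (k a b c : ℝ) : k • su2Vec a b c = su2Vec (k * a) (k * b) (k * c) := by
  ext i j
  fin_cases i <;> fin_cases j <;> simp [su2Vec] <;> ring

lemma vert_eq : vert = su2Vec 0 0 1 := by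
  ext i j
  fin_cases i <;> fin_cases j <;> simp [su2Vec, vert]

/-- The first coordinate of the axis. -/
def axis₁ (Φ : Mat) : ℝ := -2 * ((Φ 0 0).re * (Φ 0 1).re - (Φ 0 0).im * (Φ 0 1).im)
/-- The second coordinate of the axis. -/
def axis₂ (Φ : Mat) : ℝ := -2 * ((Φ 0 0).re * (Φ 0 1).im + (Φ 0 0).im * (Φ 0 1).re)
/-- The third coordinate of the axis. -/
def axis₃ (Φ : Mat) : ℝ :=
  (Φ 0 0).re ^ 2 + (Φ 0 0).im ^ 2 - (Φ 0 1).re ^ 2 - (Φ 0 1).im ^ 2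

section SU2
variable {Φ : Mat} (h : Φ ∈ Matrix.specialUnitaryGroup (Fin 2) ℂ)
include h

lemma inv_eq_conjTranspose_of_mem : Φ⁻¹ = Φᴴ :=
  Matrix.inv_eq_right_inv (Matrix.mem_unitaryGroup_iff.1 (Matrix.mem_specialUnitaryGroup_iff.1 h).1)

lemma entries_of_mem : Φ 1 0 = -(starRingEnd ℂ) (Φ 0 1) ∧ Φ 1 1 = (starRingEnd ℂ) (Φ 0 0) := by
  have h1 := inv_eq_conjTranspose_of_mem h
  have h2 := (Matrix.mem_specialUnitaryGroup_iff.1 h).2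
  rw [Matrix.inv_def, h2, Matrix.adjugate_fin_two] at h1
  have e1 := congrFun (congrFun h1 0) 0
  have e2 := congrFun (congrFun h1 1) 0
  simp at e1 e2
  exact ⟨by rw [← e2, neg_neg], e1⟩

lemma normSq_entries_of_mem :
    (Φ 0 0).re ^ 2 + (Φ 0 0).im ^ 2 + (Φ 0 1).re ^ 2 + (Φ 0 1).im ^ 2 = 1 := by
  have h2 := (Matrix.mem_specialUnitaryGroup_iff.1 h).2
  rw [Matrix.det_fin_two, (entries_of_mem h).1, (entries_of_mem h).2] at h2
  have := congrArg Complex.re h2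
  simp at this
  linarith

lemma axis_eq : axis Φ = su2Vec (axis₁ Φ) (axis₂ Φ) (axis₃ Φ) := by
  rw [axis, inv_eq_conjTranspose_of_mem h]
  obtain ⟨h1, h2⟩ := entries_of_mem h
  ext i j
  fin_cases i <;> fin_cases j <;> apply Complex.ext <;>
    simp [su2Vec, vert, Matrix.mul_apply, Fin.sum_univ_two, h1, h2, axis₁, axis₂, axis₃, sq] <;> ring

lemma axis_normSq : axis₁ Φ ^ 2 + axis₂ Φ ^ 2 + axis₃ Φ ^ 2 = 1 := by
  have := normSq_entries_of_mem h
  rw [axis₁, axis₂, axis₃]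
  linear_combination ((Φ 0 0).re ^ 2 + (Φ 0 0).im ^ 2 + (Φ 0 1).re ^ 2 + (Φ 0 1).im ^ 2 + 1) * this

lemma height_eq : height Φ = axis₃ Φ := by
  rw [height, axis_eq h, vert_eq, ip_su2Vec]; ring

lemma lie_axis_vert : ⁅axis Φ, vert⁆ = su2Vec (axis₂ Φ) (-axis₁ Φ) 0 := by
  rw [axis_eq h, vert_eq, lie_su2Vec]
  ring_nf

variable (T : ToyTop) (a b c : ℝ)

lemma momentum_eq : T.momentum Φ (su2Vec a b c) =
    su2Vec
      (T.A * a + (T.C - T.A) * (a * axis₁ Φ + b * axis₂ Φ + c * axis₃ Φ) * axis₁ Φ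
        + T.μ * T.s * (a * axis₂ Φ - b * axis₁ Φ) * axis₂ Φ)
      (T.A * b + (T.C - T.A) * (a * axis₁ Φ + b * axis₂ Φ + c * axis₃ Φ) * axis₂ Φ
        - T.μ * T.s * (a * axis₂ Φ - b * axis₁ Φ) * axis₁ Φ)
      (T.A * c + (T.C - T.A) * (a * axis₁ Φ + b * axis₂ Φ + c * axis₃ Φ) * axis₃ Φ) := by
  rw [momentum, lie_axis_vert h, axis_eq h]
  simp only [ip_su2Vec, smul_su2Vec, su2Vec_add]
  ring_nf

lemma kinetic_eq : T.kinetic Φ (su2Vec a b c) = 1 / 2 * T.A * (a ^ 2 + b ^ 2 + c ^ 2)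
    + 1 / 2 * (T.C - T.A) * (a * axis₁ Φ + b * axis₂ Φ + c * axis₃ Φ) ^ 2
    + 1 / 2 * (T.μ * T.s) * (a * axis₂ Φ - b * axis₁ Φ) ^ 2 := by
  rw [kinetic, lie_axis_vert h, axis_eq h]
  simp only [ip_su2Vec]
  ring

lemma potential_eq : T.potential Φ = T.μ * axis₃ Φ := by
  rw [potential, axis_eq h, vert_eq, ip_su2Vec]; ring

end SU2

/-- Along a curve in `SU(2)` with `Φ' = ω Φ` the axis satisfies `r' = ω × r`. -/
lemma hasDerivAt_axis {Φ : ℝ → Mat} (hΦ : ∀ t, Φ t ∈ Matrix.specialUnitaryGroup (Fin 2) ℂ)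
    {a b c t : ℝ} (hd : HasDerivAt Φ (su2Vec a b c * Φ t) t) :
    HasDerivAt (fun t ↦ axis₁ (Φ t)) (b * axis₃ (Φ t) - c * axis₂ (Φ t)) t ∧
    HasDerivAt (fun t ↦ axis₂ (Φ t)) (c * axis₁ (Φ t) - a * axis₃ (Φ t)) t ∧
    HasDerivAt (fun t ↦ axis₃ (Φ t)) (a * axis₂ (Φ t) - b * axis₁ (Φ t)) t := by
  have hij (i j : Fin 2) : HasDerivAt (fun t ↦ Φ t i j) ((su2Vec a b c * Φ t) i j) t :=
    hasDerivAt_pi.1 (hasDerivAt_pi.1 hd i) j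
  have hre (i j : Fin 2) : HasDerivAt (fun t ↦ (Φ t i j).re) ((su2Vec a b c * Φ t) i j).re t :=
    reCLM.hasFDerivAt.comp_hasDerivAt t (hij i j)
  have him (i j : Fin 2) : HasDerivAt (fun t ↦ (Φ t i j).im) ((su2Vec a b c * Φ t) i j).im t :=
    imCLM.hasFDerivAt.comp_hasDerivAt t (hij i j)
  obtain ⟨h1, h2⟩ := entries_of_mem (hΦ t)
  have hx := hre 0 0
  have hx' := him 0 0
  have hy := hre 0 1
  have hy' := him 0 1
  simp only [Matrix.mul_apply, Fin.sum_univ_two, h1, h2, su2Vec] at hx hx' hy hy'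
  refine ⟨(((hx.mul hy).sub (hx'.mul hy')).const_mul (-2)).congr_deriv ?_,
    (((hx.mul hy').add (hx'.mul hy)).const_mul (-2)).congr_deriv ?_,
    ((((hx.pow 2).add (hx'.pow 2)).sub (hy.pow 2)).sub (hy'.pow 2)).congr_deriv ?_⟩ <;>
  · simp [axis₁, axis₂, axis₃]
    ring

/-! ### Variations of the position by one-parameter groups -/

lemma hasDerivAt_exp_smul (η : Mat) (ε : ℝ) :
    HasDerivAt (fun ε : ℝ ↦ NormedSpace.exp (ε • η)) (η * NormedSpace.exp (ε • η)) ε := by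
  -- The derivative of the exponential is taken in a normed algebra. The operator norm chosen here
  -- induces the usual topology on matrices.
  let : NormedRing Mat := Matrix.linftyOpNormedRing
  let : NormedAlgebra ℝ Mat := Matrix.linftyOpNormedAlgebra
  exact hasDerivAt_exp_smul_const' (𝕂 := ℝ) η ε

/-- The derivative of the determinant along the group is the trace of η times the determinant, hence
zero. -/
lemma det_exp_smul {η : Mat} (hη : η.trace = 0) (ε : ℝ) :
    (NormedSpace.exp (ε • η)).det = 1 := by
  have hd (ε : ℝ) : HasDerivAt (fun ε : ℝ ↦ (NormedSpace.exp (ε • η)).det) 0 ε := by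
    have hij (i j : Fin 2) := hasDerivAt_pi.1 (hasDerivAt_pi.1 (hasDerivAt_exp_smul η ε) i) j
    simp only [Matrix.det_fin_two]
    refine (((hij 0 0).mul (hij 1 1)).sub ((hij 0 1).mul (hij 1 0))).congr_deriv ?_
    rw [Matrix.trace_fin_two] at hη
    simp only [Matrix.mul_apply, Fin.sum_univ_two]
    linear_combination (NormedSpace.exp (ε • η) 0 0 * NormedSpace.exp (ε • η) 1 1
      - NormedSpace.exp (ε • η) 0 1 * NormedSpace.exp (ε • η) 1 0) * hη
  rw [is_const_of_deriv_eq_zero (fun ε ↦ (hd ε).differentiableAt) (fun ε ↦ (hd ε).deriv) ε 0]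
  simp

lemma exp_smul_mul_mem {Φ η : Mat} (hΦ : Φ ∈ Matrix.specialUnitaryGroup (Fin 2) ℂ)
    (hη : η ∈ su2) (ε : ℝ) :
    NormedSpace.exp (ε • η) * Φ ∈ Matrix.specialUnitaryGroup (Fin 2) ℂ := by
  refine mul_mem (Matrix.mem_specialUnitaryGroup_iff.2 ⟨?_, det_exp_smul hη.2 ε⟩) hΦ
  rw [Matrix.mem_unitaryGroup_iff, Matrix.star_eq_conjTranspose, ← Matrix.exp_conjTranspose]
  rw [conjTranspose_smul, hη.1, star_trivial, smul_neg, Matrix.exp_neg]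
  exact Matrix.mul_nonsing_inv _ ((Matrix.isUnit_iff_isUnit_det _).1 (Matrix.isUnit_exp _))

lemma hasDerivAt_exp_smul_mul (Φ η : Mat) :
    HasDerivAt (fun ε : ℝ ↦ NormedSpace.exp (ε • η) * Φ) (η * Φ) 0 := by
  have h := hasDerivAt_exp_smul η 0
  rw [zero_smul, NormedSpace.exp_zero, mul_one] at h
  refine hasDerivAt_pi.2 fun i ↦ hasDerivAt_pi.2 fun j ↦ ?_
  have hij (k : Fin 2) := hasDerivAt_pi.1 (hasDerivAt_pi.1 h i) k
  simp only [Matrix.mul_apply, Fin.sum_univ_two]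
  exact ((hij 0).mul_const (Φ 0 j)).add ((hij 1).mul_const (Φ 1 j))

/-- The variation keeps ω fixed and turns the axis with angular velocity η, so the chain rule is
applied with r' = η × r. -/
lemma lagrangianDeriv_eq (T : ToyTop) {Φ : Mat}
    (hΦ : Φ ∈ Matrix.specialUnitaryGroup (Fin 2) ℂ) (a b c x y z : ℝ) :
    T.lagrangianDeriv Φ (su2Vec a b c) (su2Vec x y z) =
      (T.C - T.A) * (a * axis₁ Φ + b * axis₂ Φ + c * axis₃ Φ) *
        (a * (y * axis₃ Φ - z * axis₂ Φ) + b * (z * axis₁ Φ - x * axis₃ Φ)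
          + c * (x * axis₂ Φ - y * axis₁ Φ))
      + T.μ * T.s * (a * axis₂ Φ - b * axis₁ Φ) *
        (a * (z * axis₁ Φ - x * axis₃ Φ) - b * (y * axis₃ Φ - z * axis₂ Φ))
      - T.μ * (x * axis₂ Φ - y * axis₁ Φ) := by
  have hmem (ε : ℝ) := exp_smul_mul_mem hΦ (su2Vec_mem x y z) ε
  have hd := hasDerivAt_exp_smul_mul Φ (su2Vec x y z)
  have h0 : NormedSpace.exp ((0 : ℝ) • su2Vec x y z) * Φ = Φ := by simp
  obtain ⟨h1, h2, h3⟩ := hasDerivAt_axis (t := 0) hmem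
    (show HasDerivAt _ (su2Vec x y z * (NormedSpace.exp ((0 : ℝ) • su2Vec x y z) * Φ)) 0 by
      rw [h0]; exact hd)
  rw [h0] at h1 h2 h3
  rw [lagrangianDeriv]
  refine HasDerivAt.deriv ?_
  have he : (fun ε : ℝ ↦ T.lagrangian (NormedSpace.exp (ε • su2Vec x y z) * Φ) (su2Vec a b c)) =
      fun ε ↦ _ := funext fun ε ↦ by
    rw [lagrangian, kinetic_eq (hmem ε), potential_eq (hmem ε)]
  rw [he]
  refine ((((((h1.const_mul a).add (h2.const_mul b)).add (h3.const_mul c)).pow 2).const_mul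
    (1 / 2 * (T.C - T.A))).const_add (1 / 2 * T.A * (a ^ 2 + b ^ 2 + c ^ 2)) |>.add
    ((((h2.const_mul a).sub (h1.const_mul b)).pow 2).const_mul
      (1 / 2 * (T.μ * T.s))) |>.sub (h3.const_mul T.μ)).congr_deriv ?_
  simp
  ring

end ToyTop

namespace ToyTop

/-! ### The equations of motion in coordinates -/

/-- The equations of motion in coordinates: `w` is the angular velocity, `r` the axis, and `m` the
momentum. -/
structure CoordMotion (T : ToyTop) (w₁ w₂ w₃ r₁ r₂ r₃ m₁ m₂ m₃ : ℝ → ℝ) : Prop where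
  normSq : ∀ t, r₁ t ^ 2 + r₂ t ^ 2 + r₃ t ^ 2 = 1
  m₁_eq : ∀ t, m₁ t = T.A * w₁ t + (T.C - T.A) * (w₁ t * r₁ t + w₂ t * r₂ t + w₃ t * r₃ t) * r₁ t
        + T.μ * T.s * (w₁ t * r₂ t - w₂ t * r₁ t) * r₂ t
  m₂_eq : ∀ t, m₂ t = T.A * w₂ t + (T.C - T.A) * (w₁ t * r₁ t + w₂ t * r₂ t + w₃ t * r₃ t) * r₂ t
        - T.μ * T.s * (w₁ t * r₂ t - w₂ t * r₁ t) * r₁ t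
  m₃_eq : ∀ t, m₃ t = T.A * w₃ t + (T.C - T.A) * (w₁ t * r₁ t + w₂ t * r₂ t + w₃ t * r₃ t) * r₃ t
  deriv_r₁ : ∀ t, HasDerivAt r₁ (w₂ t * r₃ t - w₃ t * r₂ t) t
  deriv_r₂ : ∀ t, HasDerivAt r₂ (w₃ t * r₁ t - w₁ t * r₃ t) t
  deriv_r₃ : ∀ t, HasDerivAt r₃ (w₁ t * r₂ t - w₂ t * r₁ t) t
  deriv_m₁ : ∀ t, HasDerivAt m₁ (w₂ t * m₃ t - w₃ t * m₂ t
    + ((T.C - T.A) * (w₁ t * r₁ t + w₂ t * r₂ t + w₃ t * r₃ t) * (w₃ t * r₂ t - w₂ t * r₃ t)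
      - T.μ * T.s * (w₁ t * r₂ t - w₂ t * r₁ t) * (w₁ t * r₃ t) - T.μ * r₂ t)) t
  deriv_m₂ : ∀ t, HasDerivAt m₂ (w₃ t * m₁ t - w₁ t * m₃ t
    + ((T.C - T.A) * (w₁ t * r₁ t + w₂ t * r₂ t + w₃ t * r₃ t) * (w₁ t * r₃ t - w₃ t * r₁ t)
      - T.μ * T.s * (w₁ t * r₂ t - w₂ t * r₁ t) * (w₂ t * r₃ t) + T.μ * r₁ t)) t
  deriv_m₃ : ∀ t, HasDerivAt m₃ (w₁ t * m₂ t - w₂ t * m₁ t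
    + ((T.C - T.A) * (w₁ t * r₁ t + w₂ t * r₂ t + w₃ t * r₃ t) * (w₂ t * r₁ t - w₁ t * r₂ t)
      + T.μ * T.s * (w₁ t * r₂ t - w₂ t * r₁ t) * (w₁ t * r₁ t + w₂ t * r₂ t))) t

variable {T : ToyTop}

lemma eq_of_hasDerivAt_zero {f : ℝ → ℝ} (hf : ∀ t, HasDerivAt f 0 t) (t : ℝ) : f t = f 0 :=
  is_const_of_deriv_eq_zero (fun t ↦ (hf t).differentiableAt) (fun t ↦ (hf t).deriv) t 0

/-- Testing the momentum equation against an orthonormal basis of su(2) gives the three scalar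
equations. -/
lemma IsMotion.exists_coordMotion {Φ ω : ℝ → Mat} (h : T.IsMotion Φ ω) :
    ∃ w₁ w₂ w₃ m₁ m₂ m₃ : ℝ → ℝ, (∀ t, ω t = su2Vec (w₁ t) (w₂ t) (w₃ t)) ∧
      (∀ t, T.momentum (Φ t) (ω t) = su2Vec (m₁ t) (m₂ t) (m₃ t)) ∧
      T.CoordMotion w₁ w₂ w₃ (fun t ↦ axis₁ (Φ t)) (fun t ↦ axis₂ (Φ t)) (fun t ↦ axis₃ (Φ t))
        m₁ m₂ m₃ := by
  obtain ⟨w₁, w₂, w₃, hω⟩ : ∃ w₁ w₂ w₃ : ℝ → ℝ, ∀ t, ω t = su2Vec (w₁ t) (w₂ t) (w₃ t) :=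
    ⟨_, _, _, fun t ↦ eq_su2Vec_of_mem (h.mem_su2 t)⟩
  obtain ⟨m₁, m₂, m₃, hm⟩ : ∃ m₁ m₂ m₃ : ℝ → ℝ,
      (∀ t, m₁ t = T.A * w₁ t + (T.C - T.A) *
        (w₁ t * axis₁ (Φ t) + w₂ t * axis₂ (Φ t) + w₃ t * axis₃ (Φ t)) * axis₁ (Φ t) +
        T.μ * T.s * (w₁ t * axis₂ (Φ t) - w₂ t * axis₁ (Φ t)) * axis₂ (Φ t)) ∧
      (∀ t, m₂ t = T.A * w₂ t + (T.C - T.A) *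
        (w₁ t * axis₁ (Φ t) + w₂ t * axis₂ (Φ t) + w₃ t * axis₃ (Φ t)) * axis₂ (Φ t) -
        T.μ * T.s * (w₁ t * axis₂ (Φ t) - w₂ t * axis₁ (Φ t)) * axis₁ (Φ t)) ∧
      (∀ t, m₃ t = T.A * w₃ t + (T.C - T.A) *
        (w₁ t * axis₁ (Φ t) + w₂ t * axis₂ (Φ t) + w₃ t * axis₃ (Φ t)) * axis₃ (Φ t)) :=
    ⟨_, _, _, fun t ↦ rfl, fun t ↦ rfl, fun t ↦ rfl⟩
  have hM (t : ℝ) : T.momentum (Φ t) (ω t) = su2Vec (m₁ t) (m₂ t) (m₃ t) := by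
    rw [hω, momentum_eq (h.mem_SU2 t), hm.1, hm.2.1, hm.2.2]
  have hr (t : ℝ) := hasDerivAt_axis (t := t) h.mem_SU2 (by rw [← hω]; exact h.deriv_config t)
  have hd (t : ℝ) (a b c : ℝ) := h.deriv_momentum t (su2Vec a b c) (su2Vec_mem a b c)
  simp only [hM] at hd
  simp only [hω, lie_su2Vec, ip_su2Vec, lagrangianDeriv_eq T (h.mem_SU2 _)] at hd
  refine ⟨w₁, w₂, w₃, m₁, m₂, m₃, hω, hM, fun t ↦ axis_normSq (h.mem_SU2 t), hm.1, hm.2.1, hm.2.2,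
    fun t ↦ (hr t).1, fun t ↦ (hr t).2.1, fun t ↦ (hr t).2.2, fun t ↦ ?_, fun t ↦ ?_, fun t ↦ ?_⟩
  · simpa only [mul_one, mul_zero, add_zero] using (hd t 1 0 0).congr_deriv (by ring)
  · simpa only [mul_one, mul_zero, add_zero, zero_add] using (hd t 0 1 0).congr_deriv (by ring)
  · simpa only [mul_one, mul_zero, add_zero, zero_add] using (hd t 0 0 1).congr_deriv (by ring)

namespace CoordMotion

variable {w₁ w₂ w₃ r₁ r₂ r₃ m₁ m₂ m₃ : ℝ → ℝ} (h : T.CoordMotion w₁ w₂ w₃ r₁ r₂ r₃ m₁ m₂ m₃)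
include h

lemma m₃_const (t : ℝ) : m₃ t = m₃ 0 := by
  refine eq_of_hasDerivAt_zero (fun t ↦ (h.deriv_m₃ t).congr_deriv ?_) t
  rw [h.m₁_eq, h.m₂_eq]; ring

lemma axisMomentum_eq (t : ℝ) : m₁ t * r₁ t + m₂ t * r₂ t + m₃ t * r₃ t =
    T.C * (w₁ t * r₁ t + w₂ t * r₂ t + w₃ t * r₃ t) := by
  rw [h.m₁_eq, h.m₂_eq, h.m₃_eq]
  linear_combination (T.C - T.A) * (w₁ t * r₁ t + w₂ t * r₂ t + w₃ t * r₃ t) * h.normSq t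

lemma axisMomentum_const (t : ℝ) : T.C * (w₁ t * r₁ t + w₂ t * r₂ t + w₃ t * r₃ t) =
    T.C * (w₁ 0 * r₁ 0 + w₂ 0 * r₂ 0 + w₃ 0 * r₃ 0) := by
  rw [← h.axisMomentum_eq, ← h.axisMomentum_eq]
  refine eq_of_hasDerivAt_zero (f := fun t ↦ m₁ t * r₁ t + m₂ t * r₂ t + m₃ t * r₃ t)
    (fun t ↦ ((((h.deriv_m₁ t).mul (h.deriv_r₁ t)).add ((h.deriv_m₂ t).mul (h.deriv_r₂ t))).add
    ((h.deriv_m₃ t).mul (h.deriv_r₃ t))).congr_deriv ?_) t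
  ring

/-- The momentum `⟨m, [r, k]⟩` conjugate to the inclination. -/
lemma inclinationMomentum_eq (t : ℝ) : m₁ t * r₂ t - m₂ t * r₁ t =
    (T.A + T.μ * T.s * (1 - r₃ t ^ 2)) * (w₁ t * r₂ t - w₂ t * r₁ t) := by
  rw [h.m₁_eq, h.m₂_eq]
  linear_combination T.μ * T.s * (w₁ t * r₂ t - w₂ t * r₁ t) * h.normSq t

lemma inclinationMomentum_hasDerivAt (t : ℝ) : HasDerivAt (fun t ↦ m₁ t * r₂ t - m₂ t * r₁ t)
    (T.A * w₃ t * (w₁ t * r₁ t + w₂ t * r₂ t + w₃ t * r₃ t)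
      - r₃ t * T.A * (w₁ t ^ 2 + w₂ t ^ 2 + w₃ t ^ 2)
      - 2 * T.μ * T.s * r₃ t * (w₁ t * r₂ t - w₂ t * r₁ t) ^ 2
      + (T.C - T.A) * (w₁ t * r₁ t + w₂ t * r₂ t + w₃ t * r₃ t)
        * (w₃ t - (w₁ t * r₁ t + w₂ t * r₂ t + w₃ t * r₃ t) * r₃ t)
      - T.μ * (1 - r₃ t ^ 2)) t := by
  refine (((h.deriv_m₁ t).mul (h.deriv_r₂ t)).sub
    ((h.deriv_m₂ t).mul (h.deriv_r₁ t))).congr_deriv ?_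
  rw [h.m₁_eq, h.m₂_eq, h.m₃_eq]
  linear_combination ((T.C - T.A) * (w₁ t * r₁ t + w₂ t * r₂ t + w₃ t * r₃ t) * w₃ t - T.μ)
    * h.normSq t

/-- The left side is the squared triple product of ω, r and k, and the right side is their Gram
determinant. -/
lemma gram (t : ℝ) : (w₁ t * r₂ t - w₂ t * r₁ t) ^ 2 =
    (1 - r₃ t ^ 2) * (w₁ t ^ 2 + w₂ t ^ 2 + w₃ t ^ 2
      - (w₁ t * r₁ t + w₂ t * r₂ t + w₃ t * r₃ t) ^ 2)
      - (w₃ t - (w₁ t * r₁ t + w₂ t * r₂ t + w₃ t * r₃ t) * r₃ t) ^ 2 := by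
  linear_combination (w₁ t ^ 2 + w₂ t ^ 2) * h.normSq t

lemma sq_r₃_le (t : ℝ) : r₃ t ^ 2 ≤ 1 := by
  nlinarith [h.normSq t, sq_nonneg (r₁ t), sq_nonneg (r₂ t)]

/-- The equations of motion supply derivatives of r and m, but not of ω. The energy is therefore
first written in terms of m and r, as in the Hamiltonian formalism, and this expression is
differentiated. The denominator is the inertia belonging to the inclination, which is positive. -/
lemma energy_const (t : ℝ) :
    1 / 2 * T.A * (w₁ t ^ 2 + w₂ t ^ 2 + w₃ t ^ 2)
      + 1 / 2 * (T.C - T.A) * (w₁ t * r₁ t + w₂ t * r₂ t + w₃ t * r₃ t) ^ 2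
      + 1 / 2 * (T.μ * T.s) * (w₁ t * r₂ t - w₂ t * r₁ t) ^ 2 + T.μ * r₃ t =
    1 / 2 * T.A * (w₁ 0 ^ 2 + w₂ 0 ^ 2 + w₃ 0 ^ 2)
      + 1 / 2 * (T.C - T.A) * (w₁ 0 * r₁ 0 + w₂ 0 * r₂ 0 + w₃ 0 * r₃ 0) ^ 2
      + 1 / 2 * (T.μ * T.s) * (w₁ 0 * r₂ 0 - w₂ 0 * r₁ 0) ^ 2 + T.μ * r₃ 0 := by
  have hA := T.A_pos
  have hG (t : ℝ) : 0 < T.A + T.μ * T.s * (1 - r₃ t ^ 2) := by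
    have := mul_pos T.μ_pos T.s_pos
    have := h.sq_r₃_le t
    nlinarith
  set N := w₁ 0 * r₁ 0 + w₂ 0 * r₂ 0 + w₃ 0 * r₃ 0 with hN
  have hW (t : ℝ) : w₁ t * r₁ t + w₂ t * r₂ t + w₃ t * r₃ t = N :=
    mul_left_cancel₀ T.C_pos.ne' (h.axisMomentum_const t)
  have key (t : ℝ) : 1 / 2 * T.A * (w₁ t ^ 2 + w₂ t ^ 2 + w₃ t ^ 2)
      + 1 / 2 * (T.C - T.A) * (w₁ t * r₁ t + w₂ t * r₂ t + w₃ t * r₃ t) ^ 2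
      + 1 / 2 * (T.μ * T.s) * (w₁ t * r₂ t - w₂ t * r₁ t) ^ 2 + T.μ * r₃ t =
    (m₁ t ^ 2 + m₂ t ^ 2 + m₃ t ^ 2 - (T.C - T.A) * T.C * N ^ 2
      - T.μ * T.s * ((m₁ t * r₂ t - m₂ t * r₁ t) ^ 2 / (T.A + T.μ * T.s * (1 - r₃ t ^ 2))))
      / (2 * T.A) + T.μ * r₃ t := by
    have e1 : (m₁ t * r₂ t - m₂ t * r₁ t) ^ 2 / (T.A + T.μ * T.s * (1 - r₃ t ^ 2)) =
        (T.A + T.μ * T.s * (1 - r₃ t ^ 2)) * (w₁ t * r₂ t - w₂ t * r₁ t) ^ 2 := by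
      rw [h.inclinationMomentum_eq, div_eq_iff (hG t).ne']; ring
    rw [e1, ← hW t, h.m₁_eq, h.m₂_eq, h.m₃_eq]
    field_simp
    linear_combination (-(T.C - T.A) ^ 2 * (w₁ t * r₁ t + w₂ t * r₂ t + w₃ t * r₃ t) ^ 2
      - (T.μ * T.s) ^ 2 * (w₁ t * r₂ t - w₂ t * r₁ t) ^ 2) * h.normSq t
  rw [hN, key t, key 0]
  refine eq_of_hasDerivAt_zero (f := fun t ↦
    (m₁ t ^ 2 + m₂ t ^ 2 + m₃ t ^ 2 - (T.C - T.A) * T.C * N ^ 2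
      - T.μ * T.s * ((m₁ t * r₂ t - m₂ t * r₁ t) ^ 2 / (T.A + T.μ * T.s * (1 - r₃ t ^ 2))))
      / (2 * T.A) + T.μ * r₃ t) (fun t ↦ ?_) t
  have hq := ((h.deriv_m₁ t).mul (h.deriv_r₂ t)).sub ((h.deriv_m₂ t).mul (h.deriv_r₁ t))
  refine (((((((h.deriv_m₁ t).pow 2).add ((h.deriv_m₂ t).pow 2)).add
    ((h.deriv_m₃ t).pow 2)).sub_const ((T.C - T.A) * T.C * N ^ 2)).sub
    (((hq.pow 2).div ((((h.deriv_r₃ t).pow 2).const_sub 1 |>.const_mul (T.μ * T.s)).const_add T.A)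
      (hG t).ne').const_mul (T.μ * T.s)) |>.div_const (2 * T.A)).add
    ((h.deriv_r₃ t).const_mul T.μ)).congr_deriv ?_
  simp only [Pi.mul_apply, Pi.sub_apply, Pi.pow_apply, h.inclinationMomentum_eq t, Nat.cast_ofNat,
    Nat.add_one_sub_one, pow_one]
  have hG' := (hG t).ne'
  set G := T.A + T.μ * T.s * (1 - r₃ t ^ 2)
  rw [show ∀ z q' d : ℝ, (2 * (G * z) * q' * G - (G * z) ^ 2 * d) / G ^ 2 = 2 * z * q' - z ^ 2 * d
    from fun z q' d ↦ by field_simp]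
  rw [h.m₁_eq, h.m₂_eq, h.m₃_eq]
  field_simp
  ring

end CoordMotion
end ToyTop

namespace ToyTop

/-! ### Reduction in the aperiodic case -/

section SU2
lemma axis₁_add_axis₂ (Φ : Mat) : (axis₁ Φ + I * axis₂ Φ : ℂ) = -2 * (Φ 0 0 * Φ 0 1) := by
  apply Complex.ext <;> simp [axis₁, axis₂]

variable {Φ : Mat} (h : Φ ∈ Matrix.specialUnitaryGroup (Fin 2) ℂ)
include h

lemma one_add_axis₃ : (1 + axis₃ Φ : ℂ) = 2 * (Φ 0 0 * Φ 1 1) := by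
  obtain ⟨h1, h2⟩ := entries_of_mem h
  have := normSq_entries_of_mem h
  rw [h2, Complex.mul_conj, normSq_apply]
  norm_cast
  rw [axis₃]
  linear_combination -this

lemma one_sub_axis₃ : (1 - axis₃ Φ : ℂ) = -2 * (Φ 0 1 * Φ 1 0) := by
  obtain ⟨h1, h2⟩ := entries_of_mem h
  have := normSq_entries_of_mem h
  rw [h1, mul_neg, Complex.mul_conj, normSq_apply, neg_mul_neg]
  norm_cast
  rw [axis₃]
  linear_combination -this

lemma axis₁_sub_axis₂ : (axis₁ Φ - I * axis₂ Φ : ℂ) = 2 * (Φ 1 0 * Φ 1 1) := by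
  obtain ⟨h1, h2⟩ := entries_of_mem h
  rw [h1, h2]
  apply Complex.ext <;> simp [axis₁, axis₂] <;> ring

/-- The angular velocity in terms of the Cayley-Klein parameters. -/
lemma su2Vec_mul_entries (a b c : ℝ) :
    (1 + axis₃ Φ) * (su2Vec a b c * Φ) 0 0 = Φ 0 0 * (((a * axis₂ Φ - b * axis₁ Φ : ℝ) : ℂ) / 2
      + I / 2 * (c + (a * axis₁ Φ + b * axis₂ Φ + c * axis₃ Φ : ℝ))) ∧
    (1 - axis₃ Φ) * (su2Vec a b c * Φ) 0 1 = Φ 0 1 * (-((a * axis₂ Φ - b * axis₁ Φ : ℝ) : ℂ) / 2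
      - I / 2 * ((a * axis₁ Φ + b * axis₂ Φ + c * axis₃ Φ : ℝ) - c)) ∧
    (1 - axis₃ Φ) * (su2Vec a b c * Φ) 1 0 = Φ 1 0 * (-((a * axis₂ Φ - b * axis₁ Φ : ℝ) : ℂ) / 2
      + I / 2 * ((a * axis₁ Φ + b * axis₂ Φ + c * axis₃ Φ : ℝ) - c)) ∧
    (1 + axis₃ Φ) * (su2Vec a b c * Φ) 1 1 = Φ 1 1 * (((a * axis₂ Φ - b * axis₁ Φ : ℝ) : ℂ) / 2
      - I / 2 * (c + (a * axis₁ Φ + b * axis₂ Φ + c * axis₃ Φ : ℝ))) := by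
  have e1 := one_add_axis₃ h
  have e2 := one_sub_axis₃ h
  have e3 := axis₁_add_axis₂ Φ
  have e4 := axis₁_sub_axis₂ h
  simp only [Matrix.mul_apply, Fin.sum_univ_two, su2Vec, Matrix.of_apply, Matrix.cons_val',
    Matrix.cons_val_zero, Matrix.cons_val_one, Matrix.cons_val_fin_one]
  push_cast
  have hI := I_sq
  refine ⟨?_, ?_, ?_, ?_⟩
  · linear_combination (I * a - b) / 2 * (Φ 1 0 * e1 - Φ 0 0 * e4)
      - Φ 0 0 * a * axis₂ Φ / 2 * hI
  · linear_combination (I * a - b) / 2 * (Φ 1 1 * e2 + Φ 0 1 * e4)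
      + Φ 0 1 * a * axis₂ Φ / 2 * hI
  · linear_combination (I * a + b) / 2 * (Φ 0 0 * e2 - Φ 1 0 * e3)
      + Φ 1 0 * a * axis₂ Φ / 2 * hI
  · linear_combination (I * a + b) / 2 * (Φ 0 1 * e1 + Φ 1 1 * e3)
      - Φ 1 1 * a * axis₂ Φ / 2 * hI

end SU2

variable (T : ToyTop)

lemma e₄_sq : T.e₄ ^ 2 = 1 + T.A / (T.μ * T.s) := by
  have := T.A_pos; have := T.μ_pos; have := T.s_pos
  rw [e₄, Real.sq_sqrt (by positivity)]

lemma A_eq : T.A = T.μ * T.s * (T.e₄ ^ 2 - 1) := by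
  have := T.μ_pos; have := T.s_pos
  rw [e₄_sq]; field_simp; ring

/-- The reduced equations of motion in the aperiodic case. Here `z` is the derivative of `u`,
and `n` is the value of both first integrals. -/
structure AperiodicMotion (Φ : ℝ → Mat) (e₁ n : ℝ) (z : ℝ → ℝ) : Prop where
  mem_SU2 : ∀ t, Φ t ∈ Matrix.specialUnitaryGroup (Fin 2) ℂ
  sq_n : n ^ 2 = 2 * T.A * T.μ * (1 + e₁)
  le_height : ∀ t, e₁ ≤ height (Φ t)
  height_lt : ∀ t, height (Φ t) < 1
  deriv_height : ∀ t, HasDerivAt (fun t ↦ height (Φ t)) (z t) t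
  sq_deriv : ∀ t, T.s / 2 * (T.e₄ ^ 2 - height (Φ t) ^ 2) * z t ^ 2 =
    (height (Φ t) - e₁) * (1 - height (Φ t)) ^ 2
  deriv₂ : ∀ t, HasDerivAt
    (fun t ↦ √(2 * T.s) * (T.e₄ ^ 2 - height (Φ t) ^ 2) * z t / (1 - height (Φ t)))
    ((1 - height (Φ t)) / (√(2 * T.s) * (T.e₄ ^ 2 - height (Φ t) ^ 2)) *
      (2 * (T.e₄ ^ 2 - height (Φ t) ^ 2) - 4 * height (Φ t) * (height (Φ t) - e₁))) t
  deriv_α : ∀ t, HasDerivAt (fun t ↦ Φ t 0 0) (Φ t 0 0 *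
    ((z t / (2 * (1 + height (Φ t))) : ℝ) +
      I * ((1 / T.C - 1 / T.A) * n / 2 + n / (T.A * (1 + height (Φ t))) : ℝ))) t
  deriv_β : ∀ t, HasDerivAt (fun t ↦ Φ t 0 1) (Φ t 0 1 *
    (-(z t / (2 * (1 - height (Φ t))) : ℝ) - I * ((1 / T.C - 1 / T.A) * n / 2 : ℝ))) t
  deriv_γ : ∀ t, HasDerivAt (fun t ↦ Φ t 1 0) (Φ t 1 0 *
    (-(z t / (2 * (1 - height (Φ t))) : ℝ) + I * ((1 / T.C - 1 / T.A) * n / 2 : ℝ))) t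
  deriv_δ : ∀ t, HasDerivAt (fun t ↦ Φ t 1 1) (Φ t 1 1 *
    ((z t / (2 * (1 + height (Φ t))) : ℝ) -
      I * ((1 / T.C - 1 / T.A) * n / 2 + n / (T.A * (1 + height (Φ t))) : ℝ))) t

/-- Gronwall's argument in both time directions: f exp(Kt) is increasing and f exp(-Kt) is
decreasing. -/
lemma pos_of_abs_deriv_le {f f' : ℝ → ℝ} {K : ℝ} (hf : ∀ t, HasDerivAt f (f' t) t)
    (hK : ∀ t, |f' t| ≤ K * f t) (h0 : 0 < f 0) (t : ℝ) : 0 < f t := by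
  have hexp (k t : ℝ) : HasDerivAt (fun t ↦ f t * Real.exp (k * t))
      ((f' t + k * f t) * Real.exp (k * t)) t := by
    refine ((hf t).mul (((hasDerivAt_id t).const_mul k).exp)).congr_deriv ?_
    simp; ring
  have hpos {k : ℝ} (h : 0 < f t * Real.exp (k * t)) : 0 < f t :=
    pos_of_mul_pos_left h (Real.exp_pos _).le
  rcases le_total 0 t with ht | ht
  · have hm : Monotone fun t ↦ f t * Real.exp (K * t) :=
      monotone_of_hasDerivAt_nonneg (fun t ↦ hexp K t) fun t ↦
        mul_nonneg (by linarith [neg_abs_le (f' t), hK t]) (Real.exp_pos _).le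
    have := hm ht
    simp only [mul_zero, Real.exp_zero, mul_one] at this
    exact hpos (h0.trans_le this)
  · have hm : Antitone fun t ↦ f t * Real.exp (-K * t) :=
      antitone_of_hasDerivAt_nonpos (fun t ↦ hexp (-K) t) fun t ↦
        mul_nonpos_of_nonpos_of_nonneg (by linarith [le_abs_self (f' t), hK t]) (Real.exp_pos _).le
    have := hm ht
    simp only [mul_zero, Real.exp_zero, mul_one] at this
    exact hpos (h0.trans_le this)

/-- The Gram identity expresses |ω|² through u, u' and the first integrals. Inserted into the
energy, it gives the reduced equation. Since n belongs to both k and r, the components of ω along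
these vectors are functions of u alone, which yields the logarithmic derivatives of the entries of
Φ. -/
lemma IsMotion.aperiodicMotion {T : ToyTop} {Φ ω : ℝ → Mat} (h : T.IsMotion Φ ω) {e₁ : ℝ}
    (he₁ : -1 < e₁) (he₁' : e₁ < 1) (hdyn : T.HasDynamicalConstants (Φ 0) (ω 0) e₁ 1 1)
    (hu₀ : height (Φ 0) = e₁) :
    T.vertMomentum (Φ 0) (ω 0) = T.axisMomentum (Φ 0) (ω 0) ∧
      ∃ z, T.AperiodicMotion Φ e₁ (T.axisMomentum (Φ 0) (ω 0)) z := by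
  obtain ⟨w₁, w₂, w₃, m₁, m₂, m₃, hω, hm, hc⟩ := h.exists_coordMotion
  obtain ⟨-, -, -, -, hpoly⟩ := hdyn
  have hμ := T.μ_pos
  have hA := T.A_pos
  have hC := T.C_pos
  have hs := T.s_pos
  have hu (t : ℝ) : axis₃ (Φ t) = height (Φ t) := (height_eq (h.mem_SU2 t)).symm
  set n := T.axisMomentum (Φ 0) (ω 0) with hn
  have hn0 : n = m₁ 0 * axis₁ (Φ 0) + m₂ 0 * axis₂ (Φ 0) + m₃ 0 * axis₃ (Φ 0) := by
    rw [hn, axisMomentum, hm, axis_eq (h.mem_SU2 0), ip_su2Vec]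
  have hl0 : T.vertMomentum (Φ 0) (ω 0) = m₃ 0 := by
    rw [vertMomentum, hm, vert_eq, ip_su2Vec]; ring
  have hnW (t : ℝ) : n = T.C * (w₁ t * axis₁ (Φ t) + w₂ t * axis₂ (Φ t) + w₃ t * axis₃ (Φ t)) := by
    rw [hn0, hc.axisMomentum_eq, ← hc.axisMomentum_const t]
  have henergy (t : ℝ) : T.energy (Φ 0) (ω 0) =
      1 / 2 * T.A * (w₁ t ^ 2 + w₂ t ^ 2 + w₃ t ^ 2)
      + 1 / 2 * (T.C - T.A) * (w₁ t * axis₁ (Φ t) + w₂ t * axis₂ (Φ t) + w₃ t * axis₃ (Φ t)) ^ 2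
      + 1 / 2 * (T.μ * T.s) * (w₁ t * axis₂ (Φ t) - w₂ t * axis₁ (Φ t)) ^ 2
      + T.μ * axis₃ (Φ t) := by
    rw [hc.energy_const t, energy, hω, kinetic_eq (h.mem_SU2 0), potential_eq (h.mem_SU2 0)]
  -- At v = 1 only the term with (λ - n)² survives, and the right side vanishes.
  have hln : T.vertMomentum (Φ 0) (ω 0) = n := by
    have h1 := hpoly 1
    rw [one_pow, sub_self, mul_zero, zero_mul, zero_sub, mul_zero, neg_eq_zero, mul_eq_zero,
      pow_eq_zero_iff two_ne_zero, mul_one, sub_eq_zero] at h1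
    exact h1.resolve_left (by positivity)
  have hnsq : n ^ 2 = 2 * T.A * T.μ * (1 + e₁) := by
    have h1 := hpoly (-1)
    have h2 : 1 / (2 * T.A * T.μ) * (2 * n) ^ 2 = 4 * (1 + e₁) := by
      rw [hln] at h1; linear_combination -h1
    field_simp at h2
    linarith
  have hlam (t : ℝ) : n = T.A * w₃ t + (T.C - T.A) *
      (w₁ t * axis₁ (Φ t) + w₂ t * axis₂ (Φ t) + w₃ t * axis₃ (Φ t)) * axis₃ (Φ t) := by
    rw [← hln, hl0, ← hc.m₃_const t, hc.m₃_eq]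
  have he₄ := T.one_lt_e₄
  have hsq (t : ℝ) : height (Φ t) ^ 2 ≤ 1 := hu t ▸ hc.sq_r₃_le t
  have hD (t : ℝ) : 0 < T.e₄ ^ 2 - height (Φ t) ^ 2 := by nlinarith [hsq t]
  set z : ℝ → ℝ := fun t ↦ w₁ t * axis₂ (Φ t) - w₂ t * axis₁ (Φ t) with hz
  have hred (t : ℝ) : T.s / 2 * (T.e₄ ^ 2 - height (Φ t) ^ 2) * z t ^ 2 =
      (height (Φ t) - e₁) * (1 - height (Φ t)) ^ 2 := by
    have h1 := hpoly (height (Φ t))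
    have h2 := hc.gram t
    have h3 := hlam t
    have h4 := hnW t
    rw [henergy t, hln] at h1
    rw [show (height (Φ t) - e₁) * (1 - height (Φ t)) ^ 2 =
      (height (Φ t) - e₁) * (height (Φ t) - 1) * (height (Φ t) - 1) by ring, ← h1]
    simp only [hu] at h2 h3 h4 ⊢
    rw [e₄_sq]
    change (z t) ^ 2 = _ at h2
    change _ = 1 / T.μ * (1 - height (Φ t) ^ 2) * (_ + 1 / 2 * (T.μ * T.s) * z t ^ 2 + _ - _ - _) -
      1 / (2 * T.A * T.μ) * (n - n * height (Φ t)) ^ 2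
    set W := w₁ t * axis₁ (Φ t) + w₂ t * axis₂ (Φ t) + w₃ t * height (Φ t)
    have h5 : n - n * height (Φ t) = T.A * (w₃ t - W * height (Φ t)) := by
      linear_combination h3 - height (Φ t) * h4
    rw [h5, h4]
    field_simp
    linear_combination T.A * h2
  -- The reduced equation bounds |u'| by a multiple of 1 - u, using A ≤ μs(e₄² - u²) and u - e₁ ≤ 2.
  -- Hence u cannot reach 1 in finite time.
  have hz2 (t : ℝ) : |-z t| ≤ √(4 * T.μ / T.A) * (1 - height (Φ t)) := by
    have h1 : 0 ≤ 1 - height (Φ t) := by nlinarith [hsq t]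
    have h2 : z t ^ 2 ≤ 4 * T.μ / T.A * (1 - height (Φ t)) ^ 2 := by
      rw [div_mul_eq_mul_div, le_div_iff₀ hA]
      have h3 := hred t
      have h4 : T.A ≤ T.μ * T.s * (T.e₄ ^ 2 - height (Φ t) ^ 2) := by
        rw [T.A_eq]
        have := mul_pos hμ hs
        nlinarith [hsq t]
      have h5 : height (Φ t) - e₁ ≤ 2 := by nlinarith [hsq t]
      calc z t ^ 2 * T.A ≤ z t ^ 2 * (T.μ * T.s * (T.e₄ ^ 2 - height (Φ t) ^ 2)) := by gcongr
        _ = 2 * T.μ * ((height (Φ t) - e₁) * (1 - height (Φ t)) ^ 2) := by rw [← h3]; ring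
        _ ≤ 2 * T.μ * (2 * (1 - height (Φ t)) ^ 2) := by gcongr
        _ = _ := by ring
    rw [abs_neg]
    refine abs_le_of_sq_le_sq ?_ (by positivity)
    rwa [mul_pow, Real.sq_sqrt (by positivity)]
  have hdu (t : ℝ) : HasDerivAt (fun t ↦ height (Φ t)) (z t) t := by
    simpa only [hu] using hc.deriv_r₃ t
  have hlt (t : ℝ) : height (Φ t) < 1 := sub_pos.1 <|
    pos_of_abs_deriv_le (f := fun t ↦ 1 - height (Φ t)) (fun t ↦ (hdu t).const_sub 1) hz2
      (by simpa [hu₀] using he₁') t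
  have hle (t : ℝ) : e₁ ≤ height (Φ t) := by
    have h1 : 0 ≤ (height (Φ t) - e₁) * (1 - height (Φ t)) ^ 2 := by
      rw [← hred t]
      have := hD t
      positivity
    exact sub_nonneg.1 (nonneg_of_mul_nonneg_left h1 (pow_pos (sub_pos.2 (hlt t)) 2))
  have hp (t : ℝ) : 1 + height (Φ t) ≠ 0 := by linarith [hle t]
  have hm' (t : ℝ) : 1 - height (Φ t) ≠ 0 := (sub_pos.2 (hlt t)).ne'
  have hij (t : ℝ) (i j : Fin 2) : HasDerivAt (fun t ↦ Φ t i j) ((ω t * Φ t) i j) t :=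
    hasDerivAt_pi.1 (hasDerivAt_pi.1 (h.deriv_config t) i) j
  -- The relations n = C W and n = A w₃ + (C - A) W u are solved for w₃ and W = ⟨ω, r⟩. The spin τ/2
  -- splits off, and for the difference W - w₃ nothing else remains.
  have hplus (t : ℝ) : w₃ t + (w₁ t * axis₁ (Φ t) + w₂ t * axis₂ (Φ t) + w₃ t * height (Φ t)) =
      2 * (1 + height (Φ t)) *
        ((1 / T.C - 1 / T.A) * n / 2 + n / (T.A * (1 + height (Φ t)))) := by
    have h3 := hlam t
    have h4 := hnW t
    have h5 := hp t
    rw [hu] at h3 h4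
    set W := w₁ t * axis₁ (Φ t) + w₂ t * axis₂ (Φ t) + w₃ t * height (Φ t)
    have e3 : w₃ t = (T.C * W - (T.C - T.A) * W * height (Φ t)) / T.A := by
      field_simp; linarith
    rw [e3, h4]
    field_simp
    ring
  have hminus (t : ℝ) : (w₁ t * axis₁ (Φ t) + w₂ t * axis₂ (Φ t) + w₃ t * height (Φ t)) - w₃ t =
      2 * (1 - height (Φ t)) * ((1 / T.C - 1 / T.A) * n / 2) := by
    have h3 := hlam t
    have h4 := hnW t
    rw [hu] at h3 h4
    set W := w₁ t * axis₁ (Φ t) + w₂ t * axis₂ (Φ t) + w₃ t * height (Φ t)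
    have e3 : w₃ t = (T.C * W - (T.C - T.A) * W * height (Φ t)) / T.A := by
      field_simp; linarith
    rw [e3, h4]
    field_simp
    ring
  have hpC (t : ℝ) : (1 + height (Φ t) : ℂ) ≠ 0 := by exact_mod_cast hp t
  have hmC (t : ℝ) : (1 - height (Φ t) : ℂ) ≠ 0 := by exact_mod_cast hm' t
  have hent (t : ℝ) := su2Vec_mul_entries (h.mem_SU2 t) (w₁ t) (w₂ t) (w₃ t)
  simp only [hu, ← hω, ← ofReal_add, ← ofReal_sub, hplus, hminus] at hent
  have hzt (t : ℝ) : w₁ t * axis₂ (Φ t) - w₂ t * axis₁ (Φ t) = z t := rfl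
  simp only [hzt] at hent
  refine ⟨hln, z, h.mem_SU2, hnsq, hle, hlt, hdu, hred, fun t ↦ ?_,
    fun t ↦ (hij t 0 0).congr_deriv ?_, fun t ↦ (hij t 0 1).congr_deriv ?_,
    fun t ↦ (hij t 1 0).congr_deriv ?_, fun t ↦ (hij t 1 1).congr_deriv ?_⟩
  -- With x = -iy, the function to be differentiated is du/dy. Differentiating the reduced equation
  -- would require division by u', which vanishes at t = 0, so the equation for the momentum of the
  -- inclination is used instead.
  · have hq := hc.inclinationMomentum_hasDerivAt t
    have hqe (t : ℝ) : m₁ t * axis₂ (Φ t) - m₂ t * axis₁ (Φ t) =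
        T.μ * T.s * (T.e₄ ^ 2 - height (Φ t) ^ 2) * z t := by
      rw [hc.inclinationMomentum_eq, hu, hzt, T.A_eq]
      ring
    simp only [hqe, hu, hzt] at hq
    have hr : 0 < √(2 * T.s) := by positivity
    have hr2 : √(2 * T.s) ^ 2 = 2 * T.s := Real.sq_sqrt (by positivity)
    have h1 := ((hq.const_mul (√(2 * T.s) / (T.μ * T.s))).div ((hdu t).const_sub 1) (hm' t))
    refine (h1.congr_of_eventuallyEq (.of_forall fun t ↦ ?_)).congr_deriv ?_
    · simp only [Pi.div_apply]
      field_simp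
    have h2 := hc.gram t
    have h3 := hlam t
    have h4 := hnW t
    have h5 := hred t
    have h6 := hp t
    have h7 := hm' t
    have h8 := (hD t).ne'
    simp only [hu, hzt] at h2 h3 h4
    set W := w₁ t * axis₁ (Φ t) + w₂ t * axis₂ (Φ t) + w₃ t * height (Φ t)
    set u := height (Φ t)
    set Q := T.A * w₃ t * W - u * T.A * (w₁ t ^ 2 + w₂ t ^ 2 + w₃ t ^ 2) -
      2 * T.μ * T.s * u * z t ^ 2 + (T.C - T.A) * W * (w₃ t - W * u) - T.μ * (1 - u ^ 2) with hQ
    have e1 : T.A * (w₃ t - W * u) = n * (1 - u) := by linear_combination u * h4 - h3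
    -- The factor 1 - u² makes the Gram identity applicable, which eliminates |ω|². The factor is
    -- nonzero and is cancelled in two steps below.
    have hQ1 : (1 - u ^ 2) * Q = -(u * z t ^ 2 * (T.A + 2 * T.μ * T.s * (1 - u ^ 2)))
        - (1 - u ^ 2) ^ 2 * T.μ + 2 * T.μ * (1 + e₁) * (1 - u) ^ 2 := by
      have e2 : T.A * (w₃ t - W * u) ^ 2 = 2 * T.μ * (1 + e₁) * (1 - u) ^ 2 := by
        refine mul_left_cancel₀ hA.ne' ?_
        linear_combination (T.A * (w₃ t - W * u) + n * (1 - u)) * e1 + (1 - u) ^ 2 * hnsq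
      have e3 : T.C * W * (w₃ t - W * u) = 2 * T.μ * (1 + e₁) * (1 - u) := by
        refine mul_left_cancel₀ hA.ne' ?_
        linear_combination n * e1 - T.A * (w₃ t - W * u) * h4 + (1 - u) * hnsq
      rw [hQ]
      linear_combination u * T.A * h2 + (1 - u ^ 2) * e3 - u * e2
    have hQ2 : (1 + u) * Q * (T.e₄ ^ 2 - u ^ 2) = T.μ * (1 - u) *
        (-2 * u * (u - e₁) * (T.e₄ ^ 2 - u ^ 2 + 1 - u ^ 2) - (1 + u) ^ 2 * (T.e₄ ^ 2 - u ^ 2)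
          + 2 * (1 + e₁) * (T.e₄ ^ 2 - u ^ 2)) := by
      refine mul_left_cancel₀ h7 ?_
      rw [T.A_eq] at hQ1
      linear_combination (T.e₄ ^ 2 - u ^ 2) * hQ1
        - 2 * u * T.μ * (T.e₄ ^ 2 - u ^ 2 + 1 - u ^ 2) * h5
    rw [div_mul_eq_mul_div (1 - u) (√(2 * T.s) * (T.e₄ ^ 2 - u ^ 2)),
      div_eq_div_iff (pow_ne_zero _ h7) (mul_ne_zero hr.ne' h8)]
    calc _ = √(2 * T.s) ^ 2 / (T.μ * T.s) * (Q * (1 - u)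
          + T.μ * T.s * (T.e₄ ^ 2 - u ^ 2) * z t ^ 2) * (T.e₄ ^ 2 - u ^ 2) := by ring
      _ = 2 / T.μ * (Q * (1 - u)
          + T.μ * T.s * (T.e₄ ^ 2 - u ^ 2) * z t ^ 2) * (T.e₄ ^ 2 - u ^ 2) := by
        rw [hr2]; field_simp
      _ = _ := by
        refine mul_left_cancel₀ (mul_ne_zero hμ.ne' h6) ?_
        rw [show T.μ * (1 + u) * (2 / T.μ * (Q * (1 - u) + T.μ * T.s * (T.e₄ ^ 2 - u ^ 2) * z t ^ 2)
          * (T.e₄ ^ 2 - u ^ 2)) = (1 + u) * (2 * (Q * (1 - u) + T.μ * T.s * (T.e₄ ^ 2 - u ^ 2)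
          * z t ^ 2) * (T.e₄ ^ 2 - u ^ 2)) by field_simp]
        linear_combination 2 * (1 - u) * hQ2 + 4 * T.μ * (1 + u) * (T.e₄ ^ 2 - u ^ 2) * h5
  · refine mul_left_cancel₀ (hpC t) ?_
    rw [(hent t).1]
    have := hpC t
    push_cast
    field_simp
  · refine mul_left_cancel₀ (hmC t) ?_
    rw [(hent t).2.1]
    have := hmC t
    push_cast
    field_simp
  · refine mul_left_cancel₀ (hmC t) ?_
    rw [(hent t).2.2.1]
    have := hmC t
    push_cast
    field_simp
  · refine mul_left_cancel₀ (hpC t) ?_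
    rw [(hent t).2.2.2]
    have := hpC t
    push_cast
    field_simp

end ToyTop

/-! ### The uniformization of the elliptic curve `w² = 4 (u - e₁) (u² - e₄²)` -/

namespace PeriodPair

/-- The lattice `L` uniformizes the curve `w² = 4 (u - e₁) (u² - e₄²)`
by `u = ℘ + e₁ / 3` and `w = ℘'`. -/
structure IsUniformization (L : PeriodPair) (e₁ e₄ η η' : ℝ) : Prop extends
    L.IsRectangular η η' where
  half₃ : ℘[L] (-(I * η') + η) + e₁ / 3 = e₁
  half₂ : ℘[L] η + e₁ / 3 = e₄
  sq : ∀ z ∉ L.lattice, ℘'[L] z ^ 2 =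
    4 * (℘[L] z + e₁ / 3 - e₁) * ((℘[L] z + e₁ / 3) ^ 2 - e₄ ^ 2)

end PeriodPair

namespace ToyTop

variable (T : ToyTop)

/-- Shifting by e₁/3 turns the roots -e₄, e₁, e₄ into numbers with sum zero. The half periods are by
definition the integrals that determine such roots. -/
lemma exists_isUniformization {e₁ : ℝ} (h : -1 < e₁) (h' : e₁ < 1) :
    ∃ η η' : ℝ, (T.periodPair h h').IsUniformization e₁ T.e₄ η η' ∧
      T.halfPeriod₃ e₁ = -(I * η') + η := by
  have h4 := T.one_lt_e₄
  have p1 : 0 < ∫ u in e₁..T.e₄, 1 / √(-T.aperPoly e₁ u) :=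
    integral_one_div_sqrt_pos (c := 4 * (e₁ + T.e₄)) (g := fun u ↦ 4 * (u + T.e₄)) (by linarith)
      (by linarith) (by fun_prop) (fun x hx ↦ by linarith [hx.1])
      (fun x ↦ by simp only [aperPoly]; ring)
  have p2 : 0 < ∫ u in (-T.e₄)..e₁, 1 / √(T.aperPoly e₁ u) :=
    integral_one_div_sqrt_pos (c := 4 * (T.e₄ - e₁)) (g := fun u ↦ 4 * (T.e₄ - u)) (by linarith)
      (by linarith) (by fun_prop) (fun x hx ↦ by linarith [hx.2])
      (fun x ↦ by simp only [aperPoly]; ring)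
  have hR : (T.periodPair h h').IsRectangular (∫ u in (-T.e₄)..e₁, 1 / √(T.aperPoly e₁ u))
      (∫ u in e₁..T.e₄, 1 / √(-T.aperPoly e₁ u)) :=
    ⟨p2, p1, by simp only [periodPair, halfPeriod₁]; ring, rfl⟩
  obtain ⟨v1, v3, v2⟩ := hR.half_period_values_eq (E₁ := -T.e₄ - e₁ / 3) (E₃ := 2 * e₁ / 3)
    (E₂ := T.e₄ - e₁ / 3) (by linarith) (by linarith) (by ring)
    (by
      rw [show 2 * e₁ / 3 = e₁ - e₁ / 3 by ring, ← intervalIntegral.integral_comp_sub_right]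
      refine intervalIntegral.integral_congr fun u _ ↦ ?_
      simp only [aperPoly]
      ring_nf)
    (by
      rw [show 2 * e₁ / 3 = e₁ - e₁ / 3 by ring, ← intervalIntegral.integral_comp_sub_right]
      refine intervalIntegral.integral_congr fun u _ ↦ ?_
      simp only [aperPoly]
      ring_nf)
  refine ⟨_, _, { toIsRectangular := hR, half₃ := ?_, half₂ := ?_, sq := fun z hz ↦ ?_ }, ?_⟩
  · rw [v3]; push_cast; ring
  · rw [v2]; push_cast; ring
  · rw [hR.weierstrassP_half_sum.2 z hz, v1, v2, v3]; push_cast; ring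
  · simp only [halfPeriod₃, halfPeriod₁, halfPeriod₂]; ring

end ToyTop

namespace PeriodPair
namespace IsUniformization

variable {L : PeriodPair} {e₁ e₄ η η' : ℝ} (h : L.IsUniformization e₁ e₄ η η')
include h

/-- Differentiate the equation of the curve and cancel 2℘'. This is possible off the countable set
where 2z is a period, and continuity gives the remaining points. -/
lemma hasDerivAt_derivWeierstrassP {z : ℂ} (hz : z ∉ L.lattice) : HasDerivAt ℘'[L]
    (2 * ((℘[L] z + e₁ / 3) ^ 2 - e₄ ^ 2) + 4 * (℘[L] z + e₁ / 3) * (℘[L] z + e₁ / 3 - e₁)) z := by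
  have hd {z : ℂ} (hz : z ∉ L.lattice) : HasDerivAt ℘'[L] (deriv ℘'[L] z) z :=
    (L.analyticOnNhd_derivWeierstrassP z hz).differentiableAt.hasDerivAt
  refine (hd hz).congr_deriv ?_
  set N := {z : ℂ | 2 * z ∈ L.lattice} with hN
  have hNc : N.Countable := by
    have : N = (2 * ·) ⁻¹' (L.lattice : Set ℂ) := rfl
    rw [this]
    exact L.countable_lattice.preimage (mul_right_injective₀ two_ne_zero)
  have hdense : Dense Nᶜ := hNc.dense_compl ℝ
  have hsub : (L.lattice : Set ℂ) ⊆ N := fun l hl ↦ by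
    simp only [hN, mem_ofPred_eq, two_mul]; exact add_mem hl hl
  have hne {z : ℂ} (hz : z ∉ N) : ℘'[L] z ≠ 0 := by
    have key {w : ℂ} (hw2 : 2 * w ∈ L.lattice) : z + w ∉ L.lattice := fun hm ↦ hz <| by
      have := sub_mem (add_mem hm hm) hw2
      rwa [show z + w + (z + w) - 2 * w = 2 * z by ring] at this
    exact h.derivWeierstrassP_ne_zero (fun hm ↦ hz (hsub hm)) (key h.two_mul_half₁_mem)
      (key h.two_mul_half₂_mem) (key h.two_mul_half₃_mem)
  have hev {z : ℂ} (hz : z ∉ L.lattice) : ∀ᶠ x in 𝓝 z, x ∉ L.lattice :=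
    L.isClosed_lattice.isOpen_compl.mem_nhds hz
  have heq (z : ℂ) (hz : z ∈ Nᶜ) : deriv ℘'[L] z = 2 * ((℘[L] z + e₁ / 3) ^ 2 - e₄ ^ 2) +
      4 * (℘[L] z + e₁ / 3) * (℘[L] z + e₁ / 3 - e₁) := by
    have hzL : z ∉ L.lattice := fun hm ↦ hz (hsub hm)
    have h1 := (hd hzL).pow 2
    have h2 := (((((L.hasDerivAt_weierstrassP hzL).add_const (e₁ / 3 : ℂ)).sub_const
      (e₁ : ℂ)).const_mul 4).mul ((((L.hasDerivAt_weierstrassP hzL).add_const (e₁ / 3 : ℂ)).pow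
        2).sub_const ((e₄ : ℂ) ^ 2))).congr_of_eventuallyEq
      (f₁ := fun z ↦ ℘'[L] z ^ 2) ((hev hzL).mono fun x hx ↦ by simpa using h.sq x hx)
    have h3 := h1.unique h2
    refine mul_left_cancel₀ (hne hz) ?_
    simp only [Nat.cast_ofNat, Nat.add_one_sub_one, pow_one, Pi.pow_apply] at h3
    linear_combination h3 / 2
  have hcP {z : ℂ} (hz : z ∉ L.lattice) : ContinuousAt ℘[L] z :=
    (L.hasDerivAt_weierstrassP hz).continuousAt
  have hcD : ContinuousAt (deriv ℘'[L]) z :=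
    (L.analyticOnNhd_derivWeierstrassP.deriv z hz).continuousAt
  have hc2 : ContinuousAt (fun z ↦ 2 * ((℘[L] z + e₁ / 3) ^ 2 - e₄ ^ 2) +
      4 * (℘[L] z + e₁ / 3) * (℘[L] z + e₁ / 3 - e₁)) z := by
    have := hcP hz
    fun_prop
  have : (𝓝[Nᶜ] z).NeBot := mem_closure_iff_nhdsWithin_neBot.1 (hdense z)
  exact tendsto_nhds_unique_of_eventuallyEq (hcD.tendsto.mono_left nhdsWithin_le_nhds)
    (hc2.tendsto.mono_left nhdsWithin_le_nhds) (eventually_nhdsWithin_of_forall heq)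

/-- The real form of the curve along the imaginary axis through the origin. -/
lemma exists_vertical : ∃ V G : ℝ → ℝ,
    (∀ y : ℝ, ℘[L] (-I * (y : ℂ) - (-(I * η') + η)) + e₁ / 3 = V y) ∧
    (∀ y : ℝ, ℘'[L] (-I * (y : ℂ) - (-(I * η') + η)) = I * G y) ∧
    (∀ y, HasDerivAt V (G y) y) ∧
    (∀ y, HasDerivAt G (2 * (e₄ ^ 2 - V y ^ 2) - 4 * V y * (V y - e₁)) y) ∧
    V 0 = e₁ ∧ G 0 = 0 ∧ V η' = e₄ ∧ (∀ y, V (-y) = V y) ∧ ∃ K, ∀ y, |V y| ≤ K := by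
  obtain ⟨V, hV⟩ : ∃ V : ℝ → ℝ, ∀ y : ℝ,
      ℘[L] (-I * (y : ℂ) - (-(I * η') + η)) + e₁ / 3 = V y :=
    ⟨fun y ↦ (℘[L] (-I * (y : ℂ) - (-(I * η') + η))).re + e₁ / 3, fun y ↦ by
      apply Complex.ext
      · simp
      · have := h.vertical_im y
        simpa using this⟩
  obtain ⟨G, hG⟩ : ∃ G : ℝ → ℝ, ∀ y : ℝ, ℘'[L] (-I * (y : ℂ) - (-(I * η') + η)) = I * G y :=
    ⟨fun y ↦ (℘'[L] (-I * (y : ℂ) - (-(I * η') + η))).im, fun y ↦ by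
      apply Complex.ext
      · have := (h.vertical_hasDerivAt y).2
        simpa using this
      · simp⟩
  have h3 := h.two_mul_half₃_mem
  have hVd (y : ℝ) : HasDerivAt V (G y) y := by
    have := (h.vertical_hasDerivAt y).1.add_const (e₁ / 3)
    refine (this.congr_of_eventuallyEq (.of_forall fun y ↦ ?_)).congr_deriv ?_
    · rw [← ofReal_re (V y), ← hV]; simp
    · rw [hG]; simp
  have hGd (y : ℝ) : HasDerivAt G (2 * (e₄ ^ 2 - V y ^ 2) - 4 * V y * (V y - e₁)) y := by
    have hd : HasDerivAt (fun z : ℂ ↦ -I * ℘'[L] (-I * z - (-(I * η') + η)))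
        (2 * (e₄ ^ 2 - V y ^ 2) - 4 * V y * (V y - e₁)) (y : ℂ) := by
      have := ((h.hasDerivAt_derivWeierstrassP (h.vertical_notMem y)).comp (y : ℂ)
        (((hasDerivAt_id (y : ℂ)).const_mul (-I)).sub_const (-(I * η') + η))).const_mul (-I)
      rw [hV] at this
      refine this.congr_deriv ?_
      linear_combination (2 * ((V y : ℂ) ^ 2 - e₄ ^ 2) + 4 * V y * (V y - e₁)) * I_sq
    have := hd.real_of_complex
    refine (this.congr_of_eventuallyEq (.of_forall fun y ↦ ?_)).congr_deriv ?_
    · change G y = (-I * ℘'[L] (-I * (y : ℂ) - (-(I * η') + η))).re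
      rw [hG, ← mul_assoc, neg_mul, I_mul_I]
      simp
    · norm_cast
  refine ⟨V, G, hV, hG, hVd, hGd, ?_, ?_, ?_, ?_, ?_⟩
  · have := hV 0
    simp only [ofReal_zero, mul_zero, zero_sub, weierstrassP_neg, h.half₃] at this
    exact_mod_cast this.symm
  · have := hG 0
    simp only [ofReal_zero, mul_zero, zero_sub, derivWeierstrassP_neg,
      derivWeierstrassP_eq_zero h3, neg_zero] at this
    simpa using this.symm
  · have := hV η'
    rw [show -I * (η' : ℂ) - (-(I * η') + η) = -η by ring, weierstrassP_neg, h.half₂] at this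
    exact_mod_cast this.symm
  · intro y
    have h1 := hV (-y)
    rw [← L.weierstrassP_neg, show -(-I * ((-y : ℝ) : ℂ) - (-(I * η') + η)) =
      -I * y - (-(I * η') + η) + 2 * (-(I * η') + η) by push_cast; ring,
      L.weierstrassP_add_coe _ ⟨_, h3⟩, hV] at h1
    exact_mod_cast h1.symm
  -- Periodicity makes V bounded, which provides a global Lipschitz constant for the comparison with
  -- the motion.
  · have hper : Function.Periodic V (2 * η') := fun y ↦ by
      have h1 := hV (y + 2 * η')
      rw [show -I * ((y + 2 * η' : ℝ) : ℂ) - (-(I * η') + η) =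
        -I * y - (-(I * η') + η) + 2 * -(I * η') by push_cast; ring,
        L.weierstrassP_add_coe _ ⟨_, h.two_mul_half₁_mem⟩, hV] at h1
      exact_mod_cast h1.symm
    have hcont : Continuous V := continuous_iff_continuousAt.2 fun y ↦ (hVd y).continuousAt
    obtain ⟨K, hK⟩ := (hper.isBounded_of_continuous (mul_ne_zero two_ne_zero h.pos'.ne')
      hcont).exists_norm_le
    exact ⟨K, fun y ↦ hK _ ⟨y, rfl⟩⟩

end IsUniformization
end PeriodPair

/-! ### The uniformizing variable along the motion -/

namespace ToyTop

/-- The derivative of `i x(t)`, where `x` is the uniformizing variable, as a function of `u`. -/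
noncomputable def paramSpeed (T : ToyTop) (u : ℝ) : ℝ := (1 - u) / (√(2 * T.s) * (T.e₄ ^ 2 - u ^ 2))

/-- A positive value at time t would propagate back to time 0 by the Gronwall bound. -/
lemma eq_zero_of_abs_deriv_le {f f' : ℝ → ℝ} {K : ℝ} (hf : ∀ t, HasDerivAt f (f' t) t)
    (hK : ∀ t, |f' t| ≤ K * f t) (hnn : ∀ t, 0 ≤ f t) (h0 : f 0 = 0) (t : ℝ) : f t = 0 := by
  by_contra hne
  have h := pos_of_abs_deriv_le (f := fun r ↦ f (r + t)) (f' := fun r ↦ f' (r + t)) (K := K)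
    (fun r ↦ (hf (r + t)).comp_add_const r t) (fun r ↦ hK _)
    (by simpa using lt_of_le_of_ne (hnn t) (Ne.symm hne)) (-t)
  simp [h0] at h

namespace AperiodicMotion

variable {T : ToyTop} {Φ : ℝ → Mat} {e₁ n : ℝ} {z : ℝ → ℝ} (M : T.AperiodicMotion Φ e₁ n z)
include M

lemma continuous_height : Continuous fun t ↦ height (Φ t) :=
  continuous_iff_continuousAt.2 fun t ↦ (M.deriv_height t).continuousAt

variable (he₁ : -1 < e₁)
include he₁

lemma height_sq_lt (t : ℝ) : height (Φ t) ^ 2 < 1 := by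
  have := M.le_height t; have := M.height_lt t
  nlinarith

lemma sub_height_sq_pos (t : ℝ) : T.e₄ ^ 2 - 1 < T.e₄ ^ 2 - height (Φ t) ^ 2 := by
  linarith [M.height_sq_lt he₁ t]

lemma sub_height_sq_pos' (t : ℝ) : 0 < T.e₄ ^ 2 - height (Φ t) ^ 2 := by
  have := M.sub_height_sq_pos he₁ t
  nlinarith [T.one_lt_e₄]

lemma paramSpeed_pos (t : ℝ) : 0 < T.paramSpeed (height (Φ t)) := by
  have := M.sub_height_sq_pos' he₁ t
  have := T.s_pos
  have := sub_pos.2 (M.height_lt t)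
  unfold paramSpeed
  positivity

lemma paramSpeed_le (t : ℝ) :
    T.paramSpeed (height (Φ t)) ≤ 2 / (√(2 * T.s) * (T.e₄ ^ 2 - 1)) := by
  have h1 := M.sub_height_sq_pos he₁ t
  have := T.s_pos
  have : 0 < T.e₄ ^ 2 - 1 := by nlinarith [T.one_lt_e₄]
  unfold paramSpeed
  have := M.le_height t
  gcongr
  linarith

/-- For real u the integrand is -i times a positive real number, so x moves along the imaginary axis
and y is a real time parameter. -/
lemma exists_uniformizer_eq : ∃ y : ℝ → ℝ, (∀ t, T.uniformizer Φ t = -I * y t) ∧ y 0 = 0 ∧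
    ∀ t, HasDerivAt y (T.paramSpeed (height (Φ t))) t := by
  have hc : Continuous fun t ↦ T.paramSpeed (height (Φ t)) := by
    have h1 := M.continuous_height
    unfold paramSpeed
    refine Continuous.div₀ (by fun_prop) (by fun_prop) fun t ↦ ?_
    have := M.sub_height_sq_pos' he₁ t
    have := T.s_pos
    positivity
  refine ⟨fun t ↦ ∫ r in (0 : ℝ)..t, T.paramSpeed (height (Φ r)), fun t ↦ ?_, by simp,
    fun t ↦ hc.integral_hasStrictDerivAt 0 t |>.hasDerivAt⟩
  rw [← intervalIntegral.integral_ofReal, ← intervalIntegral.integral_const_mul]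
  refine intervalIntegral.integral_congr fun r _ ↦ ?_
  simp only [paramSpeed]
  have h1 := (M.sub_height_sq_pos' he₁ r).ne'
  have h2 : (T.e₄ : ℂ) ^ 2 - height (Φ r) ^ 2 ≠ 0 := by exact_mod_cast h1
  have h3 : (height (Φ r) : ℂ) ^ 2 - T.e₄ ^ 2 ≠ 0 := by rwa [← neg_sub, neg_ne_zero]
  have h4 : (√(2 * T.s) : ℂ) ≠ 0 := by
    have := T.s_pos
    exact_mod_cast (by positivity : √(2 * T.s) ≠ 0)
  push_cast
  field_simp
  linear_combination ((height (Φ r) : ℂ) - 1) * (T.e₄ ^ 2 - height (Φ r) ^ 2) * I_sq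

/-- The height `u` and the function `w` along the motion solve the differential equation of the
uniformization of the curve. -/
lemma height_eq_of_hasDerivAt (hu₀ : height (Φ 0) = e₁) {y V G : ℝ → ℝ} {K : ℝ} (hy₀ : y 0 = 0)
    (hy : ∀ t, HasDerivAt y (T.paramSpeed (height (Φ t))) t)
    (hV : ∀ y, HasDerivAt V (G y) y)
    (hG : ∀ y, HasDerivAt G (2 * (T.e₄ ^ 2 - V y ^ 2) - 4 * V y * (V y - e₁)) y)
    (hV₀ : V 0 = e₁) (hG₀ : G 0 = 0) (hK : ∀ y, |V y| ≤ K) (t : ℝ) :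
    height (Φ t) = V (y t) ∧ z t = T.paramSpeed (height (Φ t)) * G (y t) := by
  have hD := M.sub_height_sq_pos' he₁
  have hm (t : ℝ) := sub_pos.2 (M.height_lt t)
  have hr : 0 < √(2 * T.s) := Real.sqrt_pos.2 (mul_pos two_pos T.s_pos)
  set g : ℝ → ℝ := fun t ↦ √(2 * T.s) * (T.e₄ ^ 2 - height (Φ t) ^ 2) * z t / (1 - height (Φ t))
    with hg
  have hz (t : ℝ) : z t = T.paramSpeed (height (Φ t)) * g t := by
    have := hD t; have := hm t
    simp only [hg, paramSpeed]
    field_simp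
  have hz₀ : z 0 = 0 := by
    have := M.sq_deriv 0
    rw [hu₀, sub_self, zero_mul] at this
    have h1 := hD 0
    rw [hu₀] at h1
    have h2 := T.s_pos
    simpa [h2.ne', h1.ne'] using this
  have hg₀ : g 0 = 0 := by simp [hg, hz₀]
  set Y := T.paramSpeed
  -- The squared distance between (u, du/dy) and (V, G) satisfies a Gronwall inequality. The right
  -- side of the second order equation is quadratic in u, hence the factor -6(u + V) + 4e₁ from its
  -- difference quotient.
  have hF (t : ℝ) : HasDerivAt (fun t ↦ (height (Φ t) - V (y t)) ^ 2 + (g t - G (y t)) ^ 2)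
      (2 * Y (height (Φ t)) * (1 + (-6 * (height (Φ t) + V (y t)) + 4 * e₁)) *
        ((height (Φ t) - V (y t)) * (g t - G (y t)))) t := by
    have h1 := ((M.deriv_height t).sub ((hV (y t)).comp t (hy t))).pow 2
    have h2 := ((M.deriv₂ t).sub ((hG (y t)).comp t (hy t))).pow 2
    refine (h1.add h2).congr_deriv ?_
    change (2 : ℕ) * (height (Φ t) - V (y t)) ^ (2 - 1) * (z t - G (y t) * Y (height (Φ t))) +
      (2 : ℕ) * (g t - G (y t)) ^ (2 - 1) * (Y (height (Φ t)) * (2 * (T.e₄ ^ 2 - height (Φ t) ^ 2) -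
        4 * height (Φ t) * (height (Φ t) - e₁)) - (2 * (T.e₄ ^ 2 - V (y t) ^ 2) -
        4 * V (y t) * (V (y t) - e₁)) * Y (height (Φ t))) = _
    rw [hz t]
    push_cast
    ring
  have hzero := eq_zero_of_abs_deriv_le hF
    (K := 2 / (√(2 * T.s) * (T.e₄ ^ 2 - 1)) * (1 + (6 * (1 + K) + 4))) (fun t ↦ ?_)
    (fun t ↦ by positivity) (by simp [hu₀, hy₀, hV₀, hG₀, hg₀]) t
  · have h1 := sq_nonneg (height (Φ t) - V (y t))
    have h2 := sq_nonneg (g t - G (y t))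
    have h3 : height (Φ t) = V (y t) := by
      rw [← sub_eq_zero, ← sq_eq_zero_iff]; linarith
    have h4 : g t = G (y t) := by
      rw [← sub_eq_zero, ← sq_eq_zero_iff]; linarith
    exact ⟨h3, by rw [hz, h4]⟩
  · have hY := M.paramSpeed_le he₁ t
    have hY0 := M.paramSpeed_pos he₁ t
    have hY1 := hY0.trans_le hY
    have hK0 : 0 ≤ K := (abs_nonneg _).trans (hK 0)
    set A := height (Φ t) - V (y t)
    set B := g t - G (y t)
    have hAB : 2 * |A * B| ≤ A ^ 2 + B ^ 2 := by
      rw [abs_mul]; nlinarith [sq_nonneg (|A| - |B|), sq_abs A, sq_abs B]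
    have hb : |1 + (-6 * (height (Φ t) + V (y t)) + 4 * e₁)| ≤ 1 + (6 * (1 + K) + 4) := by
      have h1 := abs_le.1 (hK (y t))
      have h2 := M.le_height t
      have h3 := M.height_lt t
      rw [abs_le]
      constructor <;> linarith
    calc _ = Y (height (Φ t)) * |1 + (-6 * (height (Φ t) + V (y t)) + 4 * e₁)| * (2 * |A * B|) := by
          rw [abs_mul, abs_mul, abs_mul, abs_two, abs_of_pos hY0]; ring
      _ ≤ 2 / (√(2 * T.s) * (T.e₄ ^ 2 - 1)) * (1 + (6 * (1 + K) + 4)) * (A ^ 2 + B ^ 2) :=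
        mul_le_mul (mul_le_mul hY hb (abs_nonneg _) hY1.le) hAB (by positivity)
          (mul_nonneg hY1.le (by positivity))

end AperiodicMotion
end ToyTop

/-! ### Logarithmic derivatives of products of sigma functions -/

namespace PeriodPair

section LogDeriv

variable {L : PeriodPair} {ω₃ a b wm wp p l c : ℂ} {e₁ : ℝ}

lemma notMem_of_derivWeierstrassP_ne_zero {z : ℂ} (h : ℘'[L] z ≠ 0) : z ∉ L.lattice :=
  fun hz ↦ h (L.derivWeierstrassP_coe ⟨z, hz⟩)

lemma weierstrassP_ne_iff {z w : ℂ} (hz : z ∉ L.lattice) (hw : w ∉ L.lattice) :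
    ℘[L] z ≠ ℘[L] w ↔ z + w ∉ L.lattice ∧ z - w ∉ L.lattice := by
  rw [Ne, L.weierstrassP_eq_iff hz hw, not_or]

/-- The logarithmic derivatives of the explicit functions `α` and `δ` in terms of `u` and `w`. -/
lemma logDeriv_sigma_quotients (h3 : 2 * ω₃ ∈ L.lattice) (hwm : wm ≠ 0) (hwp : wp ≠ 0)
    (ha : ℘[L] (a - ω₃) + e₁ / 3 = -1 ∧ ℘'[L] (a - ω₃) = wm)
    (hb : ℘[L] (b - ω₃) + e₁ / 3 = 1 ∧ ℘'[L] (b - ω₃) = wp) (hp : p = wm / (2 * wp))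
    (hl : l = wm / 4 - wm / c + L.weierstrassZeta (a - ω₃)
      - p * (L.weierstrassZeta (a + b) - L.weierstrassZeta (a - b)))
    {x u : ℂ} (hx : x - ω₃ ∉ L.lattice) (hu : ℘[L] (x - ω₃) + e₁ / 3 = u) (hu1 : u ≠ -1)
    (hu2 : u ≠ 1) :
    l + (L.weierstrassZeta (x - a) - L.weierstrassZeta (x - ω₃))
        + p * (L.weierstrassZeta (x + b) - L.weierstrassZeta (x - b)) =
      (℘'[L] (x - ω₃) + wm) / (2 * (u + 1)) - wm / c - wm / (2 * (u - 1)) ∧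
    -l + (L.weierstrassZeta (x + a) - L.weierstrassZeta (x + ω₃))
        + p * (L.weierstrassZeta (x - b) - L.weierstrassZeta (x + b)) =
      (℘'[L] (x - ω₃) - wm) / (2 * (u + 1)) + wm / c + wm / (2 * (u - 1)) := by
  have hA : a - ω₃ ∉ L.lattice := notMem_of_derivWeierstrassP_ne_zero (ha.2 ▸ hwm)
  have hB : b - ω₃ ∉ L.lattice := notMem_of_derivWeierstrassP_ne_zero (hb.2 ▸ hwp)
  -- Moving an argument by the period 2ω₃ adds the same constant q to each zeta value, and q cancels
  -- in all differences below.
  obtain ⟨q, hq⟩ := L.exists_weierstrassZeta_add h3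
  have d1 : ℘[L] (x - ω₃) - ℘[L] (a - ω₃) = u + 1 := by linear_combination hu - ha.1
  have d2 : ℘[L] (x - ω₃) - ℘[L] (b - ω₃) = u - 1 := by linear_combination hu - hb.1
  have d3 : ℘[L] (a - ω₃) - ℘[L] (b - ω₃) = -2 := by linear_combination ha.1 - hb.1
  have n1 : u + 1 ≠ 0 := fun h ↦ hu1 (by linear_combination h)
  have n2 : u - 1 ≠ 0 := sub_ne_zero.2 hu2
  have m1 := (weierstrassP_ne_iff hx hA).1 (sub_ne_zero.1 (d1 ▸ n1))
  have m2 := (weierstrassP_ne_iff hx hB).1 (sub_ne_zero.1 (d2 ▸ n2))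
  have m3 := (weierstrassP_ne_iff hA hB).1 (sub_ne_zero.1 (by rw [d3]; norm_num))
  have q1 := hq _ m1.1
  have q2 := hq _ m2.1
  have q3 := hq _ m3.1
  have q4 := hq _ hx
  have z1 := L.weierstrassZeta_add hx hA (sub_ne_zero.1 (d1 ▸ n1))
  have z2 := L.weierstrassZeta_add (w := -(a - ω₃)) hx (by rwa [neg_mem_iff])
    (by rw [weierstrassP_neg]; exact sub_ne_zero.1 (d1 ▸ n1))
  have z3 := L.weierstrassZeta_sub_sub_add hx hB (sub_ne_zero.1 (d2 ▸ n2))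
  have z4 := L.weierstrassZeta_sub_sub_add hA hB (sub_ne_zero.1 (by rw [d3]; norm_num))
  rw [d1, ha.2] at z1
  rw [weierstrassP_neg, derivWeierstrassP_neg, weierstrassZeta_neg, d1, ha.2] at z2
  rw [d2, hb.2] at z3
  rw [d3, hb.2] at z4
  rw [show x - ω₃ - (a - ω₃) = x - a by ring] at z1
  rw [show x - ω₃ - -(a - ω₃) = x - ω₃ + (a - ω₃) by ring] at z2
  rw [show x - ω₃ - (b - ω₃) = x - b by ring] at z3
  rw [show a - ω₃ - (b - ω₃) = a - b by ring] at z4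
  rw [show x - ω₃ + (a - ω₃) + 2 * ω₃ = x + a by ring] at q1
  rw [show x - ω₃ + (b - ω₃) + 2 * ω₃ = x + b by ring] at q2
  rw [show a - ω₃ + (b - ω₃) + 2 * ω₃ = a + b by ring] at q3
  rw [show x - ω₃ + 2 * ω₃ = x + ω₃ by ring] at q4
  have hpw : p * wp = wm / 2 := by rw [hp]; field_simp
  have e1 : p * (wp / (u - 1)) = wm / (2 * (u - 1)) := by
    rw [← mul_div_assoc, hpw]; field_simp
  have e2 : p * (wp / -2) = -wm / 4 := by rw [← mul_div_assoc, hpw]; ring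
  -- The unknown value of ζ at b - ω₃ cancels between the formulas at x and at a. The choice of p
  -- replaces wp by wm/2, and the remainder -wm/4 is what the first term of l compensates.
  have key : p * (L.weierstrassZeta (x + b) - L.weierstrassZeta (x - b)) -
      p * (L.weierstrassZeta (a + b) - L.weierstrassZeta (a - b)) =
      -(wm / (2 * (u - 1))) - wm / 4 := by
    rw [q2, q3]
    linear_combination p * (z4 - z3) - e1 + e2
  constructor
  · rw [hl]
    linear_combination key + z1
  · rw [hl, q1, q4]
    linear_combination -key + z2

variable (L)

lemma hasDerivAt_weierstrassSigma_div {x a b : ℂ} (ha : x + a ∉ L.lattice)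
    (hb : x + b ∉ L.lattice) :
    HasDerivAt (fun x ↦ L.weierstrassSigma (x + a) / L.weierstrassSigma (x + b))
      (L.weierstrassSigma (x + a) / L.weierstrassSigma (x + b) *
        (L.weierstrassZeta (x + a) - L.weierstrassZeta (x + b))) x := by
  have h1 := (L.hasDerivAt_weierstrassSigma ha).comp_add_const x a
  have h2 := (L.hasDerivAt_weierstrassSigma hb).comp_add_const x b
  have hne := L.weierstrassSigma_ne_zero hb
  refine (h1.div h2 hne).congr_deriv ?_
  field_simp

end LogDeriv

end PeriodPair

/-! ### Branches of complex powers and scalar linear equations -/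

section PowerBranch

variable {U : Set ℂ} {f : ℂ → ℂ} {p : ℂ} {P : ℂ → ℂ}

lemma IsPowerBranch.ne_zero (h : IsPowerBranch U f p P) {x : ℂ} (hx : x ∈ U) : f x ≠ 0 := by
  obtain ⟨ℓ, -, h⟩ := h
  rw [← (h x hx).1]
  exact exp_ne_zero _

lemma IsPowerBranch.hasDerivAt (h : IsPowerBranch U f p P) (hU : IsOpen U) {x c : ℂ} (hx : x ∈ U)
    (hf : HasDerivAt f (f x * c) x) : HasDerivAt P (P x * (p * c)) x := by
  have hne := h.ne_zero hx
  obtain ⟨ℓ, hℓ, h⟩ := h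
  have hd := ((hℓ x hx).differentiableAt (hU.mem_nhds hx)).hasDerivAt
  have hev := hU.mem_nhds hx
  have h1 := (hd.cexp.congr_of_eventuallyEq (eventually_of_mem hev fun y hy ↦ (h y hy).1.symm)).unique
    hf
  rw [(h x hx).1] at h1
  have h2 := mul_left_cancel₀ hne h1
  refine ((hd.const_mul p).cexp.congr_of_eventuallyEq
    (eventually_of_mem hev fun y hy ↦ (h y hy).2)).congr_deriv ?_
  rw [(h x hx).2, h2]

lemma IsPowerBranch.differentiableOn (h : IsPowerBranch U f p P) : DifferentiableOn ℂ P U := by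
  obtain ⟨ℓ, hℓ, h⟩ := h
  exact (hℓ.const_mul p).cexp.congr fun y hy ↦ (h y hy).2

end PowerBranch

/-- The quotient of two solutions with the same logarithmic derivative is constant. Only the
denominator has to be free of zeros, so no such knowledge about f is required. -/
lemma eq_of_hasDerivAt_mul {f g c : ℝ → ℂ} (hf : ∀ t, HasDerivAt f (f t * c t) t)
    (hg : ∀ t, HasDerivAt g (g t * c t) t) (hne : ∀ t, g t ≠ 0) (h0 : f 0 = g 0) (t : ℝ) :
    f t = g t := by
  have hd (t : ℝ) : HasDerivAt (fun t ↦ f t / g t) 0 t := by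
    refine ((hf t).div (hg t) (hne t)).congr_deriv ?_
    rw [div_eq_zero_iff]
    left; ring
  have := is_const_of_deriv_eq_zero (fun t ↦ (hd t).differentiableAt) (fun t ↦ (hd t).deriv) t 0
  rw [h0, div_self (hne 0), div_eq_one_iff_eq (hne t)] at this
  exact this

/-! ### The explicit solution along the motion -/

namespace ToyTop

/-- The three fractions multiplying wm add up to (u² - e²)/((1 - u²)(1 - e²)). The factor e² - u²
cancels against dx/dt and 1 - e² against wm, which leaves the angular term n/(A(1 + u)). -/
lemma logDeriv_identity {u w wm e r n A z x' : ℂ} (h1 : 1 + u ≠ 0) (h2 : 1 - u ≠ 0)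
    (h3 : e ^ 2 - u ^ 2 ≠ 0) (h4 : 1 - e ^ 2 ≠ 0) (hr : r ≠ 0) (hA : A ≠ 0)
    (hwm : wm = r * (1 - e ^ 2) * (n / A)) (hx' : x' = -I * ((1 - u) / (r * (e ^ 2 - u ^ 2))))
    (hz : x' * w = z) :
    x' * ((w + wm) / (2 * (u + 1)) - wm / (1 - e ^ 2) - wm / (2 * (u - 1))) =
      z / (2 * (1 + u)) + I * (n / (A * (1 + u))) ∧
    x' * ((w - wm) / (2 * (u + 1)) + wm / (1 - e ^ 2) + wm / (2 * (u - 1))) =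
      z / (2 * (1 + u)) - I * (n / (A * (1 + u))) := by
  have h5 : u + 1 ≠ 0 := by rwa [add_comm]
  have h6 : u - 1 ≠ 0 := by rwa [← neg_sub, neg_ne_zero]
  have key : x' * (wm * (1 / (2 * (u + 1)) - 1 / (1 - e ^ 2) - 1 / (2 * (u - 1)))) =
      I * (n / (A * (1 + u))) := by
    rw [hwm, hx']
    field_simp
    ring
  have key' : x' * w / (2 * (u + 1)) = z / (2 * (1 + u)) := by rw [hz, add_comm]
  constructor
  · rw [← key, ← key']; ring
  · rw [← key, ← key']; ring

section Initial

variable {Φ : Mat} {e₁ : ℝ} (h : Φ ∈ Matrix.specialUnitaryGroup (Fin 2) ℂ) (hu : height Φ = e₁)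
include h hu

lemma entry_zero_zero_eq (hα : 0 < (Φ 0 0).re ∧ (Φ 0 0).im = 0) :
    Φ 0 0 = (√((1 + e₁) / 2) : ℂ) ∧ Φ 1 1 = (√((1 + e₁) / 2) : ℂ) := by
  have h1 := one_add_axis₃ h
  obtain ⟨-, h2⟩ := entries_of_mem h
  have h3 : Φ 0 0 = ((Φ 0 0).re : ℂ) := Complex.ext (by simp) (by simp [hα.2])
  rw [h2, ← height_eq h, hu, h3, conj_ofReal] at h1
  norm_cast at h1
  have h4 : √((1 + e₁) / 2) = (Φ 0 0).re := by
    rw [Real.sqrt_eq_iff_mul_self_eq_of_pos hα.1]; linarith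
  rw [h4, h2, h3, conj_ofReal]
  simp

lemma entry_zero_one_eq (hβ : (Φ 0 1).re = 0 ∧ 0 < (Φ 0 1).im) :
    Φ 0 1 = I * (√((1 - e₁) / 2) : ℂ) ∧ Φ 1 0 = I * (√((1 - e₁) / 2) : ℂ) := by
  have h1 := one_sub_axis₃ h
  obtain ⟨h2, -⟩ := entries_of_mem h
  have h3 : Φ 0 1 = I * ((Φ 0 1).im : ℂ) := Complex.ext (by simp [hβ.1]) (by simp)
  have h5 : Φ 1 0 = I * ((Φ 0 1).im : ℂ) := by
    rw [h2, h3]; simp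
  have h6 : (1 - e₁ : ℂ) = 2 * ((Φ 0 1).im * (Φ 0 1).im) := by
    rw [h5, h3, ← height_eq h, hu] at h1
    simp only [mul_im, I_re, ofReal_im, mul_zero, I_im, ofReal_re, one_mul, zero_add] at h1
    linear_combination h1 - 2 * (Φ 0 1).im * (Φ 0 1).im * I_sq
  norm_cast at h6
  have h4 : √((1 - e₁) / 2) = (Φ 0 1).im := by
    rw [Real.sqrt_eq_iff_mul_self_eq_of_pos hβ.2]; linarith
  rw [h4]
  exact ⟨h3, h5⟩

end Initial

/-- The data of the uniformization along a motion in the aperiodic case. -/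
structure UniformizedMotion (T : ToyTop) (Φ : ℝ → Mat) (e₁ n : ℝ) (L : PeriodPair) (ω₃ : ℂ)
    (x : ℝ → ℂ) (z : ℝ → ℝ) : Prop extends T.AperiodicMotion Φ e₁ n z where
  lt_e₁ : -1 < e₁
  two_mul_mem : 2 * ω₃ ∈ L.lattice
  x_zero : x 0 = 0
  height_zero : height (Φ 0) = e₁
  notMem : ∀ t, x t - ω₃ ∉ L.lattice
  deriv_x : ∀ t, HasDerivAt x (-I * T.paramSpeed (height (Φ t))) t
  height_eq : ∀ t, L.weierstrassP (x t - ω₃) + e₁ / 3 = height (Φ t)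
  z_eq : ∀ t, -I * T.paramSpeed (height (Φ t)) * L.derivWeierstrassP (x t - ω₃) = z t

namespace UniformizedMotion

variable {T : ToyTop} {Φ : ℝ → Mat} {e₁ n : ℝ} {L : PeriodPair} {ω₃ : ℂ} {x : ℝ → ℂ} {z : ℝ → ℝ}
  (M : T.UniformizedMotion Φ e₁ n L ω₃ x z)
include M

lemma height_mem (t : ℝ) : height (Φ t) ∈ Ioo (-1) 1 :=
  ⟨M.lt_e₁.trans_le (M.le_height t), M.height_lt t⟩

/-- Points congruent up to sign would have the same height. Since the height lies strictly between
-1 and 1, the path thus avoids the zeros of the sigma functions at ±a and ±b. -/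
lemma sub_notMem {c v : ℂ} (hc : c - ω₃ ∉ L.lattice) (hv : L.weierstrassP (c - ω₃) + e₁ / 3 = v)
    {t : ℝ} (h : (height (Φ t) : ℂ) ≠ v) : x t - c ∉ L.lattice ∧ x t + c ∉ L.lattice := by
  have h1 : L.weierstrassP (x t - ω₃) ≠ L.weierstrassP (c - ω₃) := fun he ↦ h <| by
    rw [← M.height_eq, ← hv, he]
  have h2 := (PeriodPair.weierstrassP_ne_iff (M.notMem t) hc).1 h1
  refine ⟨by simpa using h2.2, fun hm ↦ h2.1 ?_⟩
  have := sub_mem hm M.two_mul_mem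
  rwa [show x t + c - 2 * ω₃ = x t - ω₃ + (c - ω₃) by ring] at this

variable {a b p k l wm wp : ℂ} {U : Set ℂ} {P Q S : ℂ → ℂ}
  (hwm : wm = ((√(2 * T.s) * (1 - T.e₄ ^ 2) * (n / T.A) : ℝ) : ℂ)) (hwp : wp ≠ 0)
  (ha : L.weierstrassP (a - ω₃) + e₁ / 3 = -1 ∧ L.derivWeierstrassP (a - ω₃) = wm)
  (hb : L.weierstrassP (b - ω₃) + e₁ / 3 = 1 ∧ L.derivWeierstrassP (b - ω₃) = wp)
  (hp : p = wm / (2 * wp))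
  (hk : k = (√((1 + e₁) / 2) : ℂ) * (L.weierstrassSigma ω₃ / L.weierstrassSigma a))
  (hl : l = wm / 4 - wm / (1 - (T.e₄ : ℂ) ^ 2) + L.weierstrassZeta (a - ω₃)
    - p * (L.weierstrassZeta (a + b) - L.weierstrassZeta (a - b)))
  (hU : IsPathDomain L ω₃ x U) (hB : AreAperiodicBranches L ω₃ e₁ b p U P Q S)

omit M in
lemma one_sub_e₄_sq_ne_zero : (1 - (T.e₄ : ℂ) ^ 2) ≠ 0 := by
  have := T.one_lt_e₄
  exact_mod_cast (by nlinarith : 1 - T.e₄ ^ 2 ≠ 0)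

include hwm in
lemma wm_ne_zero : wm ≠ 0 := by
  have h1 := M.sq_n
  have := M.lt_e₁
  have hn : n ≠ 0 := by
    rintro rfl
    have : 0 < 2 * T.A * T.μ * (1 + e₁) :=
      mul_pos (mul_pos (mul_pos two_pos T.A_pos) T.μ_pos) (by linarith)
    linarith
  have h2 := T.one_lt_e₄
  rw [hwm, ofReal_ne_zero]
  have h3 : 1 - T.e₄ ^ 2 ≠ 0 := by nlinarith
  have := T.s_pos; have := T.A_pos
  positivity

include hwm hwp ha hb hp hl hU hB

lemma hasDerivAt_aperiodicSolution (t : ℝ) :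
    HasDerivAt (fun t ↦ aperiodicSolution L ω₃ a p k l P Q S (x t) 0 0)
      (aperiodicSolution L ω₃ a p k l P Q S (x t) 0 0 *
        ((z t / (2 * (1 + height (Φ t))) : ℝ) + I * (n / (T.A * (1 + height (Φ t))) : ℝ))) t ∧
    HasDerivAt (fun t ↦ aperiodicSolution L ω₃ a p k l P Q S (x t) 1 1)
      (aperiodicSolution L ω₃ a p k l P Q S (x t) 1 1 *
        ((z t / (2 * (1 + height (Φ t))) : ℝ) - I * (n / (T.A * (1 + height (Φ t))) : ℝ))) t := by
  have hm := M.height_mem t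
  have hwm0 := M.wm_ne_zero hwm
  have hA := PeriodPair.notMem_of_derivWeierstrassP_ne_zero (ha.2 ▸ hwm0)
  have hB' := PeriodPair.notMem_of_derivWeierstrassP_ne_zero (hb.2 ▸ hwp)
  have u1 : (height (Φ t) : ℂ) ≠ -1 := by exact_mod_cast hm.1.ne'
  have u2 : (height (Φ t) : ℂ) ≠ 1 := by exact_mod_cast hm.2.ne
  obtain ⟨na, na'⟩ := M.sub_notMem hA ha.1 u1
  obtain ⟨nb, nb'⟩ := M.sub_notMem hB' hb.1 u2
  obtain ⟨l1, l2⟩ := PeriodPair.logDeriv_sigma_quotients M.two_mul_mem hwm0 hwp ha hb hp hl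
    (M.notMem t) (M.height_eq t) u1 u2
  have n3 : x t + ω₃ ∉ L.lattice := fun h ↦ M.notMem t <| by
    have := sub_mem h M.two_mul_mem
    rwa [show x t + ω₃ - 2 * ω₃ = x t - ω₃ by ring] at this
  have hD := M.sub_height_sq_pos' M.lt_e₁ t
  have hr : (0 : ℝ) < √(2 * T.s) := Real.sqrt_pos.2 (mul_pos two_pos T.s_pos)
  obtain ⟨i1, i2⟩ := logDeriv_identity (u := height (Φ t)) (w := L.derivWeierstrassP (x t - ω₃))
    (wm := wm) (e := T.e₄) (r := √(2 * T.s)) (n := n) (A := T.A) (z := z t)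
    (x' := -I * T.paramSpeed (height (Φ t))) (by rw [add_comm]; exact fun h ↦ u1 (by linear_combination h))
    (sub_ne_zero.2 u2.symm) (by exact_mod_cast hD.ne') one_sub_e₄_sq_ne_zero
    (by exact_mod_cast hr.ne') (by exact_mod_cast T.A_pos.ne') (by rw [hwm]; push_cast; rfl)
    (by simp [paramSpeed]) (M.z_eq t)
  have hxU := hU.path_mem t
  have hσ1 := L.hasDerivAt_weierstrassSigma_div (x := x t) (a := b) (b := -b) nb'
    (by rwa [← sub_eq_add_neg])
  have hσ2 := L.hasDerivAt_weierstrassSigma_div (x := x t) (a := -b) (b := b)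
    (by rwa [← sub_eq_add_neg]) nb'
  have hσ3 := L.hasDerivAt_weierstrassSigma_div (x := x t) (a := -a) (b := -ω₃)
    (by rwa [← sub_eq_add_neg]) (by rw [← sub_eq_add_neg]; exact M.notMem t)
  have hσ4 := L.hasDerivAt_weierstrassSigma_div (x := x t) (a := a) (b := ω₃) na' n3
  simp only [← sub_eq_add_neg] at hσ1 hσ2 hσ3
  have hP := hB.branch_P.hasDerivAt hU.isOpen hxU hσ1
  have hQ := hB.branch_Q.hasDerivAt hU.isOpen hxU hσ2
  have he1 : HasDerivAt (fun x ↦ k * exp (l * x - I * Real.pi * p))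
      (k * (exp (l * x t - I * Real.pi * p) * l)) (x t) := by
    have := ((((hasDerivAt_id (x t)).const_mul l).sub_const (I * Real.pi * p)).cexp).const_mul k
    simpa using this
  have he2 : HasDerivAt (fun x ↦ k * exp (-(l * x) + I * Real.pi * p))
      (k * (exp (-(l * x t) + I * Real.pi * p) * -l)) (x t) := by
    have := ((((hasDerivAt_id (x t)).const_mul l).neg.add_const (I * Real.pi * p)).cexp).const_mul k
    simpa using this
  constructor
  · refine (((he1.mul hσ3).mul hP).comp t (M.deriv_x t)).congr_deriv ?_
    push_cast
    rw [← i1, ← l1]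
    simp only [aperiodicSolution, Matrix.of_apply, Matrix.cons_val', Matrix.cons_val_zero,
      Matrix.cons_val_fin_one, Pi.mul_apply]
    ring
  · refine (((he2.mul hσ4).mul hQ).comp t (M.deriv_x t)).congr_deriv ?_
    push_cast
    rw [← i2, ← l2]
    simp only [aperiodicSolution, Matrix.of_apply, Matrix.cons_val', Matrix.cons_val_one,
      Matrix.cons_val_fin_one, Pi.mul_apply]
    ring

omit hp hl hU hwp hb in
include hk in
-- Since σ is odd, the sigma quotients equal σ(a)/σ(ω₃) at 0 and cancel against k. The factors
-- exp(∓iπp) cancel against the prescribed branch values.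
lemma aperiodicSolution_zero :
    aperiodicSolution L ω₃ a p k l P Q S 0 0 0 = (√((1 + e₁) / 2) : ℂ) ∧
    aperiodicSolution L ω₃ a p k l P Q S 0 1 1 = (√((1 + e₁) / 2) : ℂ) := by
  have hA := PeriodPair.notMem_of_derivWeierstrassP_ne_zero (ha.2 ▸ M.wm_ne_zero hwm)
  have u1 : (height (Φ 0) : ℂ) ≠ -1 := by exact_mod_cast (M.height_mem 0).1.ne'
  have na := (M.sub_notMem hA ha.1 u1).2
  have nω := M.notMem 0
  rw [M.x_zero, zero_add] at na
  rw [M.x_zero, zero_sub, neg_mem_iff] at nω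
  have s1 := L.weierstrassSigma_ne_zero na
  have s2 := L.weierstrassSigma_ne_zero nω
  simp only [aperiodicSolution, Matrix.of_apply, Matrix.cons_val', Matrix.cons_val_zero,
    Matrix.cons_val_one, Matrix.cons_val_fin_one, zero_sub, zero_add, mul_zero, hB.P_zero,
    hB.Q_zero, hk, L.weierstrassSigma_neg, exp_neg, neg_zero]
  have := exp_ne_zero (I * Real.pi * p)
  constructor <;> field_simp

end UniformizedMotion
end ToyTop

/-! ### Comparison with the motion, holomorphy and uniqueness -/

namespace ToyTop
namespace UniformizedMotion

variable {T : ToyTop} {Φ : ℝ → Mat} {e₁ n : ℝ} {L : PeriodPair} {ω₃ : ℂ} {x : ℝ → ℂ} {z : ℝ → ℝ}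
  (M : T.UniformizedMotion Φ e₁ n L ω₃ x z)

lemma _root_.HasDerivAt.mul_cexp_const_mul {f : ℝ → ℂ} {c : ℂ} {t : ℝ}
    (h : HasDerivAt f (f t * c) t) (q : ℂ) :
    HasDerivAt (fun t : ℝ ↦ f t * exp (q * t)) (f t * exp (q * t) * (c + q)) t := by
  have h1 : HasDerivAt (fun t : ℝ ↦ exp (q * t)) (exp (q * t) * q) t := by
    have := (((hasDerivAt_id (t : ℂ)).const_mul q).cexp).comp_ofReal
    simpa using this
  refine (h.mul h1).congr_deriv ?_
  ring

include M

lemma sqrt_pos (t : ℝ) : 0 < √((1 - height (Φ t)) / 2) :=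
  Real.sqrt_pos.2 (by have := (M.height_mem t).2; linarith)

lemma hasDerivAt_sqrt (t : ℝ) :
    HasDerivAt (fun t ↦ I * (√((1 - height (Φ t)) / 2) : ℂ))
      (I * (√((1 - height (Φ t)) / 2) : ℂ) * (-(z t / (2 * (1 - height (Φ t))) : ℝ))) t := by
  have h1 := M.sqrt_pos t
  have h2 : 0 < 1 - height (Φ t) := by linarith [(M.height_mem t).2]
  have h3 : √((1 - height (Φ t)) / 2) ^ 2 = (1 - height (Φ t)) / 2 := Real.sq_sqrt (by linarith)
  have := ((((M.deriv_height t).const_sub 1).div_const 2).sqrt (by positivity)).ofReal_comp.const_mul I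
  refine this.congr_deriv ?_
  rw [mul_assoc]
  congr 1
  norm_cast
  have h4 : 1 - height (Φ t) = 2 * √((1 - height (Φ t)) / 2) ^ 2 := by linarith
  nth_rewrite 3 [h4]
  field_simp

variable {a b p k l wm wp : ℂ} {U : Set ℂ} {P Q S : ℂ → ℂ}

/-- Along the connected time axis two continuous square roots of a function without zeros agree if
they agree at one time. -/
lemma branch_sqrt_eq (hU : IsPathDomain L ω₃ x U)
    (hB : AreAperiodicBranches L ω₃ e₁ b p U P Q S) (t : ℝ) :
    S (x t) = (√((1 - height (Φ t)) / 2) : ℂ) := by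
  have hx : Continuous x := continuous_iff_continuousAt.2 fun t ↦ (M.deriv_x t).continuousAt
  have hS : Continuous fun t ↦ S (x t) := continuous_iff_continuousAt.2 fun t ↦
    ((hB.holo_S _ (hU.path_mem t)).differentiableAt
      (hU.isOpen.mem_nhds (hU.path_mem t))).continuousAt.comp hx.continuousAt
  have hs : Continuous fun t ↦ (√((1 - height (Φ t)) / 2) : ℂ) := by
    have := M.continuous_height
    fun_prop
  refine isPreconnected_univ.eq_of_sq_eq hS.continuousOn hs.continuousOn (fun t _ ↦ ?_)
    (fun {t} _ ↦ by exact_mod_cast (M.sqrt_pos t).ne') (mem_univ 0) ?_ (mem_univ t)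
  · simp only [Pi.pow_apply]
    rw [hB.sq_S _ (hU.path_mem t), M.height_eq]
    norm_cast
    rw [Real.sq_sqrt (by have := (M.height_mem t).2; linarith)]
  · rw [M.x_zero, hB.S_zero, M.height_zero]

variable
  (hwm : wm = ((√(2 * T.s) * (1 - T.e₄ ^ 2) * (n / T.A) : ℝ) : ℂ)) (hwp : wp ≠ 0)
  (ha : L.weierstrassP (a - ω₃) + e₁ / 3 = -1 ∧ L.derivWeierstrassP (a - ω₃) = wm)
  (hb : L.weierstrassP (b - ω₃) + e₁ / 3 = 1 ∧ L.derivWeierstrassP (b - ω₃) = wp)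
  (hp : p = wm / (2 * wp))
  (hk : k = (√((1 + e₁) / 2) : ℂ) * (L.weierstrassSigma ω₃ / L.weierstrassSigma a))
  (hl : l = wm / 4 - wm / (1 - (T.e₄ : ℂ) ^ 2) + L.weierstrassZeta (a - ω₃)
    - p * (L.weierstrassZeta (a + b) - L.weierstrassZeta (a - b)))
  (hU : IsPathDomain L ω₃ x U) (hB : AreAperiodicBranches L ω₃ e₁ b p U P Q S)
  (hα : 0 < (Φ 0 0 0).re ∧ (Φ 0 0 0).im = 0) (hβ : (Φ 0 0 1).re = 0 ∧ 0 < (Φ 0 0 1).im)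
include hwm hwp ha hb hp hk hl hU hB hα hβ

/-- After multiplication by the spin factor each entry satisfies the scalar equation of the same
entry of Φ, with the same initial value. The entries of Φ have no zeros, because αδ = (1 + u)/2 and
-βγ = (1 - u)/2. -/
theorem eq_aperiodicSolution_mul {τ : ℝ} (hτ : τ = (1 / T.C - 1 / T.A) * n) (t : ℝ) :
    Φ t = aperiodicSolution L ω₃ a p k l P Q S (x t) *
      !![exp (I / 2 * τ * t), 0; 0, exp (-(I / 2 * τ * t))] := by
  obtain ⟨i1, i2⟩ := entry_zero_zero_eq (M.mem_SU2 0) M.height_zero hα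
  obtain ⟨i3, i4⟩ := entry_zero_one_eq (M.mem_SU2 0) M.height_zero hβ
  obtain ⟨j1, j2⟩ := M.aperiodicSolution_zero hwm ha hk hB (l := l)
  have hd := M.hasDerivAt_aperiodicSolution hwm hwp ha hb hp hl hU hB (k := k)
  have hS := M.branch_sqrt_eq hU hB
  have hs := M.hasDerivAt_sqrt
  have hpos (t : ℝ) : (1 + height (Φ t) : ℂ) ≠ 0 := by
    have := (M.height_mem t).1
    exact_mod_cast (by linarith : 1 + height (Φ t) ≠ 0)
  have hneg (t : ℝ) : (1 - height (Φ t) : ℂ) ≠ 0 := by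
    have := (M.height_mem t).2
    exact_mod_cast (by linarith : 1 - height (Φ t) ≠ 0)
  have hne1 (t : ℝ) : Φ t 0 0 ≠ 0 ∧ Φ t 1 1 ≠ 0 := by
    have h1 := one_add_axis₃ (M.mem_SU2 t)
    rw [← ToyTop.height_eq (M.mem_SU2 t)] at h1
    exact ⟨fun h ↦ hpos t (by rw [h1, h]; simp), fun h ↦ hpos t (by rw [h1, h]; simp)⟩
  have hne2 (t : ℝ) : Φ t 0 1 ≠ 0 ∧ Φ t 1 0 ≠ 0 := by
    have h1 := one_sub_axis₃ (M.mem_SU2 t)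
    rw [← ToyTop.height_eq (M.mem_SU2 t)] at h1
    exact ⟨fun h ↦ hneg t (by rw [h1, h]; simp), fun h ↦ hneg t (by rw [h1, h]; simp)⟩
  have E1 := eq_of_hasDerivAt_mul (g := fun t ↦ Φ t 0 0)
    (fun t ↦ (hd t).1.mul_cexp_const_mul (I / 2 * τ))
    (fun t ↦ (M.deriv_α t).congr_deriv (by rw [hτ]; push_cast; ring)) (fun t ↦ (hne1 t).1)
    (by simp [M.x_zero, j1, i1]) t
  have E2 := eq_of_hasDerivAt_mul (g := fun t ↦ Φ t 1 1)
    (fun t ↦ (hd t).2.mul_cexp_const_mul (-(I / 2 * τ)))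
    (fun t ↦ (M.deriv_δ t).congr_deriv (by rw [hτ]; push_cast; ring)) (fun t ↦ (hne1 t).2)
    (by simp [M.x_zero, j2, i2]) t
  have E3 := eq_of_hasDerivAt_mul (g := fun t ↦ Φ t 0 1)
    (fun t ↦ (hs t).mul_cexp_const_mul (-(I / 2 * τ)))
    (fun t ↦ (M.deriv_β t).congr_deriv (by rw [hτ]; push_cast; ring)) (fun t ↦ (hne2 t).1)
    (by simp [M.height_zero, i3]) t
  have E4 := eq_of_hasDerivAt_mul (g := fun t ↦ Φ t 1 0)
    (fun t ↦ (hs t).mul_cexp_const_mul (I / 2 * τ))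
    (fun t ↦ (M.deriv_γ t).congr_deriv (by rw [hτ]; push_cast; ring)) (fun t ↦ (hne2 t).2)
    (by simp [M.height_zero, i4]) t
  have c1 : aperiodicSolution L ω₃ a p k l P Q S (x t) 0 1 = I * S (x t) := rfl
  have c2 : aperiodicSolution L ω₃ a p k l P Q S (x t) 1 0 = I * S (x t) := rfl
  ext i j
  fin_cases i <;> fin_cases j
  · simpa [Matrix.mul_apply, Fin.sum_univ_two] using E1.symm
  · simpa [Matrix.mul_apply, Fin.sum_univ_two, c1, hS] using E3.symm
  · simpa [Matrix.mul_apply, Fin.sum_univ_two, c2, hS] using E4.symm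
  · simpa [Matrix.mul_apply, Fin.sum_univ_two] using E2.symm

omit M hwm hwp ha hb hp hk hl hU hB hα hβ in
lemma differentiableOn_aperiodicSolution (hω : 2 * ω₃ ∈ L.lattice) (hU : IsPathDomain L ω₃ x U)
    (hB : AreAperiodicBranches L ω₃ e₁ b p U P Q S) (i j : Fin 2) :
    DifferentiableOn ℂ (fun z ↦ aperiodicSolution L ω₃ a p k l P Q S z i j) U := by
  have hσ := L.differentiable_weierstrassSigma
  have hP := hB.branch_P.differentiableOn
  have hQ := hB.branch_Q.differentiableOn
  have hS := hB.holo_S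
  have h1 (z : ℂ) (hz : z ∈ U) : L.weierstrassSigma (z - ω₃) ≠ 0 :=
    L.weierstrassSigma_ne_zero (hU.no_pole z hz)
  have h2 (z : ℂ) (hz : z ∈ U) : L.weierstrassSigma (z + ω₃) ≠ 0 :=
    L.weierstrassSigma_ne_zero fun h ↦ hU.no_pole z hz <| by
      have := sub_mem h hω
      rwa [show z + ω₃ - 2 * ω₃ = z - ω₃ by ring] at this
  have hq1 : DifferentiableOn ℂ (fun z ↦ L.weierstrassSigma (z - a) / L.weierstrassSigma (z - ω₃))
      U := DifferentiableOn.div (by fun_prop) (by fun_prop) h1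
  have hq2 : DifferentiableOn ℂ (fun z ↦ L.weierstrassSigma (z + a) / L.weierstrassSigma (z + ω₃))
      U := DifferentiableOn.div (by fun_prop) (by fun_prop) h2
  fin_cases i <;> fin_cases j
  · change DifferentiableOn ℂ (fun z ↦ k * exp (l * z - I * Real.pi * p) *
      (L.weierstrassSigma (z - a) / L.weierstrassSigma (z - ω₃)) * P z) U
    fun_prop
  · change DifferentiableOn ℂ (fun z ↦ I * S z) U
    fun_prop
  · change DifferentiableOn ℂ (fun z ↦ I * S z) U
    fun_prop
  · change DifferentiableOn ℂ (fun z ↦ k * exp (-(l * z) + I * Real.pi * p) *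
      (L.weierstrassSigma (z + a) / L.weierstrassSigma (z + ω₃)) * Q z) U
    fun_prop

omit hwm hwp ha hb hp hk hl hB hα hβ in
/-- Holomorphic functions on a path domain are determined by their values along the motion. -/
lemma eqOn_of_eq_on_path {f g : ℂ → ℂ} (hf : DifferentiableOn ℂ f U) (hg : DifferentiableOn ℂ g U)
    (h : ∀ t, f (x t) = g (x t)) : EqOn f g U := by
  refine (hf.analyticOnNhd hU.isOpen).eqOn_of_preconnected_of_frequently_eq
    (hg.analyticOnNhd hU.isOpen) hU.isConnected.isPreconnected (hU.path_mem 0) ?_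
  -- Nonzero speed at t = 0 makes x(0) an accumulation point of the other points of the path.
  have hd : -I * (T.paramSpeed (height (Φ 0)) : ℂ) ≠ 0 := by
    have := M.paramSpeed_pos M.lt_e₁ 0
    exact mul_ne_zero (by simp) (by exact_mod_cast this.ne')
  have htend : Tendsto x (𝓝[≠] 0) (𝓝[≠] (x 0)) := (M.deriv_x 0).tendsto_nhdsNE hd
  exact htend.frequently (Eventually.of_forall h).frequently

end UniformizedMotion
end ToyTop

/-! ### Existence of a path domain with branches -/

/-- A primitive of f'/f on the disc, normalized at 0, is a logarithm of f. -/
lemma exists_log_on_ball {f : ℂ → ℂ} {r : ℝ} (hr : 0 < r)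
    (hf : DifferentiableOn ℂ f (Metric.ball 0 r)) (hne : ∀ z ∈ Metric.ball 0 r, f z ≠ 0) {c : ℂ}
    (hc : exp c = f 0) : ∃ ℓ : ℂ → ℂ, DifferentiableOn ℂ ℓ (Metric.ball 0 r) ∧
      (∀ z ∈ Metric.ball 0 r, exp (ℓ z) = f z) ∧ ℓ 0 = c := by
  have hd : DifferentiableOn ℂ (deriv f) (Metric.ball 0 r) := hf.deriv Metric.isOpen_ball
  obtain ⟨ℓ, h0, hℓ⟩ := (hd.div hf hne).isExactOn_ball.with_val_at 0 c
  refine ⟨ℓ, fun z hz ↦ (hℓ z hz).differentiableAt.differentiableWithinAt, fun z hz ↦ ?_, h0⟩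
  have h1 (z : ℂ) (hz : z ∈ Metric.ball 0 r) : HasDerivAt (fun z ↦ exp (ℓ z) / f z) 0 z := by
    have h2 := ((hf z hz).differentiableAt (Metric.isOpen_ball.mem_nhds hz)).hasDerivAt
    refine ((hℓ z hz).cexp.div h2 (hne z hz)).congr_deriv ?_
    have := hne z hz
    simp only [Pi.div_apply]
    field_simp
    ring
  have h3 := Metric.isOpen_ball.is_const_of_deriv_eq_zero
    (convex_ball (0 : ℂ) r).isPreconnected
    (fun z hz ↦ (h1 z hz).differentiableAt.differentiableWithinAt) (fun z hz ↦ (h1 z hz).deriv) hz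
    (Metric.mem_ball_self hr)
  rw [h0, hc, div_self (hne 0 (Metric.mem_ball_self hr)), div_eq_one_iff_eq (hne z hz)] at h3
  exact h3

namespace PeriodPair.IsRectangular

variable {L : PeriodPair} {η η' : ℝ} (h : L.IsRectangular η η')
include h

lemma notMem_of_abs_im_lt {z : ℂ} (h0 : z.im ≠ 0) (hz : |z.im| < 2 * η') : z ∉ L.lattice := by
  have hη := h.pos'
  obtain ⟨h1, h2⟩ := abs_lt.1 hz
  rcases h0.lt_or_gt with h0 | h0
  · refine h.notMem_of_im (n := -1) (x := 2 + z.im / η') ⟨?_, ?_⟩ (by push_cast; field_simp; ring)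
    · have : -2 < z.im / η' := by rw [lt_div_iff₀ hη]; linarith
      linarith
    · linarith [div_neg_of_neg_of_pos h0 hη]
  · exact h.notMem_of_im (n := 0) (x := z.im / η') ⟨div_pos h0 hη, by rwa [div_lt_iff₀ hη]⟩
      (by push_cast; field_simp; ring)

end PeriodPair.IsRectangular

/-- The domain is the disc of radius r about 0, where ±ir are points over u = 1 on the imaginary
axis. The motion cannot pass them because u < 1. Modulo the lattice b is one of these points, so σ(x
+ b) and σ(x - b) have no zeros in the disc, and logarithms exist. -/
theorem exists_pathDomain_branches {L : PeriodPair} {e₁ e₄ η η' : ℝ} (he₁ : e₁ < 1) (he₄ : 1 < e₄)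
    (h : L.IsUniformization e₁ e₄ η η') {b wp p : ℂ} (hwp : wp ≠ 0)
    (hb : L.weierstrassP (b - (-(I * η') + η)) + e₁ / 3 = 1 ∧
      L.derivWeierstrassP (b - (-(I * η') + η)) = wp) {y u : ℝ → ℝ} {x : ℝ → ℂ}
    (hx : ∀ t, x t = -I * y t) (hy : Continuous y) (hy0 : y 0 = 0) (hu : ∀ t, u t < 1)
    (hux : ∀ t, L.weierstrassP (x t - (-(I * η') + η)) + e₁ / 3 = u t) :
    ∃ U P Q S, IsPathDomain L (-(I * η') + η) x U ∧
      AreAperiodicBranches L (-(I * η') + η) e₁ b p U P Q S := by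
  obtain ⟨V, G, hV, -, hVd, -, hV0, -, hV1, hVe, -⟩ := h.exists_vertical
  have hVc : Continuous V := continuous_iff_continuousAt.2 fun y ↦ (hVd y).continuousAt
  -- V runs from e₁ < 1 at 0 to e₄ > 1 at η'.
  obtain ⟨r, hr, hr1⟩ := exists_mem_Ioo_eq_of_mem_Ioo (v := 1) h.pos' hVc.continuousOn
    (Or.inl ⟨by rwa [hV0], by rwa [hV1]⟩)
  set ω₃ : ℂ := -(I * η') + η with hω₃
  have h2ω : 2 * ω₃ ∈ L.lattice := h.two_mul_half₃_mem
  have hBn : b - ω₃ ∉ L.lattice := PeriodPair.notMem_of_derivWeierstrassP_ne_zero (hb.2 ▸ hwp)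
  have hsmall (t : ℝ) : |y t| < r := by
    by_contra! hcon
    obtain ⟨s, hs⟩ := intermediate_value_univ 0 t hy.abs
      (show r ∈ Icc |y 0| |y t| from ⟨by simpa [hy0] using hr.1.le, hcon⟩)
    replace hs : |y s| = r := hs
    have h1 := hux s
    rw [hx, hV] at h1
    have h2 : V (y s) = 1 := by
      rcases abs_choice (y s) with h3 | h3
      · rw [← h3, hs, hr1]
      · rw [← neg_neg (y s), ← h3, hs, hVe, hr1]
    rw [h2] at h1
    exact (hu s).ne' (by exact_mod_cast h1)
  have him (w : ℂ) (hw : w ∈ Metric.ball 0 r) : |w.im| < r :=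
    (abs_im_le_norm w).trans_lt (by simpa using hw)
  have hpole (w : ℂ) (hw : w ∈ Metric.ball 0 r) : w - ω₃ ∉ L.lattice := by
    have h1 := abs_lt.1 (him w hw)
    have h2 : (w - ω₃).im = w.im + η' := by simp [hω₃]
    refine h.notMem_of_abs_im_lt ?_ ?_
    · rw [h2]; linarith [hr.2]
    · rw [h2, abs_lt]; constructor <;> linarith [hr.1, hr.2]
  -- The imaginary part is nonzero and smaller than 2r < 2η' in absolute value, while lattice points
  -- have imaginary parts in 2η'ℤ.
  have hr2 (w : ℂ) (hw : w ∈ Metric.ball 0 r) :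
      w + -I * (r : ℂ) ∉ L.lattice ∧ w - -I * (r : ℂ) ∉ L.lattice := by
    have h1 := abs_lt.1 (him w hw)
    constructor <;> refine h.notMem_of_abs_im_lt ?_ ?_ <;>
      simp only [neg_mul, sub_neg_eq_add, add_im, neg_im, mul_im, I_re, I_im, ofReal_re, ofReal_im]
    · linarith
    · rw [abs_lt]; constructor <;> linarith [hr.1, hr.2]
    · linarith
    · rw [abs_lt]; constructor <;> linarith [hr.1, hr.2]
  have hb1 : -I * (r : ℂ) + b ∈ L.lattice ∨ -I * (r : ℂ) - b ∈ L.lattice := by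
    have h1 : L.weierstrassP (-I * (r : ℂ) - ω₃) = L.weierstrassP (b - ω₃) := by
      have h2 := hV r
      rw [hr1, ofReal_one, ← hb.1] at h2
      exact add_right_cancel h2
    refine ((L.weierstrassP_eq_iff (h.vertical_notMem r) hBn).1 h1).imp (fun h3 ↦ ?_) fun h3 ↦ ?_
    · have := add_mem h3 h2ω
      rwa [show -I * (r : ℂ) - ω₃ + (b - ω₃) + 2 * ω₃ = -I * (r : ℂ) + b by ring] at this
    · rwa [show -I * (r : ℂ) - ω₃ - (b - ω₃) = -I * (r : ℂ) - b by ring] at h3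
  have hb2 (w : ℂ) (hw : w ∈ Metric.ball 0 r) : w + b ∉ L.lattice ∧ w - b ∉ L.lattice := by
    obtain ⟨h1, h2⟩ := hr2 w hw
    rcases hb1 with h3 | h3
    · refine ⟨fun h4 ↦ h2 ?_, fun h4 ↦ h1 ?_⟩
      · have := sub_mem h4 h3
        rwa [show w + b - (-I * (r : ℂ) + b) = w - -I * (r : ℂ) by ring] at this
      · have := add_mem h4 h3
        rwa [show w - b + (-I * (r : ℂ) + b) = w + -I * (r : ℂ) by ring] at this
    · refine ⟨fun h4 ↦ h1 ?_, fun h4 ↦ h2 ?_⟩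
      · have := add_mem h4 h3
        rwa [show w + b + (-I * (r : ℂ) - b) = w + -I * (r : ℂ) by ring] at this
      · have := sub_mem h4 h3
        rwa [show w - b - (-I * (r : ℂ) - b) = w - -I * (r : ℂ) by ring] at this
  have hmem0 : (0 : ℂ) ∈ Metric.ball 0 r := Metric.mem_ball_self hr.1
  have hσ := L.differentiable_weierstrassSigma
  have hσ1 (w : ℂ) (hw : w ∈ Metric.ball 0 r) := L.weierstrassSigma_ne_zero (hb2 w hw).1
  have hσ2 (w : ℂ) (hw : w ∈ Metric.ball 0 r) := L.weierstrassSigma_ne_zero (hb2 w hw).2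
  have hσ0 : L.weierstrassSigma b ≠ 0 := by simpa using hσ1 0 hmem0
  -- At 0 the quotient is σ(b)/σ(-b) = -1 = exp(iπ), which accounts for the branch value exp(iπp).
  obtain ⟨ℓ₁, d1, E1, z1⟩ := exists_log_on_ball hr.1
    (f := fun x ↦ L.weierstrassSigma (x + b) / L.weierstrassSigma (x - b))
    (DifferentiableOn.div (by fun_prop) (by fun_prop) hσ2)
    (fun w hw ↦ div_ne_zero (hσ1 w hw) (hσ2 w hw)) (c := Real.pi * I)
    (by simp [exp_pi_mul_I, L.weierstrassSigma_neg, hσ0])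
  obtain ⟨ℓ₂, d2, E2, z2⟩ := exists_log_on_ball hr.1
    (f := fun x ↦ L.weierstrassSigma (x - b) / L.weierstrassSigma (x + b))
    (DifferentiableOn.div (by fun_prop) (by fun_prop) hσ1)
    (fun w hw ↦ div_ne_zero (hσ2 w hw) (hσ1 w hw)) (c := -(Real.pi * I))
    (by simp [Complex.exp_neg, exp_pi_mul_I, L.weierstrassSigma_neg, hσ0])
  have hu1 (w : ℂ) (hw : w ∈ Metric.ball 0 r) :
      (1 - (L.weierstrassP (w - ω₃) + e₁ / 3)) / 2 ≠ 0 := by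
    refine div_ne_zero (fun h1 ↦ ?_) two_ne_zero
    have h2 : L.weierstrassP (w - ω₃) = L.weierstrassP (b - ω₃) := by
      linear_combination -h1 - hb.1
    rcases (L.weierstrassP_eq_iff (hpole w hw) hBn).1 h2 with h3 | h3
    · refine (hb2 w hw).1 ?_
      have := add_mem h3 h2ω
      rwa [show w - ω₃ + (b - ω₃) + 2 * ω₃ = w + b by ring] at this
    · exact (hb2 w hw).2 (by rwa [show w - ω₃ - (b - ω₃) = w - b by ring] at h3)
  have hpos : 0 < (1 - e₁) / 2 := by linarith
  obtain ⟨ℓ₃, d3, E3, z3⟩ := exists_log_on_ball hr.1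
    (f := fun w ↦ (1 - (L.weierstrassP (w - ω₃) + e₁ / 3)) / 2) (fun w hw ↦ by
      have := ((L.hasDerivAt_weierstrassP (hpole w hw)).comp_sub_const w ω₃).differentiableAt
      exact DifferentiableAt.differentiableWithinAt (by fun_prop)) hu1
    (c := (Real.log ((1 - e₁) / 2) : ℝ)) (by
      rw [← ofReal_exp, Real.exp_log hpos, zero_sub, L.weierstrassP_neg, h.half₃]
      push_cast; rfl)
  refine ⟨Metric.ball 0 r, fun w ↦ exp (p * ℓ₁ w), fun w ↦ exp (p * ℓ₂ w),
    fun w ↦ exp (1 / 2 * ℓ₃ w), ⟨Metric.isOpen_ball, Metric.isConnected_ball hr.1, fun t ↦ ?_, hpole⟩,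
    ⟨ℓ₁, d1, fun w hw ↦ ⟨E1 w hw, rfl⟩⟩, ⟨ℓ₂, d2, fun w hw ↦ ⟨E2 w hw, rfl⟩⟩,
    (d3.const_mul _).cexp, fun w hw ↦ ?_, ?_, ?_, ?_⟩
  · rw [hx]
    simpa using hsmall t
  · rw [← E3 w hw, ← exp_nat_mul]
    congr 1
    push_cast; ring
  · simp only [z1]; ring_nf
  · simp only [z2]; ring_nf
  · simp only [z3]
    rw [Real.sqrt_eq_rpow, Real.rpow_def_of_pos hpos, ofReal_exp]
    push_cast
    ring_nf

end

/-! ### The proposition on the aperiodic motion -/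

theorem mainTheorem5 (T : ToyTop) (Φ ω : ℝ → Matrix (Fin 2) (Fin 2) ℂ) (hΦ : T.IsMotion Φ ω)
    -- the aperiodic case `e₂ = e₃ = 1`
    (e₁ : ℝ) (he₁ : -1 < e₁) (he₁' : e₁ < 1)
    (hdyn : T.HasDynamicalConstants (Φ 0) (ω 0) e₁ 1 1)
    -- initial conditions: `u = e₁`, `α₀` real and positive, `β₀` imaginary, positive imaginary part
    (hu₀ : ToyTop.height (Φ 0) = e₁)
    (hα₀ : 0 < (Φ 0 0 0).re ∧ (Φ 0 0 0).im = 0)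
    (hβ₀ : (Φ 0 0 1).re = 0 ∧ 0 < (Φ 0 0 1).im)
    -- the period lattice and the half period `ω₃`
    (L : PeriodPair) (hL : L = T.periodPair he₁ he₁')
    (ω₃ : ℂ) (hω₃ : ω₃ = T.halfPeriod₃ e₁)
    -- the values of `w` over `u = -1` (its sign is determined by the motion) and over `u = 1`
    (wm wp : ℂ)
    (hwm : wm = ((√(T.s / 2) * (1 - T.e₄ ^ 2) *
      ((T.vertMomentum (Φ 0) (ω 0) + T.axisMomentum (Φ 0) (ω 0)) / T.A) : ℝ) : ℂ))
    (hwp : wp ^ 2 = (T.aperPoly e₁ 1 : ℂ))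
    -- points of the `x`-plane over `(u, w) = (-1, wm)` and `(u, w) = (1, wp)`
    (a b : ℂ)
    (ha : L.weierstrassP (a - ω₃) + e₁ / 3 = -1 ∧ L.derivWeierstrassP (a - ω₃) = wm)
    (hb : L.weierstrassP (b - ω₃) + e₁ / 3 = 1 ∧ L.derivWeierstrassP (b - ω₃) = wp)
    -- the constants
    (p k l : ℂ)
    (hp : p = wm / (2 * wp))
    (hk : k = (√((1 + e₁) / 2) : ℂ) * (L.weierstrassSigma ω₃ / L.weierstrassSigma a))
    (hl : l = wm / 4 - wm / (1 - (T.e₄ : ℂ) ^ 2) + L.weierstrassZeta (a - ω₃)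
      - p * (L.weierstrassZeta (a + b) - L.weierstrassZeta (a - b)))
    -- the uniformizing variable along the motion, and the rotation about the top's axis
    -- (trivial for `A = C`)
    (x : ℝ → ℂ) (hx : x = T.uniformizer Φ)
    (D : ℝ → Matrix (Fin 2) (Fin 2) ℂ)
    (hD : D = fun t : ℝ => !![exp (I / 2 * T.spin (Φ 0) (ω 0) * t), 0;
      0, exp (-(I / 2 * T.spin (Φ 0) (ω 0) * t))]) :
    (∀ t, (ToyTop.height (Φ t) : ℂ) = L.weierstrassP (x t - ω₃) + e₁ / 3) ∧
    (∃ U P Q S, IsPathDomain L ω₃ x U ∧ AreAperiodicBranches L ω₃ e₁ b p U P Q S) ∧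
    ∀ U P Q S, IsPathDomain L ω₃ x U → AreAperiodicBranches L ω₃ e₁ b p U P Q S →
      (∀ t, Φ t = aperiodicSolution L ω₃ a p k l P Q S (x t) * D t ∧
        S (x t) = (√((1 - ToyTop.height (Φ t)) / 2) : ℂ)) ∧
      (∀ i j, DifferentiableOn ℂ (fun z => aperiodicSolution L ω₃ a p k l P Q S z i j) U) ∧
      ∀ Ψ : ℂ → Matrix (Fin 2) (Fin 2) ℂ, (∀ i j, DifferentiableOn ℂ (fun z => Ψ z i j) U) →
        (∀ t, Φ t = Ψ (x t) * D t) →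
        ∀ z ∈ U, Ψ z = aperiodicSolution L ω₃ a p k l P Q S z := by
  subst hL hω₃ hx hD
  obtain ⟨η, η', h, hω⟩ := T.exists_isUniformization he₁ he₁'
  set L := T.periodPair he₁ he₁'
  set ω₃ := T.halfPeriod₃ e₁
  obtain ⟨hvert, z, M⟩ := hΦ.aperiodicMotion he₁ he₁' hdyn hu₀
  set n := T.axisMomentum (Φ 0) (ω 0) with hn
  obtain ⟨y, hxy, hy0, hy⟩ := M.exists_uniformizer_eq he₁
  obtain ⟨V, G, hV, hG, hVd, hGd, hV0, hG0, -, -, K, hK⟩ := h.exists_vertical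
  have hVG := M.height_eq_of_hasDerivAt he₁ hu₀ hy0 hy hVd hGd hV0 hG0 hK
  rw [← hω] at hV hG
  have hheight (t : ℝ) : L.weierstrassP (T.uniformizer Φ t - ω₃) + e₁ / 3 =
      ToyTop.height (Φ t) := by rw [hxy, hV, (hVG t).1]
  have M' : T.UniformizedMotion Φ e₁ n L ω₃ (T.uniformizer Φ) z :=
    { toAperiodicMotion := M
      lt_e₁ := he₁
      two_mul_mem := hω ▸ h.two_mul_half₃_mem
      x_zero := by simp [hxy, hy0]
      height_zero := hu₀
      notMem := fun t ↦ by rw [hxy, hω]; exact h.vertical_notMem (y t)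
      deriv_x := fun t ↦ by
        rw [funext hxy]
        exact (hy t).ofReal_comp.const_mul (-I)
      height_eq := hheight
      z_eq := fun t ↦ by
        rw [hxy, hG, (hVG t).2]
        push_cast
        linear_combination -(T.paramSpeed (ToyTop.height (Φ t)) : ℂ) * G (y t) * I_sq }
  -- Since λ = n, the sum λ + n in wm is 2n, and the factor 2 turns √(s/2) into √(2s).
  have hs : √(2 * T.s) = 2 * √(T.s / 2) := by
    rw [show 2 * T.s = 2 ^ 2 * (T.s / 2) by ring, Real.sqrt_mul (by norm_num),
      Real.sqrt_sq (by norm_num)]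
  have hwm' : wm = ((√(2 * T.s) * (1 - T.e₄ ^ 2) * (n / T.A) : ℝ) : ℂ) := by
    rw [hwm, hvert, hs]
    congr 1
    ring
  have hwp' : wp ≠ 0 := by
    rintro rfl
    have h4 := T.one_lt_e₄
    have h5 : T.aperPoly e₁ 1 ≠ 0 := by
      rw [ToyTop.aperPoly]
      exact mul_ne_zero (by linarith) (by nlinarith)
    rw [zero_pow two_ne_zero, eq_comm, ofReal_eq_zero] at hwp
    exact h5 hwp
  refine ⟨fun t ↦ (hheight t).symm, ?_, fun U P Q S hU hB ↦ ?_⟩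
  · rw [hω] at hb hheight ⊢
    exact exists_pathDomain_branches he₁' T.one_lt_e₄ h hwp' hb hxy
      (continuous_iff_continuousAt.2 fun t ↦ (hy t).continuousAt) hy0 M.height_lt hheight
  have hsol := M'.eq_aperiodicSolution_mul hwm' hwp' ha hb hp hk hl hU hB hα₀ hβ₀
    (τ := T.spin (Φ 0) (ω 0)) rfl
  have hdiff := ToyTop.UniformizedMotion.differentiableOn_aperiodicSolution (a := a) (k := k)
    (l := l) M'.two_mul_mem hU hB
  refine ⟨fun t ↦ ⟨hsol t, M'.branch_sqrt_eq hU hB t⟩, hdiff, fun Ψ hΨ hΦΨ w hw ↦ ?_⟩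
  ext i j
  refine M'.eqOn_of_eq_on_path hU (hΨ i j) (hdiff i j) (fun t ↦ ?_) hw
  -- The rotation is invertible, so it can be cancelled on the right, and both matrices agree along
  -- the path.
  have hdet : IsUnit !![exp (I / 2 * T.spin (Φ 0) (ω 0) * t), 0;
      0, exp (-(I / 2 * T.spin (Φ 0) (ω 0) * t))] := by
    rw [Matrix.isUnit_iff_isUnit_det, Matrix.det_fin_two_of, ← exp_add]
    simp
  exact congrFun (congrFun (hdet.mul_left_injective ((hΦΨ t).symm.trans (hsol t))) i) j
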